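/- **Adaptable separated graphs.** Let $E=(E^0,E^1,s,r)$ be a directed graph and let $C=\bigsqcup_{v\in E^0}C_v$, where each $C_v$ is a partition of $s^{-1}(v)$ into non-empty finite sets. Write $v\le w$ if there is a directed path from $w$ to $v$, and let $I=E^0/{\sim}$ be the associated poset of strongly connected components. For $p\in I$ let $E_p$ be the subgraph formed by the vertices of class $p$ and the edges between them. Assume that $(E,C)$ is *adaptable*: $I$ is finite and $I=I_{\rm free}\sqcup I_{\rm reg}$, where * if $p\in I_{\rm reg}$ and $w\in E_p^0$, then $|C_w|=1$ and $w$ emits at least two edges of $E_p$; * if $p\in I_{\rm free}$, then $E_p^0=\{v^p\}$; the vertex $v^p$ emits no edges if and only if $p$ is minimal in $I$; and $C_{v^p}=\{X_1^{(p)},\dots,X_{k(p)}^{(p)}\}$ (with $k(p)=0$ if $p$ is minimal), where $X^{(p)}_i=\{\alpha(p,i),\beta(p,i,1),\dots,\beta(p,i,g(p,i))\}$ with $g(p,i)\ge1$, $\alpha(p,i)$ is a loop at $v^p$, and $[r(\beta(p,i,t))]<p$. Fix such enumerations. A *connector* is an edge $\beta$ with $[r(\beta)]<[s(\beta)]$.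 For $p\in I_{\rm free}$ non-minimal put $\sigma^p(i)=i+k(p)-1$, and let $\sigma^p_j$ be the increasing bijection $\{1,\dots,k(p)\}\setminus\{j\}\to\{1,\dots,k(p)-1\}$. **The algebra $\mathcal S_K(E,C)$.** Let $K$ be a field. $\mathcal S_K(E,C)$ is the (not necessarily unital) $*$-algebra over $K$ with generators $E^0\cup E^1\cup\{(t_i^v)^{\pm1}: i\ge1,\ v\in E^0\}$ subject to the following relations and their adjoints: * $vw=\delta_{v,w}v$, $v^*=v$; $e=s(e)e=e\,r(e)$, $e^*e=r(e)$; $e^*f=0$ if $e\neq f$ lie in the same $X\in C$; $v=\sum_{e\in X}ee^*$ for $X\in C_v$; * for $p$ free and $i\ne j$: $\alpha(p,i)$ commutes with $\alpha(p,j)$ and $\alpha(p,j)^*$, and $\beta(p,i,s)^*\beta(p,j,t)=0$; * the $(t_i^v)^{\pm1}$, $i\ge1$, commute with each other, $vt_i^v=t_i^v=t_i^vv$, $t_i^v(t_i^v)^{-1}=v=(t_i^v)^{-1}t_i^v$, $(t_i^v)^*=(t_i^v)^{-1}$; * $t_i^{s(e)}e=e\,t_i^{r(e)}$ if $[s(e)]$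 is regular; * for $p$ free: $(t_i^{v^p})^{\pm1}\beta(p,j,s)=\beta(p,j,s)(t^{r(\beta(p,j,s))}_{\sigma^p(i)})^{\pm1}$; $t_i^{v^p}$ commutes with $\alpha(p,j)$ and $\alpha(p,j)^*$; and, for $i\ne j$, $\alpha(p,i)\beta(p,j,s)=\beta(p,j,s)\,t^{r(\beta(p,j,s))}_{\sigma^p_j(i)}$ and $\alpha(p,i)^*\beta(p,j,s)=\beta(p,j,s)(t^{r(\beta(p,j,s))}_{\sigma^p_j(i)})^{-1}$. **The algebra $Q_K(E,C)$.** For a $K$-algebra $R$ and a set $\Sigma$ of square matrices $A$ over corners $eRe$ ($e=e^2$, depending on $A$), let $R\Sigma^{-1}$ be the ideal generated by $R$ in the universal localization of the unitization $R^1$ at the matrices $(1-e)\mathrm{Id}+A$. Let $\mathcal S^1_K(E,C)$ be the universal localization of $\mathcal S_K(E,C)$ at the elements $f(t_1^v,t_2^v,\dots)$ of the corners $v\mathcal S_K(E,C)v$, where $v\in E^0$ and $0\ne f\in K[t_1,t_2,\dots]$. Thus $L=K(t_1,t_2,\dots)$ maps to each corner $v\mathcal S^1_K(E,C)v$ by $t_i\mapsto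 t_i^v$. For $p$ free let $\Sigma(p)\subseteq v^p\mathcal S^1_K(E,C)v^p$ be the set of all $f(\alpha(p,1),\dots,\alpha(p,k(p)))$ with $0\ne f\in L[x_1,\dots,x_{k(p)}]$ not divisible by any $x_i$. For $p$ regular let $\Sigma(p)$ be the set of all square matrices over path algebras $P_L(F)$, $F$ a finite complete subgraph of $E_p$ (if $F$ contains one edge of $E_p$ with a given source, it contains all of them), whose image under the augmentation $P_L(F)\to\bigoplus_{v\in F^0}vL$ is invertible; these are matrices over the corner with unit $\sum_{v\in F^0}v$. Put $$Q_K(E,C)=\mathcal S^1_K(E,C)\Big(\bigcup_{p\in I}\Sigma(p)\Big)^{-1}.$$ For $p$ regular, let $P_L^{\rm rat}(E_p)=P_L(E_p)\Sigma(p)^{-1}$ be the algebra of rational series over $E_p$; it maps canonically to $Q_K(E,C)$. **Paths and monomials.** Let $v\in E_p^0$ and $w\in E_q^0$ with $q<p$. A *step* from $v$ to $w$ is an element of $Q_K(E,C)$ of the form $f^{-1}\alpha(p,i)^m\beta(p,i,t)$, with $f\in\Sigma(p)$, $m\ge0$, $r(\beta(p,i,t))=w$, if $p$ is free, and of the form $f\beta$,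 with $\beta$ a connector from some $v'\in E_p^0$ to $w$ and $0\ne f\in vP_L^{\rm rat}(E_p)v'$, if $p$ is regular. A *fractional c-path* is a vertex or a product $\hat\gamma_{v_0,v_1}\cdots\hat\gamma_{v_{n-1},v_n}$ of consecutive steps. A *c-path* is a vertex or a directed path in $E$ that is a concatenation of consecutive steps of the form $\alpha(p,i)^m\beta(p,i,t)$ (with $p$ free, $m\ge 0$) or $\lambda\beta$ (with $p$ regular, $\lambda$ a directed path in $E_p$, and $\beta$ a connector starting at $r(\lambda)$). A *fractional monomial* $\mathbf m(p)$ at $p$ is an element of the form $f^{-1}\prod_{j=1}^{k(p)}\alpha(p,j)^{k_j}(\alpha(p,j)^*)^{l_j}$ with $f\in\Sigma(p)$ and $k_j,l_j\ge0$ (an empty product being $v^p$), if $p$ is free; and of the form $f\nu^*$, with $0\ne f\in vP_L^{\rm rat}(E_p)v'$ for some $v,v'\in E_p^0$ and $\nu$ a directed path in $E_p$ with $r(\nu)=v'$, if $p$ is regular. **Theorem.** Let $(E,C)$ be an adaptable separated graph and let $K$ be a field. Then $Q_K(E,C)$ is the $K$-linear span of the elements $\gamma\,\mathbf m(p)\,\nu^*$,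 where $\gamma$ is a fractional c-path, $\mathbf m(p)$ is a fractional monomial at some $p\in I$, and $\nu$ is a c-path. -/

import Mathlib

noncomputable section

/-! ### Products, corners and inverses in non-unital rings -/

/-- `powMul x m y = x ^ m * y`, in a ring that need not have a unit. -/
def powMul {R : Type*} [Mul R] (x : R) (m : ℕ) (y : R) : R :=
  (fun z => x * z)^[m] y

/-- The value of the monomial `m` at the (commuting) elements `x i` of a corner with unit `e`. -/
def monomialEval {ι R : Type*} [LinearOrder ι] [Mul R] (e : R) (x : ι → R) (m : ι →₀ ℕ) : R :=
  (m.support.sort (· ≤ ·)).foldr (fun i y => powMul (x i) (m i) y) e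

/-- `y` is the inverse of `x` in the corner `e R e`. -/
def IsCornerInv {R : Type*} [Mul R] (e x y : R) : Prop :=
  e * y = y ∧ y * e = y ∧ x * y = e ∧ y * x = e

open Classical in
/-- The inverse of `x` in the corner `e R e` (and `0` if there is none; below it is only used for
elements that have been inverted). -/
def cornerInv {R : Type*} [Mul R] [Zero R] (e x : R) : R :=
  if h : ∃ y, IsCornerInv e x y then h.choose else 0

/-! ### Universal localization -/

/-- Square matrices of arbitrary size. -/
abbrev SqMat (A : Type*) := Σ n : ℕ, Matrix (Fin n) (Fin n) A

namespace UnivLoc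

variable {K A : Type*} [Field K] [Ring A] [Algebra K A]

/-- Generators of the universal localization of `A` at `S`: the elements of `A` and, for every
matrix in `S`, the entries of an inverse. -/
abbrev Gen (S : Set (SqMat A)) := A ⊕ (Σ M : S, Fin M.1.1 × Fin M.1.1)

/-- The generator attached to an element of `A`. -/
def gA (K : Type*) [Field K] (S : Set (SqMat A)) (a : A) : FreeAlgebra K (Gen S) :=
  FreeAlgebra.ι K (Sum.inl a)

/-- The generator attached to an entry of the inverse of the matrix `M`. -/
def gI (K : Type*) [Field K] (S : Set (SqMat A)) (M : S) (i j : Fin M.1.1) :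
    FreeAlgebra K (Gen S) :=
  FreeAlgebra.ι K (Sum.inr ⟨M, i, j⟩)

/-- Relations: those of `A`, and the invertibility of the matrices in `S`. -/
inductive Rel (K : Type*) {A : Type*} [Field K] [Ring A] [Algebra K A] (S : Set (SqMat A)) :
    FreeAlgebra K (Gen S) → FreeAlgebra K (Gen S) → Prop
  | add (a b : A) : Rel K S (gA K S (a + b)) (gA K S a + gA K S b)
  | mul (a b : A) : Rel K S (gA K S (a * b)) (gA K S a * gA K S b)
  | scalar (c : K) : Rel K S (gA K S (algebraMap K A c)) (algebraMap K _ c)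
  | mul_inv (M : S) (i j : Fin M.1.1) :
      Rel K S (∑ k, gA K S (M.1.2 i k) * gI K S M k j) (if i = j then 1 else 0)
  | inv_mul (M : S) (i j : Fin M.1.1) :
      Rel K S (∑ k, gI K S M i k * gA K S (M.1.2 k j)) (if i = j then 1 else 0)

end UnivLoc

/-- The universal localization `A S⁻¹` of a unital `K`-algebra at a set of square matrices. -/
def UnivLoc (K : Type*) {A : Type*} [Field K] [Ring A] [Algebra K A] (S : Set (SqMat A)) :=
  RingQuot (UnivLoc.Rel K S)

instance {K A : Type*} [Field K] [Ring A] [Algebra K A] (S : Set (SqMat A)) :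
    Ring (UnivLoc K S) := inferInstanceAs (Ring (RingQuot (UnivLoc.Rel K S)))

instance {K A : Type*} [Field K] [Ring A] [Algebra K A] (S : Set (SqMat A)) :
    Algebra K (UnivLoc K S) := inferInstanceAs (Algebra K (RingQuot (UnivLoc.Rel K S)))

namespace UnivLoc

variable {K A : Type*} [Field K] [Ring A] [Algebra K A]

/-- The projection from the free algebra. -/
def mk (K : Type*) {A : Type*} [Field K] [Ring A] [Algebra K A] (S : Set (SqMat A)) :
    FreeAlgebra K (Gen S) →ₐ[K] UnivLoc K S :=
  RingQuot.mkAlgHom K (Rel K S)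

theorem mk_rel {S : Set (SqMat A)} {x y : FreeAlgebra K (Gen S)} (h : Rel K S x y) :
    mk K S x = mk K S y :=
  RingQuot.mkAlgHom_rel K h

/-- The canonical map `A → A S⁻¹`. -/
def of (K : Type*) {A : Type*} [Field K] [Ring A] [Algebra K A] (S : Set (SqMat A)) :
    A →ₐ[K] UnivLoc K S :=
  AlgHom.ofLinearMap
    { toFun := fun a => mk K S (gA K S a)
      map_add' := fun a b => by
        rw [mk_rel (Rel.add a b), map_add]
      map_smul' := fun c a => by
        rw [Algebra.smul_def, mk_rel (Rel.mul _ a), map_mul,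
          mk_rel (Rel.scalar c), AlgHom.commutes, RingHom.id_apply,
          Algebra.smul_def] }
    (by
      have h := mk_rel (Rel.scalar (K := K) (S := S) 1)
      simpa using h)
    (fun a b => by
      have h := mk_rel (Rel.mul (K := K) (S := S) a b)
      simpa using h)

/-- The universal property of `A S⁻¹` (existence part). -/
def lift {B : Type*} [Ring B] [Algebra K B] {S : Set (SqMat A)} (f : A →ₐ[K] B)
    (h : ∀ M : S, IsUnit (M.1.2.map f)) : UnivLoc K S →ₐ[K] B :=
  RingQuot.liftAlgHom K ⟨FreeAlgebra.lift K
    (Sum.elim f fun x => ((h x.1).unit⁻¹ : (Matrix _ _ B)ˣ).1 x.2.1 x.2.2), by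
      intro x y hxy
      cases hxy with
      | add a b => simp [gA]
      | mul a b => simp [gA]
      | scalar c => simp [gA]
      | mul_inv M i j =>
        have := congrFun (congrFun (h M).mul_val_inv i) j
        rw [Matrix.mul_apply, Matrix.one_apply] at this
        simp only [map_sum, map_mul, gA, gI, FreeAlgebra.lift_ι_apply, Sum.elim_inl, Sum.elim_inr]
        rw [apply_ite (FreeAlgebra.lift K _), map_one, map_zero]
        exact this
      | inv_mul M i j =>
        have := congrFun (congrFun (h M).val_inv_mul i) j
        rw [Matrix.mul_apply, Matrix.one_apply] at this
        simp only [map_sum, map_mul, gA, gI, FreeAlgebra.lift_ι_apply, Sum.elim_inl, Sum.elim_inr]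
        rw [apply_ite (FreeAlgebra.lift K _), map_one, map_zero]
        exact this⟩

theorem lift_of {B : Type*} [Ring B] [Algebra K B] {S : Set (SqMat A)} (f : A →ₐ[K] B)
    (h : ∀ M : S, IsUnit (M.1.2.map f)) (a : A) : lift f h (of K S a) = f a := by
  
  change RingQuot.liftAlgHom K _ (RingQuot.mkAlgHom K (Rel K S) (gA K S a)) = f a
  rw [RingQuot.liftAlgHom_mkAlgHom_apply]
  simp [gA]

theorem isUnit_map_of {S : Set (SqMat A)} {M : SqMat A} (hM : M ∈ S) :
    IsUnit (M.2.map (of K S)) := by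
  let N : Matrix (Fin M.1) (Fin M.1) (UnivLoc K S) := fun i j =>
    mk K S (gI K S ⟨M, hM⟩ i j)
  have h1 : M.2.map (of K S) * N = 1 := by
    ext i j
    have h := mk_rel (Rel.mul_inv (K := K) (S := S) ⟨M, hM⟩ i j)
    rw [map_sum, apply_ite (mk K S), map_one, map_zero] at h
    rw [Matrix.mul_apply, Matrix.one_apply, ← h]
    exact Finset.sum_congr rfl fun k _ => (map_mul (mk K S) _ _).symm
  have h2 : N * M.2.map (of K S) = 1 := by
    ext i j
    have h := mk_rel (Rel.inv_mul (K := K) (S := S) ⟨M, hM⟩ i j)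
    rw [map_sum, apply_ite (mk K S), map_one, map_zero] at h
    rw [Matrix.mul_apply, Matrix.one_apply, ← h]
    exact Finset.sum_congr rfl fun k _ => (map_mul (mk K S) _ _).symm
  exact ⟨⟨_, N, h1, h2⟩, rfl⟩

end UnivLoc

/-- A square matrix `A` to be inverted over the corner `e R e` (its entries lie in `e R e`). -/
structure CornerMat (R : Type*) where
  /-- the size -/
  n : ℕ
  /-- the idempotent -/
  e : R
  /-- the matrix -/
  A : Matrix (Fin n) (Fin n) R

/-- An element of the corner `e R e`, as a `1 × 1` matrix. -/
def CornerMat.single {R : Type*} (e x : R) : CornerMat R := ⟨1, e, fun _ _ => x⟩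

/-- The image of a matrix under a map. -/
def CornerMat.map {R R' : Type*} (f : R → R') (M : CornerMat R) : CornerMat R' :=
  ⟨M.n, f M.e, M.A.map f⟩

section Loc

variable (K : Type*) [Field K]
variable {R : Type*} [NonUnitalRing R] [Module K R] [IsScalarTower K R R] [SMulCommClass K R R]

/-- The matrix `(1 - e) I + A` over the unitization of `R`. -/
def CornerMat.unitize (M : CornerMat R) : SqMat (Unitization K R) :=
  ⟨M.n, fun i j => (if i = j then 1 - (M.e : Unitization K R) else 0) + (M.A i j : Unitization K R)⟩

/-- The universal localization of the unitization of `R` at the matrices `(1 - e) I + A`. -/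
abbrev LocAmbient (S : Set (CornerMat R)) := UnivLoc K (CornerMat.unitize K '' S)

/-- The composition of `R → R¹` with the canonical map to the localization of `R¹`. -/
def locHom (S : Set (CornerMat R)) : R →ₙₐ[K] LocAmbient K S :=
  ((UnivLoc.of K (CornerMat.unitize K '' S) : Unitization K R →ₐ[K] LocAmbient K S) :
    Unitization K R →ₙₐ[K] LocAmbient K S).comp (Unitization.inrNonUnitalAlgHom K R)

theorem locHom_apply (S : Set (CornerMat R)) (a : R) :
    locHom K S a = UnivLoc.of K (CornerMat.unitize K '' S) (a : Unitization K R) := rfl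

/-- The universal localization `R S⁻¹` of the not necessarily unital `K`-algebra `R` at a set of
matrices over corners of `R`: the ideal generated by `R` in the universal localization of the
unitization of `R` at the matrices `(1 - e) I + A`. -/
def locSub (S : Set (CornerMat R)) : NonUnitalSubalgebra K (LocAmbient K S) where
  carrier := TwoSidedIdeal.span (Set.range (locHom K S))
  add_mem' := fun ha hb => TwoSidedIdeal.add_mem _ ha hb
  zero_mem' := TwoSidedIdeal.zero_mem _
  mul_mem' := fun {a b} _ hb =>
    TwoSidedIdeal.mul_mem_left (TwoSidedIdeal.span (Set.range (locHom K S))) a b hb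
  smul_mem' := fun c x hx => by
    rw [Algebra.smul_def]
    exact TwoSidedIdeal.mul_mem_left (TwoSidedIdeal.span (Set.range (locHom K S))) _ x hx

/-- The universal localization `R S⁻¹`, as a type. -/
def Loc (S : Set (CornerMat R)) := locSub K S

instance (S : Set (CornerMat R)) : NonUnitalRing (Loc K S) :=
  inferInstanceAs (NonUnitalRing (locSub K S))

instance (S : Set (CornerMat R)) : Module K (Loc K S) :=
  inferInstanceAs (Module K (locSub K S))

instance (S : Set (CornerMat R)) : IsScalarTower K (Loc K S) (Loc K S) :=
  inferInstanceAs (IsScalarTower K (locSub K S) (locSub K S))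

instance (S : Set (CornerMat R)) : SMulCommClass K (Loc K S) (Loc K S) :=
  inferInstanceAs (SMulCommClass K (locSub K S) (locSub K S))

/-- The canonical map `R → R S⁻¹`. -/
def Loc.of (S : Set (CornerMat R)) : R →ₙₐ[K] Loc K S :=
  NonUnitalAlgHom.codRestrict (locHom K S) (locSub K S)
    fun x => TwoSidedIdeal.subset_span (Set.mem_range_self x)

variable {R' : Type*} [NonUnitalRing R'] [Module K R'] [IsScalarTower K R' R']
  [SMulCommClass K R' R']

theorem lift_inr {B : Type*} [Ring B] [Algebra K B] (f : R →ₙₐ[K] B) (a : R) :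
    Unitization.lift f (a : Unitization K R) = f a :=
  congrArg (fun g : R →ₙₐ[K] B => g a) (Unitization.lift.symm_apply_apply f)

/-- Functoriality of the localization of the unitizations. -/
def locAmbientMap {S : Set (CornerMat R)} {S' : Set (CornerMat R')} (f : R →ₙₐ[K] R')
    (h : ∀ M ∈ S, M.map f ∈ S') : LocAmbient K S →ₐ[K] LocAmbient K S' :=
  UnivLoc.lift (Unitization.lift ((locHom K S').comp f)) (by
    rintro ⟨_, M, hM, rfl⟩
    have hu := UnivLoc.isUnit_map_of (K := K) (S := CornerMat.unitize K '' S')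
      (Set.mem_image_of_mem (CornerMat.unitize K) (h M hM))
    have he : (CornerMat.unitize K M).2.map (Unitization.lift ((locHom K S').comp f)) =
        (CornerMat.unitize K (M.map f)).2.map (UnivLoc.of K (CornerMat.unitize K '' S')) := by
      ext i j
      change Unitization.lift ((locHom K S').comp f)
          ((if i = j then 1 - (M.e : Unitization K R) else 0) + (M.A i j : Unitization K R)) =
        UnivLoc.of K (CornerMat.unitize K '' S')
          ((if i = j then 1 - (f M.e : Unitization K R') else 0) + (f (M.A i j) : Unitization K R'))
      by_cases hij : i = j
      · simp only [hij, if_true, map_add, map_sub, map_one, lift_inr]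
        rfl
      · simp only [hij, if_false, map_add, map_zero, lift_inr]
        rfl
    exact he ▸ hu)

theorem locAmbientMap_mem {S : Set (CornerMat R)} {S' : Set (CornerMat R')} (f : R →ₙₐ[K] R')
    (h : ∀ M ∈ S, M.map f ∈ S') (x : locSub K S) : locAmbientMap K f h x.1 ∈ locSub K S' := by
  have hle : TwoSidedIdeal.span (Set.range (locHom K S)) ≤
      (TwoSidedIdeal.span (Set.range (locHom K S'))).comap (locAmbientMap K f h) := by
    rw [TwoSidedIdeal.span_le]
    rintro _ ⟨a, rfl⟩
    refine (TwoSidedIdeal.mem_comap _).2 ?_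
    have : locAmbientMap K f h (locHom K S a) = locHom K S' (f a) := by
      rw [locHom_apply, locAmbientMap, UnivLoc.lift_of, lift_inr]
      rfl
    rw [this]
    exact TwoSidedIdeal.subset_span (Set.mem_range_self _)
  exact (TwoSidedIdeal.mem_comap _).1 (hle x.2)

/-- Functoriality of the universal localization. -/
def Loc.map {S : Set (CornerMat R)} {S' : Set (CornerMat R')} (f : R →ₙₐ[K] R')
    (h : ∀ M ∈ S, M.map f ∈ S') : Loc K S →ₙₐ[K] Loc K S' :=
  NonUnitalAlgHom.codRestrict
    ((locAmbientMap K f h : LocAmbient K S →ₙₐ[K] LocAmbient K S').comp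
      (NonUnitalSubalgebraClass.subtype (locSub K S))) (locSub K S') (locAmbientMap_mem K f h)

end Loc

/-! ### Separated graphs -/

/-- A separated graph `(E, C)`, with vertices `V` and edges `Ed`: for every vertex `v`, `C v` is a
partition of `s⁻¹(v)` into non-empty sets. -/
structure SepGraph (V Ed : Type*) where
  /-- source -/
  s : Ed → V
  /-- range -/
  r : Ed → V
  /-- the separation -/
  C : V → Set (Set Ed)
  nonempty_of_mem : ∀ v, ∀ X ∈ C v, X.Nonempty
  source_of_mem : ∀ v, ∀ X ∈ C v, ∀ e ∈ X, s e = v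
  existsUnique_part : ∀ e, ∃! X, X ∈ C (s e) ∧ e ∈ X

namespace SepGraph

variable {V Ed : Type*} (G : SepGraph V Ed)

/-- `G.IsPath v l w`: the list `l` of edges is a directed path with source `v` and range `w`. -/
inductive IsPath : V → List Ed → V → Prop
  | nil (v : V) : IsPath v [] v
  | cons (e : Ed) {l : List Ed} {w : V} : IsPath (G.r e) l w → IsPath (G.s e) (e :: l) w

theorem IsPath.append {G : SepGraph V Ed} {u v w : V} {l m : List Ed} (h : G.IsPath u l v)
    (h' : G.IsPath v m w) : G.IsPath u (l ++ m) w := by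
  induction h with
  | nil v => exact h'
  | cons e _ ih => exact .cons e (ih h')

/-- The path-way pre-order: `v ≤ w` if there is a directed path from `w` to `v`. -/
@[reducible] def preorder : Preorder V where
  le v w := ∃ l, G.IsPath w l v
  le_refl v := ⟨[], .nil v⟩
  le_trans _ _ _ := fun ⟨_, h⟩ ⟨_, h'⟩ => ⟨_, h'.append h⟩

/-- The poset `I = V / ∼` of strongly connected components. -/
def I : Type _ := @Antisymmetrization V G.preorder.le (@instIsPreorderLe V G.preorder)

instance : PartialOrder G.I := @instPartialOrderAntisymmetrization V G.preorder

/-- The class `[v] ∈ I` of a vertex. -/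
def cls (v : V) : G.I := @toAntisymmetrization V G.preorder.le (@instIsPreorderLe V G.preorder) v

/-- A directed path. -/
structure DPath where
  /-- source -/
  src : V
  /-- the list of edges -/
  edges : List Ed
  /-- range -/
  tgt : V
  isPath : G.IsPath src edges tgt

/-- The trivial path at `v`. -/
def DPath.triv (v : V) : G.DPath := ⟨v, [], v, .nil v⟩

/-- An adaptable structure on a separated graph: the partition of `I` into free and regular
elements, and the enumerations `X i` (`i < k v`) of the sets in `C v` and the loops `α v i ∈ X v i`,
for `v = v^p` with `p` free. (The index `i` here starts at `0`.)

The subgraph `E_p` has the vertices of class `p` and the edges between them. -/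
structure Adaptable where
  finite_I : Finite G.I
  /-- finitely separated -/
  finite_part : ∀ v, ∀ X ∈ G.C v, X.Finite
  /-- the free elements of `I`; the others are the regular ones -/
  free : Set G.I
  /-- the number of sets in `C v` -/
  k : {v : V // G.cls v ∈ free} → ℕ
  /-- the sets in `C v` -/
  X : (v : {v : V // G.cls v ∈ free}) → Fin (k v) → Set Ed
  /-- the loop in `X v i` -/
  α : (v : {v : V // G.cls v ∈ free}) → Fin (k v) → Ed
  reg_one : ∀ w, G.cls w ∉ free → ∃ Y, G.C w = {Y}
  reg_two : ∀ w, G.cls w ∉ free →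
    ∃ e f, e ≠ f ∧ G.s e = w ∧ G.s f = w ∧ G.cls (G.r e) = G.cls w ∧ G.cls (G.r f) = G.cls w
  free_single : ∀ v w, G.cls v ∈ free → G.cls w = G.cls v → w = v
  free_minimal : ∀ v : {v : V // G.cls v ∈ free}, (∀ e, G.s e ≠ v.1) ↔ IsMin (G.cls v.1)
  free_range : ∀ v, Set.range (X v) = G.C v.1
  free_injective : ∀ v, Function.Injective (X v)
  α_mem : ∀ v i, α v i ∈ X v i
  α_loop : ∀ v i, G.r (α v i) = v.1
  β_lt : ∀ v i, ∀ e ∈ X v i, e ≠ α v i → G.cls (G.r e) < G.cls v.1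
  β_exists : ∀ v i, ∃ e ∈ X v i, e ≠ α v i

end SepGraph

/-! ### The algebra `S_K(E, C)` -/

namespace SepGraph

/-- Generators: vertices, edges `e`, adjoints `e*`, and `t v i b`, which is `t_i^v` for `b = true`
and `(t_i^v)⁻¹` for `b = false` (the index `i` starts at `0`). -/
inductive Gen (V Ed : Type*) where
  | vert (v : V)
  | edge (e : Ed)
  | star (e : Ed)
  | t (v : V) (i : ℕ) (b : Bool)

namespace Adaptable

variable {V Ed : Type*} {G : SepGraph V Ed} (D : G.Adaptable)

/-- Vertices `v^p` with `p` free. -/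
abbrev FreeV := {v : V // G.cls v ∈ D.free}

/-- The edges `β(p, j, s)`: the elements of `X v j` other than the loop. -/
def IsBeta (v : D.FreeV) (j : Fin (D.k v)) (e : Ed) : Prop := e ∈ D.X v j ∧ e ≠ D.α v j

/-- The map `σ^p`, `p` the class of `v`: a shift by `k(p) - 1`. -/
def sigma (v : D.FreeV) (i : ℕ) : ℕ := i + (D.k v - 1)

/-- The non-decreasing bijection `σ_j^p` from the complement of `j` onto the first `k(p) - 1`
indices. -/
def sigmaJ (v : D.FreeV) (j i : Fin (D.k v)) : ℕ := if i < j then i else i - 1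

section Relations

variable (K : Type*) [Field K] (V Ed)

/-- The vertex `v` in the free algebra. -/
abbrev gv (v : V) : FreeAlgebra K (Gen V Ed) := FreeAlgebra.ι K (.vert v)
/-- The edge `e` in the free algebra. -/
abbrev ge (e : Ed) : FreeAlgebra K (Gen V Ed) := FreeAlgebra.ι K (.edge e)
/-- The adjoint `e*` in the free algebra. -/
abbrev gs (e : Ed) : FreeAlgebra K (Gen V Ed) := FreeAlgebra.ι K (.star e)
/-- The element `t_i^v` or its inverse in the free algebra. -/
abbrev gt (v : V) (i : ℕ) (b : Bool) : FreeAlgebra K (Gen V Ed) := FreeAlgebra.ι K (.t v i b)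

variable {V Ed}

/-- The defining relations of `S_K(E, C)`, together with their adjoints. The adjoint of a vertex is
itself, and that of `t_i^v` is `(t_i^v)⁻¹`. -/
inductive Rel : FreeAlgebra K (Gen V Ed) → FreeAlgebra K (Gen V Ed) → Prop
  | vert_self (v) : Rel (gv V Ed K v * gv V Ed K v) (gv V Ed K v)
  | vert_ne (v w) : v ≠ w → Rel (gv V Ed K v * gv V Ed K w) 0
  | source (e) : Rel (gv V Ed K (G.s e) * ge V Ed K e) (ge V Ed K e)
  | range (e) : Rel (ge V Ed K e * gv V Ed K (G.r e)) (ge V Ed K e)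
  | star_source (e) : Rel (gs V Ed K e * gv V Ed K (G.s e)) (gs V Ed K e)
  | star_range (e) : Rel (gv V Ed K (G.r e) * gs V Ed K e) (gs V Ed K e)
  | star_edge (e) : Rel (gs V Ed K e * ge V Ed K e) (gv V Ed K (G.r e))
  | star_edge_ne (v) (Y) (hY : Y ∈ G.C v) (e f) : e ∈ Y → f ∈ Y → e ≠ f →
      Rel (gs V Ed K e * ge V Ed K f) 0
  | sum (v) (Y) (hY : Y ∈ G.C v) :
      Rel (∑ e ∈ (D.finite_part v Y hY).toFinset, ge V Ed K e * gs V Ed K e) (gv V Ed K v)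
  | α_comm (v) (i j) : i ≠ j →
      Rel (ge V Ed K (D.α v i) * ge V Ed K (D.α v j)) (ge V Ed K (D.α v j) * ge V Ed K (D.α v i))
  | α_star_comm (v) (i j) : i ≠ j →
      Rel (ge V Ed K (D.α v i) * gs V Ed K (D.α v j)) (gs V Ed K (D.α v j) * ge V Ed K (D.α v i))
  | star_α_comm (v) (i j) : i ≠ j →
      Rel (gs V Ed K (D.α v i) * gs V Ed K (D.α v j)) (gs V Ed K (D.α v j) * gs V Ed K (D.α v i))
  | β_orth (v) (i j) (e f) : i ≠ j → D.IsBeta v i e → D.IsBeta v j f →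
      Rel (gs V Ed K e * ge V Ed K f) 0
  | t_comm (v i j b c) :
      Rel (gt V Ed K v i b * gt V Ed K v j c) (gt V Ed K v j c * gt V Ed K v i b)
  | vert_t (v i b) : Rel (gv V Ed K v * gt V Ed K v i b) (gt V Ed K v i b)
  | t_vert (v i b) : Rel (gt V Ed K v i b * gv V Ed K v) (gt V Ed K v i b)
  | t_inv (v i b) : Rel (gt V Ed K v i b * gt V Ed K v i (!b)) (gv V Ed K v)
  | reg_t (e i b) : G.cls (G.s e) ∉ D.free →
      Rel (gt V Ed K (G.s e) i b * ge V Ed K e) (ge V Ed K e * gt V Ed K (G.r e) i b)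
  | star_reg_t (e i b) : G.cls (G.s e) ∉ D.free →
      Rel (gs V Ed K e * gt V Ed K (G.s e) i b) (gt V Ed K (G.r e) i b * gs V Ed K e)
  | t_β (v j e i b) : D.IsBeta v j e →
      Rel (gt V Ed K v.1 i b * ge V Ed K e) (ge V Ed K e * gt V Ed K (G.r e) (D.sigma v i) b)
  | star_t_β (v j e i b) : D.IsBeta v j e →
      Rel (gs V Ed K e * gt V Ed K v.1 i b) (gt V Ed K (G.r e) (D.sigma v i) b * gs V Ed K e)
  | α_β (v i j e) : i ≠ j → D.IsBeta v j e →
      Rel (ge V Ed K (D.α v i) * ge V Ed K e)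
        (ge V Ed K e * gt V Ed K (G.r e) (D.sigmaJ v j i) true)
  | α_star_β (v i j e) : i ≠ j → D.IsBeta v j e →
      Rel (gs V Ed K (D.α v i) * ge V Ed K e)
        (ge V Ed K e * gt V Ed K (G.r e) (D.sigmaJ v j i) false)
  | star_α_β (v i j e) : i ≠ j → D.IsBeta v j e →
      Rel (gs V Ed K e * gs V Ed K (D.α v i))
        (gt V Ed K (G.r e) (D.sigmaJ v j i) false * gs V Ed K e)
  | star_α_star_β (v i j e) : i ≠ j → D.IsBeta v j e →
      Rel (gs V Ed K e * ge V Ed K (D.α v i))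
        (gt V Ed K (G.r e) (D.sigmaJ v j i) true * gs V Ed K e)
  | t_α (v j i b) :
      Rel (gt V Ed K v.1 i b * ge V Ed K (D.α v j)) (ge V Ed K (D.α v j) * gt V Ed K v.1 i b)
  | t_α_star (v j i b) :
      Rel (gt V Ed K v.1 i b * gs V Ed K (D.α v j)) (gs V Ed K (D.α v j) * gt V Ed K v.1 i b)

/-- The image of a generator in the unital algebra with the given generators and relations. -/
def gen (x : Gen V Ed) : RingQuot (D.Rel K) := RingQuot.mkAlgHom K (D.Rel K) (FreeAlgebra.ι K x)

/-- The (not necessarily unital) algebra `S_K(E, C)` with the given generators and relations. As no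
relation has a constant term, it is the subalgebra without unit that is generated by the generators
in the unital algebra with the same presentation. -/
def sSub : NonUnitalSubalgebra K (RingQuot (D.Rel K)) :=
  NonUnitalAlgebra.adjoin K (Set.range (D.gen K))

/-- The algebra `S_K(E, C)`, as a type. -/
def SAlg : Type _ := D.sSub K

instance : NonUnitalRing (D.SAlg K) :=
  inferInstanceAs (NonUnitalRing (D.sSub K))

instance : Module K (D.SAlg K) :=
  inferInstanceAs (Module K (D.sSub K))

instance : IsScalarTower K (D.SAlg K) (D.SAlg K) :=
  inferInstanceAs (IsScalarTower K (D.sSub K) (D.sSub K))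

instance : SMulCommClass K (D.SAlg K) (D.SAlg K) :=
  inferInstanceAs (SMulCommClass K (D.sSub K) (D.sSub K))

/-- The generators as elements of `S_K(E, C)`. -/
def sg (x : Gen V Ed) : D.SAlg K :=
  ⟨D.gen K x, NonUnitalAlgebra.subset_adjoin K ⟨x, rfl⟩⟩

/-! ### The algebra `S_K^1(E, C)` and the copies of `L = K(t_1, t_2, …)` in its corners -/

/-- The value in `v S_K(E, C) v` of a polynomial in the variables `t_i`, at the `t_i^v`. -/
def tEval (v : V) (f : MvPolynomial ℕ K) : D.SAlg K :=
  ∑ m ∈ f.support, f.coeff m • monomialEval (D.sg K (.vert v)) (fun i => D.sg K (.t v i true)) m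

/-- The elements `p(t_i^v)`, for the non-zero polynomials `p` in the variables `t_1, t_2, …` -/
def sigmaOne : Set (CornerMat (D.SAlg K)) :=
  {M | ∃ (v : V) (f : MvPolynomial ℕ K), f ≠ 0 ∧
    M = CornerMat.single (D.sg K (.vert v)) (D.tEval K v f)}

/-- The algebra `S_K^1(E, C)`. -/
def S1 : Type _ := Loc K (D.sigmaOne K)

instance : NonUnitalRing (D.S1 K) :=
  inferInstanceAs (NonUnitalRing (Loc K (D.sigmaOne K)))

instance : Module K (D.S1 K) :=
  inferInstanceAs (Module K (Loc K (D.sigmaOne K)))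

instance : IsScalarTower K (D.S1 K) (D.S1 K) :=
  inferInstanceAs (IsScalarTower K (Loc K (D.sigmaOne K)) (Loc K (D.sigmaOne K)))

instance : SMulCommClass K (D.S1 K) (D.S1 K) :=
  inferInstanceAs (SMulCommClass K (Loc K (D.sigmaOne K)) (Loc K (D.sigmaOne K)))

/-- The canonical map from `S_K(E, C)` to `S_K^1(E, C)`. -/
def toS1 : D.SAlg K →ₙₐ[K] D.S1 K := Loc.of K (D.sigmaOne K)

/-- The generators as elements of `S_K^1(E, C)`. -/
def sg1 (x : Gen V Ed) : D.S1 K := D.toS1 K (D.sg K x)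

/-- The field `L = K(t_1, t_2, …)`. -/
abbrev L (K : Type*) [Field K] := FractionRing (MvPolynomial ℕ K)

/-- The embedding of `L` into `v S_K^1(E, C) v` that sends `t_i` to `t_i^v`: a fraction `a / b` goes
to `a(t_i^v) b(t_i^v)⁻¹`. -/
def coef (v : V) (l : L K) : D.S1 K :=
  let ab := IsLocalization.sec (nonZeroDivisors (MvPolynomial ℕ K)) l
  D.toS1 K (D.tEval K v ab.1) * cornerInv (D.sg1 K (.vert v)) (D.toS1 K (D.tEval K v ab.2.1))

/-! ### The sets `Σ(p)` -/

/-- The value `f(α(p, i))` of a polynomial with coefficients in `L`, in the corner at `v = v^p`. -/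
def αEval (v : D.FreeV) (f : MvPolynomial (Fin (D.k v)) (L K)) : D.S1 K :=
  ∑ m ∈ f.support, D.coef K v.1 (f.coeff m) *
    monomialEval (D.sg1 K (.vert v.1)) (fun i => D.sg1 K (.edge (D.α v i))) m

/-- The polynomials `f ≠ 0` with `v(f) = 0`, that is, divisible by none of the variables. -/
def IsSigmaPoly (v : D.FreeV) (f : MvPolynomial (Fin (D.k v)) (L K)) : Prop :=
  f ≠ 0 ∧ ∀ i, ¬ MvPolynomial.X i ∣ f

/-- `Σ(p)` for `p` free. -/
def sigmaFree : Set (CornerMat (D.S1 K)) :=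
  {M | ∃ (v : D.FreeV) (f : MvPolynomial (Fin (D.k v)) (L K)), D.IsSigmaPoly K v f ∧
    M = CornerMat.single (D.sg1 K (.vert v.1)) (D.αEval K v f)}

/-- The image of a path in `S_K^1(E, C)`: the product of its edges and its range. -/
def pathElem (γ : G.DPath) : D.S1 K :=
  γ.edges.foldr (fun e y => D.sg1 K (.edge e) * y) (D.sg1 K (.vert γ.tgt))

/-- The image in `S_K^1(E, C)` of an element of a path algebra with coefficients in `L`, given as a
finitely supported function on the paths. -/
def pathEval (f : G.DPath →₀ L K) : D.S1 K :=
  f.sum fun γ l => D.coef K γ.src l * D.pathElem K γ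

end Relations

end Adaptable

variable {V Ed : Type*} (G : SepGraph V Ed)

/-- A finite complete subgraph `F` of `E_p`, for a regular `p`: if `F` contains one edge of `E_p`
with source `v`, then it contains all of them. -/
structure CompleteSub (p : G.I) where
  /-- vertices -/
  verts : Finset V
  /-- edges -/
  edges : Finset Ed
  verts_mem : ∀ v ∈ verts, G.cls v = p
  source_mem : ∀ e ∈ edges, G.s e ∈ verts
  range_mem : ∀ e ∈ edges, G.r e ∈ verts
  complete : ∀ e ∈ edges, ∀ f, G.s f = G.s e → G.cls (G.r f) = p → f ∈ edges

/-- The paths in the subgraph `F`. -/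
def CompleteSub.IsPathIn {G : SepGraph V Ed} {p : G.I} (F : G.CompleteSub p) (γ : G.DPath) : Prop :=
  γ.src ∈ F.verts ∧ ∀ e ∈ γ.edges, e ∈ F.edges

namespace Adaptable

variable {G} (D : G.Adaptable) (K : Type*) [Field K]

/-- `Σ(p)` for `p` regular: the square matrices `A` over some path algebra `P_L(F)`, `F` a finite
complete subgraph of `E_p`, such that the augmentation `ε(A)` is invertible over
`⨁ v ∈ F⁰, v L`. They are matrices over the corner with unit `v_F = ∑ v ∈ F⁰, v`. -/
def sigmaReg (p : G.I) : Set (CornerMat (D.S1 K)) :=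
  {M | ∃ (F : G.CompleteSub p) (n : ℕ) (A : Matrix (Fin n) (Fin n) (G.DPath →₀ L K)),
    (∀ i j, ∀ γ ∈ (A i j).support, F.IsPathIn γ) ∧
    (∀ v ∈ F.verts, IsUnit (Matrix.of fun i j => A i j (DPath.triv G v))) ∧
    M = ⟨n, ∑ v ∈ F.verts, D.sg1 K (.vert v), Matrix.of fun i j => D.pathEval K (A i j)⟩}

/-- The union of the sets `Σ(p)`, `p ∈ I`. -/
def sigmaAll : Set (CornerMat (D.S1 K)) :=
  {M | M ∈ D.sigmaFree K ∨ ∃ p, p ∉ D.free ∧ M ∈ D.sigmaReg K p}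

/-! ### The algebra `Q_K(E, C)` -/

/-- The regular algebra `Q_K(E, C)`. -/
def Q : Type _ := Loc K (D.sigmaAll K)

instance : NonUnitalRing (D.Q K) :=
  inferInstanceAs (NonUnitalRing (Loc K (D.sigmaAll K)))

instance : Module K (D.Q K) :=
  inferInstanceAs (Module K (Loc K (D.sigmaAll K)))

instance : IsScalarTower K (D.Q K) (D.Q K) :=
  inferInstanceAs (IsScalarTower K (Loc K (D.sigmaAll K)) (Loc K (D.sigmaAll K)))

instance : SMulCommClass K (D.Q K) (D.Q K) :=
  inferInstanceAs (SMulCommClass K (Loc K (D.sigmaAll K)) (Loc K (D.sigmaAll K)))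

/-- The canonical map from `S_K^1(E, C)` to `Q_K(E, C)`. -/
def toQ : D.S1 K →ₙₐ[K] D.Q K := Loc.of K (D.sigmaAll K)

/-- The generators as elements of `Q_K(E, C)`. -/
def q (x : Gen V Ed) : D.Q K := D.toQ K (D.sg1 K x)

/-! ### Rational series -/

/-- The path algebra `P_L(E_p)`, as a subalgebra of `S_K^1(E, C)`. -/
def pathAlg (p : G.I) : NonUnitalSubalgebra K (D.S1 K) :=
  NonUnitalAlgebra.adjoin K
    ({x | ∃ (v : V) (l : L K), G.cls v = p ∧ x = D.coef K v l} ∪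
      {x | ∃ v, G.cls v = p ∧ x = D.sg1 K (.vert v)} ∪
      {x | ∃ e, G.cls (G.s e) = p ∧ G.cls (G.r e) = p ∧ x = D.sg1 K (.edge e)})

/-- The matrices over `P_L(E_p)` in `Σ(p)`. -/
def sigmaPath (p : G.I) : Set (CornerMat (D.pathAlg K p)) :=
  {M | M.map (NonUnitalSubalgebraClass.subtype (D.pathAlg K p)) ∈ D.sigmaReg K p}

/-- The algebra `P_L^rat(E_p)` of rational series over `E_p`, that is, the universal localization
of `P_L(E_p)` at `Σ(p)`. -/
def RatAlg (p : G.I) : Type _ := Loc K (D.sigmaPath K p)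

instance (p : G.I) : NonUnitalRing (D.RatAlg K p) :=
  inferInstanceAs (NonUnitalRing (Loc K (D.sigmaPath K p)))

instance (p : G.I) : Module K (D.RatAlg K p) :=
  inferInstanceAs (Module K (Loc K (D.sigmaPath K p)))

instance (p : G.I) : IsScalarTower K (D.RatAlg K p) (D.RatAlg K p) :=
  inferInstanceAs (IsScalarTower K (Loc K (D.sigmaPath K p)) (Loc K (D.sigmaPath K p)))

instance (p : G.I) : SMulCommClass K (D.RatAlg K p) (D.RatAlg K p) :=
  inferInstanceAs (SMulCommClass K (Loc K (D.sigmaPath K p)) (Loc K (D.sigmaPath K p)))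

/-- The vertices of `E_p` as elements of the algebra of rational series. -/
def ratVert {p : G.I} (v : V) (hv : G.cls v = p) : D.RatAlg K p :=
  Loc.of K (D.sigmaPath K p) ⟨D.sg1 K (.vert v),
    NonUnitalAlgebra.subset_adjoin K (Or.inl (Or.inr ⟨v, hv, rfl⟩))⟩

/-- The canonical map from `P_L^rat(E_p)` to `Q_K(E, C)`, for `p` regular. -/
def ratToQ {p : G.I} (hp : p ∉ D.free) : D.RatAlg K p →ₙₐ[K] D.Q K :=
  Loc.map K (NonUnitalSubalgebraClass.subtype (D.pathAlg K p))
    fun _ hM => Or.inr ⟨p, hp, hM⟩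

/-- `f ∈ v P_L^rat(E_p) v' \ {0}`. -/
def IsRatFrom {p : G.I} (v v' : V) (hv : G.cls v = p) (hv' : G.cls v' = p) (f : D.RatAlg K p) :
    Prop :=
  f ≠ 0 ∧ D.ratVert K v hv * f = f ∧ f * D.ratVert K v' hv' = f

/-! ### Fractional c-paths, fractional monomials and c-paths -/

/-- The element `f(α(p, i))⁻¹` of `Q_K(E, C)`. -/
def fracInv (v : D.FreeV) (f : MvPolynomial (Fin (D.k v)) (L K)) : D.Q K :=
  cornerInv (D.q K (.vert v.1)) (D.toQ K (D.αEval K v f))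

/-- `D.FracStep K v w x`: the element `x` is a step from `v` to `w`. -/
inductive FracStep : V → V → D.Q K → Prop
  | free (v : D.FreeV) (f : MvPolynomial (Fin (D.k v)) (L K)) (hf : D.IsSigmaPoly K v f)
      (i : Fin (D.k v)) (m : ℕ) (β : Ed) (hβ : D.IsBeta v i β) :
      FracStep v.1 (G.r β)
        (D.fracInv K v f * powMul (D.q K (.edge (D.α v i))) m (D.q K (.edge β)))
  | reg (p : G.I) (hp : p ∉ D.free) (v : V) (hv : G.cls v = p) (β : Ed) (hs : G.cls (G.s β) = p)
      (hr : G.cls (G.r β) < p) (f : D.RatAlg K p) (hf : D.IsRatFrom K v (G.s β) hv hs f) :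
      FracStep v (G.r β) (D.ratToQ K hp f * D.q K (.edge β))

/-- `D.IsFracCPath K v w x`: the element `x` is a fractional c-path from `v` to `w`. -/
inductive IsFracCPath : V → V → D.Q K → Prop
  | triv (v : V) : IsFracCPath v v (D.q K (.vert v))
  | cons {v u w : V} {x y : D.Q K} :
      D.FracStep K v u x → IsFracCPath u w y → IsFracCPath v w (x * y)

/-- `D.IsCStep v l w`: the path `l` is a step of a c-path, from `v` to `w`. It is of the form
`α(p, i)^m β(p, i, t)` if the class `p` of `v` is free, and consists of a path in `E_p` and a
connector if `p` is regular. -/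
inductive IsCStep : V → List Ed → V → Prop
  | free (v : D.FreeV) (i : Fin (D.k v)) (m : ℕ) (β : Ed) (hβ : D.IsBeta v i β) :
      IsCStep v.1 (List.replicate m (D.α v i) ++ [β]) (G.r β)
  | reg (v : V) (hp : G.cls v ∉ D.free) (l : List Ed) (β : Ed) (hs : G.cls (G.s β) = G.cls v)
      (hr : G.cls (G.r β) < G.cls v) (hl : G.IsPath v l (G.s β)) :
      IsCStep v (l ++ [β]) (G.r β)

/-- `D.IsCPath v l w`: the path `l` is a c-path from `v` to `w`. -/
inductive IsCPath : V → List Ed → V → Prop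
  | triv (v : V) : IsCPath v [] v
  | cons {v u w : V} {l m : List Ed} :
      D.IsCStep v l u → IsCPath u m w → IsCPath v (l ++ m) w

/-- The element `ν*` of `Q_K(E, C)`, where `ν` is the path with source `v` and list of edges `l`. -/
def adjElem (v : V) (l : List Ed) : D.Q K :=
  l.foldl (fun y e => D.q K (.star e) * y) (D.q K (.vert v))

/-- `D.IsFracMonomial K p x`: the element `x` is a fractional monomial at `p`. -/
inductive IsFracMonomial : G.I → D.Q K → Prop
  | free (v : D.FreeV) (f : MvPolynomial (Fin (D.k v)) (L K)) (hf : D.IsSigmaPoly K v f)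
      (a b : Fin (D.k v) → ℕ) :
      IsFracMonomial (G.cls v.1) (D.fracInv K v f *
        (List.finRange (D.k v)).foldr
          (fun j y => powMul (D.q K (.edge (D.α v j))) (a j)
            (powMul (D.q K (.star (D.α v j))) (b j) y)) (D.q K (.vert v.1)))
  | reg (p : G.I) (hp : p ∉ D.free) (v v' u : V) (hv : G.cls v = p) (hv' : G.cls v' = p)
      (hu : G.cls u = p) (f : D.RatAlg K p) (hf : D.IsRatFrom K v v' hv hv' f) (ν : List Ed)
      (hν : G.IsPath u ν v') :
      IsFracMonomial p (D.ratToQ K hp f * D.adjElem K u ν)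

end Adaptable

end SepGraph

end

/-!
Let `W` (`spanW`) be the linear span of the products `γ m ν*` in `Q = Q_K(E, C)`. The elements `x`
of `Q` with `x W ⊆ W` form a subalgebra (`multW`), and `W` contains the vertices. A universal
localization is generated by the original algebra and the entries of the inverses of the inverted
matrices (`Loc.mem_of_generators`), so it is enough to find all the generators of `Q` in this
subalgebra: then `W` is a left ideal that contains every `x` with `x = x v` for a vertex `v`, and
these generate `Q`. To be in the subalgebra is tested on fractional monomials and on steps
(`mem_multW_of`), and the generators are treated in turn.

* At a regular component, rational series absorb rational series, and connectors are steps. For an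
  edge `e` and a rational series `y` one has `e* y = l e* + z` with `l` in `L` and with `z` a
  rational series, or zero if `e` is a connector (`star_mul_ratToQ`). This is clear for elements of
  the path algebra. For the inverse `N` of a matrix `A` over the path algebra, multiply `A N = 1` by
  `e*` from the left: with `ε A` the invertible matrix of constant terms, `e* A = (ε A) e* + (tail)`
  gives `e* N = (ε A)⁻¹ e* - (ε A)⁻¹ (tail) N`. Then `e* ν*` and `e* β` are evaluated directly.
* At a free vertex, the inverses `f(α)⁻¹` multiply among themselves, and elements of `L` are
  absorbed by `l f(α)⁻¹ = (l⁻¹ f)(α)⁻¹`. A loop `α_i` commutes with every `f(α)⁻¹` and with all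
  loops and adjoints of loops except `α_i*`, so that a factor `α_i` on the left joins its power.
* For `β` in the class of `α_i`, one has `β* α_i = 0` and `β* α_j = t_{σ(j)} β*` for `j ≠ i`, so
  that `β* f(α) = Φ(f) β*` for a substitution `Φ : L[x_1, …, x_k] → L` which sends `x_i` to `0`
  (`substHom`). The element `Φ(f)` of the field `L` is non-zero precisely because `x_i` does not
  divide `f` (`substHom_ne_zero`): the variables `t_1, …, t_{k-1}` substituted for the others are
  algebraically independent over the image of the coefficients, whose variables are shifted by
  `k - 1`. Hence `β* f(α)⁻¹ = Φ(f)⁻¹ β*`; a product `β* (α_i*) ^ m` that remains in a fractional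
  monomial is the adjoint of a c-path.
* Finally `α_i* f(α) = f(α) α_i* + g(α) π` with `π = α_i* α_i - α_i α_i* = ∑ β β*`, so that
  `α_i* f(α)⁻¹ = f(α)⁻¹ α_i* - f(α)⁻¹ g(α) π f(α)⁻¹`, and the last factor is absorbed because
  each `β` and `β*` already is a left multiplier of `W`.
-/

noncomputable section

/-! ### Inverses in corners -/

section CornerInv

variable {R : Type*} [NonUnitalRing R] {e e' x x' y y' z u : R}

theorem IsCornerInv.unique (h : IsCornerInv e x y) (h' : IsCornerInv e x z) : y = z := by
  obtain ⟨_, h2, _, h4⟩ := h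
  obtain ⟨g1, _, g3, _⟩ := h'
  rw [← h2, ← g3, ← mul_assoc, h4, g1]

theorem IsCornerInv.isCornerInv_cornerInv (h : IsCornerInv e x y) :
    IsCornerInv e x (cornerInv e x) := by
  have h' : ∃ y, IsCornerInv e x y := ⟨y, h⟩
  rw [cornerInv, dif_pos h']
  exact h'.choose_spec

theorem IsCornerInv.cornerInv_eq (h : IsCornerInv e x y) : cornerInv e x = y :=
  h.isCornerInv_cornerInv.unique h

theorem IsCornerInv.mul (h : IsCornerInv e x y) (h' : IsCornerInv e x' y') :
    IsCornerInv e (x * x') (y' * y) := by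
  obtain ⟨h1, h2, h3, h4⟩ := h
  obtain ⟨g1, g2, g3, g4⟩ := h'
  refine ⟨by rw [← mul_assoc, g1], by rw [mul_assoc, h2], ?_, ?_⟩
  · rw [mul_assoc, ← mul_assoc x', g3, h1, h3]
  · rw [mul_assoc, ← mul_assoc y, h4, ← mul_assoc, g2, g4]

theorem IsCornerInv.map {R' F : Type*} [NonUnitalRing R'] [FunLike F R R'] [MulHomClass F R R']
    (f : F) (h : IsCornerInv e x y) : IsCornerInv (f e) (f x) (f y) := by
  obtain ⟨h1, h2, h3, h4⟩ := h
  refine ⟨?_, ?_, ?_, ?_⟩ <;> rw [← map_mul] <;> simp only [h1, h2, h3, h4]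

/-- An element that intertwines two invertible elements intertwines their inverses. -/
theorem IsCornerInv.intertwine (h : IsCornerInv e x y) (h' : IsCornerInv e' x' y')
    (hu : e * u = u) (hu' : u * e' = u) (hx : x * u = u * x') : y * u = u * y' := by
  calc y * u = y * (u * (x' * y')) := by rw [h'.2.2.1, hu']
    _ = y * (x * u) * y' := by rw [hx]; simp only [mul_assoc]
    _ = u * y' := by rw [← mul_assoc, h.2.2.2, hu]

end CornerInv

/-! ### Evaluation of polynomials in a corner -/

section PowMul

variable {R : Type*} [NonUnitalRing R]

@[simp] theorem powMul_zero (x y : R) : powMul x 0 y = y := rfl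

theorem powMul_succ (x : R) (m : ℕ) (y : R) : powMul x (m + 1) y = x * powMul x m y := by
  rw [powMul, Function.iterate_succ_apply']
  rfl

theorem powMul_mul (x : R) (m : ℕ) (y z : R) : powMul x m (y * z) = powMul x m y * z := by
  induction m with
  | zero => rfl
  | succ m ih => rw [powMul_succ, powMul_succ, ih, mul_assoc]

theorem map_powMul {R' F : Type*} [NonUnitalRing R'] [FunLike F R R'] [MulHomClass F R R']
    (f : F) (x : R) (m : ℕ) (y : R) : f (powMul x m y) = powMul (f x) m (f y) := by
  induction m with
  | zero => rfl
  | succ m ih => rw [powMul_succ, powMul_succ, map_mul, ih]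

theorem mul_powMul_intertwine {a x x' : R} (h : a * x = x' * a) (m : ℕ) (y : R) :
    a * powMul x m y = powMul x' m (a * y) := by
  induction m with
  | zero => rfl
  | succ m ih => rw [powMul_succ, powMul_succ, ← ih, ← mul_assoc, h, mul_assoc]

theorem mul_powMul_of_comm {a x : R} (h : a * x = x * a) (m : ℕ) (y : R) :
    a * powMul x m y = powMul x m (a * y) :=
  mul_powMul_intertwine h m y

theorem powMul_comm {x x' : R} (h : x * x' = x' * x) (m n : ℕ) (y : R) :
    powMul x m (powMul x' n y) = powMul x' n (powMul x m y) := by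
  induction m with
  | zero => rfl
  | succ m ih => rw [powMul_succ, powMul_succ, ih, mul_powMul_of_comm h]

theorem mul_powMul_of_mul_eq {e x y : R} (hx : e * x = x) (hy : e * y = y) (m : ℕ) :
    e * powMul x m y = powMul x m y := by
  cases m with
  | zero => exact hy
  | succ m => rw [powMul_succ, ← mul_assoc, hx]

end PowMul

section MonomialEval

theorem Finsupp.induction_add_single_one {ι : Type*} {motive : (ι →₀ ℕ) → Prop} (m : ι →₀ ℕ)
    (zero : motive 0) (add_single : ∀ m i, motive m → motive (m + Finsupp.single i 1)) :
    motive m := by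
  induction m using Finsupp.induction₂ with
  | zero => exact zero
  | add_single i b m _ hb ih =>
    clear hb
    induction b with
    | zero => simpa using ih
    | succ b ihb => rw [Finsupp.single_add, ← add_assoc]; exact add_single _ _ ihb

section Foldr

variable {ι R : Type*} [NonUnitalRing R] {e : R} {x : ι → R}

theorem foldr_powMul_congr (l : List ι) {m n : ι → ℕ} (h : ∀ i ∈ l, m i = n i) :
    l.foldr (fun i y => powMul (x i) (m i) y) e = l.foldr (fun i y => powMul (x i) (n i) y) e := by
  induction l with
  | nil => rfl
  | cons a l ih =>
    rw [List.foldr_cons, List.foldr_cons, ih fun i hi => h i (List.mem_cons_of_mem a hi),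
      h a List.mem_cons_self]

theorem foldr_powMul_perm (hx : ∀ i j, x i * x j = x j * x i) (m : ι → ℕ) {l l' : List ι}
    (h : l.Perm l') : l.foldr (fun i y => powMul (x i) (m i) y) e =
      l'.foldr (fun i y => powMul (x i) (m i) y) e :=
  have : LeftCommutative (fun i y => powMul (x i) (m i) y) :=
    ⟨fun i j y => powMul_comm (hx i j) _ _ y⟩
  h.foldr_eq e

end Foldr

section EvalData

variable {ι R A : Type*} [NonUnitalRing R] [CommRing A] {e : R} {c : A → R} {x : ι → R}

/-- The conditions under which polynomials with coefficients in `A` can be evaluated in the corner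
with unit `e`: the coefficients act through the multiplicative map `c`, and the values `x i` of the
variables commute with each other and with the coefficients. -/
structure IsEvalData (e : R) (c : A → R) (x : ι → R) : Prop where
  map_one : c 1 = e
  map_add : ∀ a b, c (a + b) = c a + c b
  map_mul : ∀ a b, c (a * b) = c a * c b
  mul_e : ∀ i, x i * e = x i
  comm : ∀ i j, x i * x j = x j * x i
  comm_coeff : ∀ a i, c a * x i = x i * c a

namespace IsEvalData

variable (h : IsEvalData e c x)

include h

theorem map_zero : c 0 = 0 := by
  have := h.map_add 0 0
  rwa [add_zero, left_eq_add] at this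

theorem mul_e_coeff (a : A) : c a * e = c a := by
  rw [← h.map_one, ← h.map_mul, mul_one]

theorem e_mul_coeff (a : A) : e * c a = c a := by
  rw [← h.map_one, ← h.map_mul, one_mul]

theorem e_mul (i : ι) : e * x i = x i := by
  rw [← h.map_one, h.comm_coeff, h.map_one, h.mul_e]

end IsEvalData

end EvalData

variable {ι R : Type*} [LinearOrder ι] [NonUnitalRing R] {e : R} {x : ι → R}

theorem monomialEval_zero : monomialEval e x 0 = e := by
  simp [monomialEval]

theorem monomialEval_add_single (hx : ∀ i j, x i * x j = x j * x i) (m : ι →₀ ℕ) (i : ι) :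
    monomialEval e x (m + Finsupp.single i 1) = x i * monomialEval e x m := by
  classical
  -- the support of the larger monomial is `i` together with that of `m` without `i`
  have hsupp : (m + Finsupp.single i 1).support = insert i (m.support.erase i) := by
    ext j
    by_cases hj : j = i <;> simp [hj, eq_comm]
  have h1 : ((m + Finsupp.single i 1).support.sort (· ≤ ·)).Perm
      (i :: (m.support.erase i).toList) := by
    rw [hsupp]
    exact (Finset.sort_perm_toList _ _).trans (Finset.toList_insert (by simp))
  have h2 : (m.support.erase i).toList.foldr
        (fun j y => powMul (x j) ((m + Finsupp.single i 1 : ι →₀ ℕ) j) y) e =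
      (m.support.erase i).toList.foldr (fun j y => powMul (x j) (m j) y) e :=
    foldr_powMul_congr _ fun j hj => by
      have : j ≠ i := by simp at hj; exact hj.1
      simp [this]
  have h3 : monomialEval e x m = powMul (x i) (m i)
      ((m.support.erase i).toList.foldr (fun j y => powMul (x j) (m j) y) e) := by
    by_cases hi : i ∈ m.support
    · have h : (m.support.sort (· ≤ ·)).Perm (i :: (m.support.erase i).toList) := by
        refine (Finset.sort_perm_toList _ _).trans ?_
        conv_lhs => rw [← Finset.insert_erase hi]
        exact Finset.toList_insert (by simp)
      rw [monomialEval, foldr_powMul_perm hx _ h, List.foldr_cons]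
    · rw [monomialEval, foldr_powMul_perm hx _ (Finset.sort_perm_toList _ _),
        Finset.erase_eq_of_notMem hi, Finsupp.notMem_support_iff.1 hi, powMul_zero]
  rw [monomialEval, foldr_powMul_perm hx _ h1, List.foldr_cons, h2, h3, Finsupp.add_apply,
    Finsupp.single_eq_same, powMul_succ]

theorem monomialEval_single (hx : ∀ i j, x i * x j = x j * x i) (he : ∀ i, x i * e = x i) (i : ι) :
    monomialEval e x (Finsupp.single i 1) = x i := by
  rw [← zero_add (Finsupp.single i 1), monomialEval_add_single hx, monomialEval_zero, he]

theorem mul_monomialEval_of_comm (hx : ∀ i j, x i * x j = x j * x i) {a : R}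
    (hae : a * e = e * a) (ha : ∀ i, a * x i = x i * a) (m : ι →₀ ℕ) :
    a * monomialEval e x m = monomialEval e x m * a := by
  induction m using Finsupp.induction_add_single_one with
  | zero => rw [monomialEval_zero, hae]
  | add_single m i ih =>
    rw [monomialEval_add_single hx, ← mul_assoc, ha, mul_assoc, ih, mul_assoc]

theorem mul_monomialEval_of_mul_eq (hx : ∀ i j, x i * x j = x j * x i) {a : R}
    (hae : a * e = e) (ha : ∀ i, a * x i = x i) (m : ι →₀ ℕ) :
    a * monomialEval e x m = monomialEval e x m := by
  induction m using Finsupp.induction_add_single_one with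
  | zero => rw [monomialEval_zero, hae]
  | add_single m i ih => rw [monomialEval_add_single hx, ← mul_assoc, ha]

theorem map_monomialEval {R' F : Type*} [NonUnitalRing R'] [FunLike F R R'] [MulHomClass F R R']
    (f : F) (m : ι →₀ ℕ) : f (monomialEval e x m) = monomialEval (f e) (fun i => f (x i)) m := by
  rw [monomialEval, monomialEval]
  induction m.support.sort (· ≤ ·) with
  | nil => rfl
  | cons a l ih => rw [List.foldr_cons, List.foldr_cons, map_powMul, ih]

/-- The value at `x` of a polynomial with coefficients acting through `c`, in the corner with
unit `e`. -/
def polyEval {A : Type*} [CommRing A] (e : R) (c : A → R) (x : ι → R) (f : MvPolynomial ι A) : R :=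
  ∑ m ∈ f.support, c (f.coeff m) * monomialEval e x m

namespace IsEvalData

variable {A : Type*} [CommRing A] {c : A → R} (h : IsEvalData e c x)

include h

theorem polyEval_add (f g : MvPolynomial ι A) :
    polyEval e c x (f + g) = polyEval e c x f + polyEval e c x g := by
  have hs : ∀ f : MvPolynomial ι A, polyEval e c x f =
      (AddMonoidAlgebra.coeff f).sum fun m a => c a * monomialEval e x m := fun f => rfl
  rw [hs, hs, hs]
  exact Finsupp.sum_add_index' (fun m => by rw [h.map_zero, zero_mul])
    fun m a b => by rw [h.map_add, add_mul]

theorem polyEval_monomial (m : ι →₀ ℕ) (a : A) :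
    polyEval e c x (MvPolynomial.monomial m a) = c a * monomialEval e x m :=
  MvPolynomial.sum_monomial_eq (b := fun m a => c a * monomialEval e x m)
    (by rw [h.map_zero, zero_mul])

theorem polyEval_C (a : A) : polyEval e c x (MvPolynomial.C a) = c a := by
  rw [MvPolynomial.C_apply, h.polyEval_monomial, monomialEval_zero, h.mul_e_coeff]

theorem polyEval_one : polyEval e c x 1 = e := by
  rw [← MvPolynomial.C_1, h.polyEval_C, h.map_one]

theorem polyEval_X (i : ι) : polyEval e c x (MvPolynomial.X i) = x i := by
  rw [MvPolynomial.X, h.polyEval_monomial, monomialEval_single h.comm h.mul_e, h.map_one, h.e_mul]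

theorem coeff_mul_monomialEval (a : A) (m : ι →₀ ℕ) :
    c a * monomialEval e x m = monomialEval e x m * c a :=
  mul_monomialEval_of_comm h.comm (by rw [h.mul_e_coeff, h.e_mul_coeff]) (h.comm_coeff a) m

theorem polyEval_mul_X (f : MvPolynomial ι A) (i : ι) :
    polyEval e c x (f * MvPolynomial.X i) = polyEval e c x f * x i := by
  induction f using MvPolynomial.induction_on' with
  | monomial m a =>
    rw [MvPolynomial.X, MvPolynomial.monomial_mul, mul_one, h.polyEval_monomial,
      h.polyEval_monomial, monomialEval_add_single h.comm, mul_assoc,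
      mul_monomialEval_of_comm h.comm (by rw [h.mul_e, h.e_mul]) fun j => h.comm i j]
  | add f g hf hg => rw [add_mul, h.polyEval_add, hf, hg, h.polyEval_add, add_mul]

theorem polyEval_mul_C (f : MvPolynomial ι A) (a : A) :
    polyEval e c x (f * MvPolynomial.C a) = polyEval e c x f * c a := by
  induction f using MvPolynomial.induction_on' with
  | monomial m b =>
    rw [MvPolynomial.C_apply, MvPolynomial.monomial_mul, add_zero, h.polyEval_monomial,
      h.polyEval_monomial, h.map_mul, mul_assoc, mul_assoc, h.coeff_mul_monomialEval]
  | add f g hf hg => rw [add_mul, h.polyEval_add, hf, hg, h.polyEval_add, add_mul]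

theorem polyEval_mul (f g : MvPolynomial ι A) :
    polyEval e c x (f * g) = polyEval e c x f * polyEval e c x g := by
  induction g using MvPolynomial.induction_on with
  | C a => rw [h.polyEval_mul_C, h.polyEval_C]
  | add p q hp hq => rw [mul_add, h.polyEval_add, hp, hq, h.polyEval_add, mul_add]
  | mul_X p i hp => rw [← mul_assoc, h.polyEval_mul_X, hp, h.polyEval_mul_X, mul_assoc]

theorem polyEval_mul_e (f : MvPolynomial ι A) : polyEval e c x f * e = polyEval e c x f := by
  have := h.polyEval_mul f 1
  rwa [mul_one, h.polyEval_one, eq_comm] at this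

theorem e_mul_polyEval (f : MvPolynomial ι A) : e * polyEval e c x f = polyEval e c x f := by
  have := h.polyEval_mul 1 f
  rwa [one_mul, h.polyEval_one, eq_comm] at this

/-- If an element intertwines the values of the coefficients and of the variables with those of
their images under a ring homomorphism, then it intertwines the values of all polynomials. -/
theorem polyEval_intertwine {B : Type*} [CommRing B] (φ : MvPolynomial ι A →+* B) (d : B → R)
    (hadd : ∀ a b, d (a + b) = d a + d b) (hmul : ∀ a b, d (a * b) = d a * d b) {u : R}
    (hc : ∀ a, u * c a = d (φ (MvPolynomial.C a)) * u)
    (hx : ∀ i, u * x i = d (φ (MvPolynomial.X i)) * u) (f : MvPolynomial ι A) :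
    u * polyEval e c x f = d (φ f) * u := by
  induction f using MvPolynomial.induction_on with
  | C a => rw [h.polyEval_C, hc]
  | add p q hp hq =>
    rw [h.polyEval_add, mul_add, hp, hq, _root_.map_add φ, hadd, add_mul]
  | mul_X p i hp =>
    rw [h.polyEval_mul, h.polyEval_X, ← mul_assoc, hp, mul_assoc, hx, _root_.map_mul φ, hmul,
      mul_assoc]

theorem polyEval_intertwine' {B : Type*} [CommRing B] (φ : MvPolynomial ι A →+* B) (d : B → R)
    (hadd : ∀ a b, d (a + b) = d a + d b) (hmul : ∀ a b, d (a * b) = d a * d b) {u : R}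
    (hc : ∀ a, c a * u = u * d (φ (MvPolynomial.C a)))
    (hx : ∀ i, x i * u = u * d (φ (MvPolynomial.X i))) (f : MvPolynomial ι A) :
    polyEval e c x f * u = u * d (φ f) := by
  induction f using MvPolynomial.induction_on with
  | C a => rw [h.polyEval_C, hc]
  | add p q hp hq =>
    rw [h.polyEval_add, add_mul, hp, hq, _root_.map_add φ, hadd, mul_add]
  | mul_X p i hp =>
    rw [h.polyEval_mul, h.polyEval_X, mul_assoc, hx, ← mul_assoc, hp, _root_.map_mul φ, hmul,
      mul_assoc]

end IsEvalData

end MonomialEval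

/-! ### Generators of a universal localization -/

/-- `N` is the inverse of the matrix `A` over the corner with unit `e`. -/
def IsCornerInvMat {R ι : Type*} [NonUnitalRing R] [Fintype ι] [DecidableEq ι] (e : R)
    (A N : Matrix ι ι R) : Prop :=
  (∀ i j, e * N i j = N i j ∧ N i j * e = N i j) ∧
    (∀ i j, ∑ k, A i k * N k j = if i = j then e else 0) ∧
    ∀ i j, ∑ k, N i k * A k j = if i = j then e else 0

/-- The entries of `M` lie in the corner with unit the idempotent `M.e`. -/
def CornerMat.IsProper {R : Type*} [NonUnitalRing R] (M : CornerMat R) : Prop :=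
  M.e * M.e = M.e ∧ ∀ i j, M.e * M.A i j = M.A i j ∧ M.A i j * M.e = M.A i j

section InvMat

variable {R R' ι : Type*} [NonUnitalRing R] [NonUnitalRing R'] [Fintype ι] [DecidableEq ι]

theorem IsCornerInvMat.map {e : R} {A N : Matrix ι ι R} (h : IsCornerInvMat e A N)
    {F : Type*} [FunLike F R R'] [NonUnitalRingHomClass F R R'] (f : F) :
    IsCornerInvMat (f e) (A.map f) (N.map f) := by
  refine ⟨fun i j => ?_, fun i j => ?_, fun i j => ?_⟩
  · simp only [Matrix.map_apply, ← map_mul, h.1 i j, and_self]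
  · simp only [Matrix.map_apply, ← map_mul, ← map_sum, h.2.1 i j]
    split <;> simp
  · simp only [Matrix.map_apply, ← map_mul, ← map_sum, h.2.2 i j]
    split <;> simp

theorem IsCornerInvMat.unique {e : R} {A N N' : Matrix ι ι R} (h : IsCornerInvMat e A N)
    (h' : IsCornerInvMat e A N') : N = N' := by
  ext i j
  have h1 : ∑ k, ∑ l, N i k * (A k l * N' l j) = N i j := by
    simp only [← Finset.mul_sum, h'.2.1, mul_ite, mul_zero, Finset.sum_ite_eq', Finset.mem_univ,
      if_true, h.1]
  have h2 : ∑ k, ∑ l, N i k * (A k l * N' l j) = N' i j := by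
    rw [Finset.sum_comm]
    simp only [← mul_assoc, ← Finset.sum_mul, h.2.2, ite_mul, zero_mul, Finset.sum_ite_eq,
      Finset.mem_univ, if_true, h'.1]
  rw [← h1, h2]

end InvMat

theorem IsCornerInvMat.isCornerInv {R : Type*} [NonUnitalRing R] {e x : R}
    {N : Matrix (Fin 1) (Fin 1) R} (h : IsCornerInvMat e (fun _ _ => x) N) :
    IsCornerInv e x (N 0 0) :=
  ⟨(h.1 0 0).1, (h.1 0 0).2, by simpa using h.2.1 0 0, by simpa using h.2.2 0 0⟩

theorem CornerMat.isProper_single {R : Type*} [NonUnitalRing R] {e x : R} (he : e * e = e)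
    (h : e * x = x) (h' : x * e = x) : (CornerMat.single e x).IsProper :=
  ⟨he, fun _ _ => ⟨h, h'⟩⟩

section LocGen

variable (K : Type*) [Field K]
variable {R : Type*} [NonUnitalRing R] [Module K R] [IsScalarTower K R R] [SMulCommClass K R R]
variable {S : Set (CornerMat R)}

/-- The inclusion of `R S⁻¹` in the localization of the unitization. -/
def Loc.val (S : Set (CornerMat R)) : Loc K S →ₙₐ[K] LocAmbient K S :=
  NonUnitalSubalgebraClass.subtype (locSub K S)

theorem Loc.val_injective : Function.Injective (Loc.val K S) := Subtype.val_injective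

theorem Loc.val_of (a : R) : Loc.val K S (Loc.of K S a) = locHom K S a := rfl

theorem Loc.exists_of_mem {x : LocAmbient K S}
    (hx : x ∈ TwoSidedIdeal.span (Set.range (locHom K S))) : ∃ y, Loc.val K S y = x :=
  ⟨⟨x, hx⟩, rfl⟩

theorem Loc.val_mem (y : Loc K S) :
    Loc.val K S y ∈ TwoSidedIdeal.span (Set.range (locHom K S)) := y.2

theorem Loc.map_of {R' : Type*} [NonUnitalRing R'] [Module K R'] [IsScalarTower K R' R']
    [SMulCommClass K R' R'] {S' : Set (CornerMat R')} (f : R →ₙₐ[K] R') (h : ∀ M ∈ S, M.map f ∈ S')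
    (a : R) : Loc.map K f h (Loc.of K S a) = Loc.of K S' (f a) := by
  apply Loc.val_injective K
  change locAmbientMap K f h (locHom K S a) = locHom K S' (f a)
  rw [locHom_apply, locAmbientMap, UnivLoc.lift_of, lift_inr]
  rfl

/-- In the localization of the unitization, the inverse of the matrix `(1 - e) I + A` attached to
`M` is `(1 - e) I + N`, with `N` the inverse of `A` over the corner. -/
theorem Loc.exists_inverse {M : CornerMat R} (hM : M ∈ S) (hP : M.IsProper) :
    ∃ (N : Matrix (Fin M.n) (Fin M.n) (Loc K S)) (U : Matrix (Fin M.n) (Fin M.n) (LocAmbient K S)),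
      IsCornerInvMat (Loc.of K S M.e) (M.A.map (Loc.of K S)) N ∧
      (∀ i j, U i j = (if i = j then 1 - Loc.val K S (Loc.of K S M.e) else 0) +
        Loc.val K S (N i j)) ∧
      U * (show Matrix (Fin M.n) (Fin M.n) (LocAmbient K S) from
        (CornerMat.unitize K M).2.map (UnivLoc.of K (CornerMat.unitize K '' S))) = 1 := by
  set e := locHom K S M.e with he
  set B : Matrix (Fin M.n) (Fin M.n) (LocAmbient K S) := M.A.map (locHom K S) with hB
  set T : Matrix (Fin M.n) (Fin M.n) (LocAmbient K S) :=
    (CornerMat.unitize K M).2.map (UnivLoc.of K (CornerMat.unitize K '' S)) with hT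
  have hTB : T = Matrix.diagonal (fun _ => 1 - e) + B := by
    ext i j
    change UnivLoc.of K (CornerMat.unitize K '' S)
      ((if i = j then 1 - (M.e : Unitization K R) else 0) + (M.A i j : Unitization K R)) = _
    rw [map_add]
    refine congrArg₂ (· + ·) ?_ rfl
    rw [apply_ite (UnivLoc.of K _), map_sub, map_one, map_zero]
    rfl
  have hee : e * e = e := by rw [he, ← map_mul, hP.1]
  have heB : ∀ i j, e * B i j = B i j := fun i j => by
    rw [he, hB, Matrix.map_apply, ← map_mul, (hP.2 i j).1]
  have hBe : ∀ i j, B i j * e = B i j := fun i j => by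
    rw [he, hB, Matrix.map_apply, ← map_mul, (hP.2 i j).2]
  set D : Matrix (Fin M.n) (Fin M.n) (LocAmbient K S) := Matrix.diagonal (fun _ => e) with hD
  have hDB : D * B = B := by ext i j; rw [hD, Matrix.diagonal_mul, heB]
  have hBD : B * D = B := by ext i j; rw [hD, Matrix.mul_diagonal, hBe]
  have hDD : D * D = D := by rw [hD, Matrix.diagonal_mul_diagonal, hee]
  have hT' : T = 1 - D + B := by
    rw [hTB, hD, ← Matrix.diagonal_one, Matrix.diagonal_sub]
  have hu : IsUnit T := UnivLoc.isUnit_map_of (K := K)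
    (S := CornerMat.unitize K '' S) (Set.mem_image_of_mem (CornerMat.unitize K) hM)
  obtain ⟨U, hTU, hUT⟩ := isUnit_iff_exists.1 hu
  have hDT : D * T = B := by rw [hT', mul_add, mul_sub, mul_one, hDD, hDB, sub_self, zero_add]
  have hTD : T * D = B := by rw [hT', add_mul, sub_mul, one_mul, hDD, hBD, sub_self, zero_add]
  have hBU : B * U = D := by rw [← hDT, mul_assoc, hTU, mul_one]
  have hUB : U * B = D := by rw [← hTD, ← mul_assoc, hUT, one_mul]
  -- `U` is the inverse of `1 - e + A` over the whole ring; it commutes with `e`, is the identity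
  -- in the complementary corner, and `e U` is the inverse of `A` over the corner
  have hUD : U * D = D * U :=
    calc U * D = U * (B * U) := by rw [hBU]
      _ = D * U := by rw [← mul_assoc, hUB]
  have hU : U = 1 - D + D * U := by
    have h1 : (1 - D) * U = 1 - D := by
      have : (1 - D) * T = 1 - D := by rw [sub_mul, one_mul, hDT, hT']; abel
      calc (1 - D) * U = (1 - D) * T * U := by rw [this]
        _ = 1 - D := by rw [mul_assoc, hTU, mul_one]
    rw [sub_mul, one_mul] at h1
    rw [← h1]; abel
  have hmem : ∀ i j, ∃ y, Loc.val K S y = (D * U) i j := fun i j => by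
    refine Loc.exists_of_mem K ?_
    rw [hD, Matrix.diagonal_mul]
    exact TwoSidedIdeal.mul_mem_right _ _ _ (TwoSidedIdeal.subset_span (Set.mem_range_self _))
  choose N hN using hmem
  refine ⟨N, U, ⟨fun i j => ⟨?_, ?_⟩, fun i j => ?_, fun i j => ?_⟩, fun i j => ?_, hUT⟩
  · apply Loc.val_injective
    rw [map_mul, hN, Loc.val_of, ← he, hD, Matrix.diagonal_mul, ← mul_assoc, hee]
  · apply Loc.val_injective
    rw [map_mul, hN, Loc.val_of, ← he, ← hUD, hD, Matrix.mul_diagonal, mul_assoc, hee]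
  · apply Loc.val_injective
    have h : B * (D * U) = D := by rw [← mul_assoc, hBD, hBU]
    have h' := congrFun (congrFun h i) j
    rw [hD, Matrix.mul_apply, Matrix.diagonal_apply, ← hD] at h'
    rw [map_sum, apply_ite (Loc.val K S), map_zero, Loc.val_of, ← he, ← h']
    exact Finset.sum_congr rfl fun k _ => by rw [map_mul, hN]; rfl
  · apply Loc.val_injective
    have h : D * U * B = D := by rw [mul_assoc, hUB, hDD]
    have h' := congrFun (congrFun h i) j
    rw [Matrix.mul_apply, hD, Matrix.diagonal_apply, ← hD] at h'
    rw [map_sum, apply_ite (Loc.val K S), map_zero, Loc.val_of, ← he, ← h']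
    exact Finset.sum_congr rfl fun k _ => by rw [map_mul, hN]; rfl
  · rw [hN, Loc.val_of, ← he]
    conv_lhs => rw [hU]
    rw [Matrix.add_apply, Matrix.sub_apply, Matrix.one_apply, hD, Matrix.diagonal_apply]
    congr 1
    split <;> simp

theorem Loc.isCornerInv {e x : R} (hM : CornerMat.single e x ∈ S)
    (hP : (CornerMat.single e x).IsProper) :
    IsCornerInv (Loc.of K S e) (Loc.of K S x) (cornerInv (Loc.of K S e) (Loc.of K S x)) := by
  obtain ⟨N, _, hN, -⟩ := Loc.exists_inverse K hM hP
  exact (IsCornerInvMat.isCornerInv hN).isCornerInv_cornerInv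

/-- A localization `R S⁻¹` is generated by the image of `R` and by the entries of the inverses of
the matrices in `S`. -/
theorem Loc.mem_of_generators (hP : ∀ M ∈ S, M.IsProper) (T : NonUnitalSubalgebra K (Loc K S))
    (hof : ∀ a, Loc.of K S a ∈ T)
    (hinv : ∀ M ∈ S, ∀ N, IsCornerInvMat (Loc.of K S M.e) (M.A.map (Loc.of K S)) N →
      ∀ i j, N i j ∈ T) (y : Loc K S) : y ∈ T := by
  -- the localization of the unitization is `K + T`
  have key : ∀ x : LocAmbient K S, ∃ c : K, ∃ t ∈ T,
      x = algebraMap K (LocAmbient K S) c + Loc.val K S t := by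
    intro x
    obtain ⟨x, rfl⟩ : ∃ y, UnivLoc.mk K _ y = x := RingQuot.mkAlgHom_surjective K _ x
    induction x using FreeAlgebra.induction with
    | grade0 c => exact ⟨c, 0, zero_mem T, by rw [AlgHom.commutes, map_zero, add_zero]⟩
    | grade1 g =>
      obtain a | ⟨⟨_, M, hM, rfl⟩, i, j⟩ := g
      · refine ⟨a.fst, Loc.of K S a.snd, hof _, ?_⟩
        change UnivLoc.of K (CornerMat.unitize K '' S) a = _
        conv_lhs => rw [← Unitization.inl_fst_add_inr_snd_eq a]
        rw [map_add]
        refine congrArg₂ (· + ·) ?_ rfl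
        exact AlgHom.commutes (UnivLoc.of K (CornerMat.unitize K '' S)) a.fst
      · obtain ⟨N, U, hN, hU, hU1⟩ := Loc.exists_inverse K hM (hP M hM)
        let W : Matrix (Fin M.n) (Fin M.n) (LocAmbient K S) := fun i j =>
          UnivLoc.mk K _ (UnivLoc.gI K (CornerMat.unitize K '' S) ⟨_, M, hM, rfl⟩ i j)
        have hW : (show Matrix (Fin M.n) (Fin M.n) (LocAmbient K S) from
            (CornerMat.unitize K M).2.map (UnivLoc.of K (CornerMat.unitize K '' S))) * W = 1 := by
          ext i j
          have h := UnivLoc.mk_rel (UnivLoc.Rel.mul_inv (K := K) (S := CornerMat.unitize K '' S)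
            ⟨_, M, hM, rfl⟩ i j)
          rw [map_sum, apply_ite (UnivLoc.mk K _), map_one, map_zero] at h
          rw [Matrix.mul_apply, Matrix.one_apply]
          refine Eq.trans ?_ h
          exact Finset.sum_congr rfl fun k _ => (map_mul (UnivLoc.mk K _) _ _).symm
        have hWU : ∀ i j : Fin M.n, ∃ c : K, ∃ t ∈ T,
            W i j = algebraMap K (LocAmbient K S) c + Loc.val K S t := by
          intro i j
          -- the formal inverse `W` is `(1 - e) I + N`, and `1` belongs to `K`
          rw [← left_inv_eq_right_inv hU1 hW, hU]
          split
          · refine ⟨1, N i j - Loc.of K S M.e, sub_mem (hinv M hM N hN i j) (hof _), ?_⟩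
            rw [map_one, map_sub]
            abel
          · exact ⟨0, N i j, hinv M hM N hN i j, by rw [map_zero]⟩
        exact hWU i j
    | mul a b ha hb =>
      obtain ⟨c, s, hs, hc⟩ := ha
      obtain ⟨d, t, ht, hd⟩ := hb
      refine ⟨c * d, c • t + d • s + s * t,
        add_mem (add_mem (T.smul_mem' c ht) (T.smul_mem' d hs)) (mul_mem hs ht), ?_⟩
      rw [map_mul, hc, hd]
      simp only [Algebra.algebraMap_eq_smul_one, add_mul, mul_add, smul_mul_assoc, mul_smul_comm,
        one_mul, mul_one, map_add, map_smul, map_mul, smul_add]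
      rw [smul_comm d c]
      abel
    | add a b ha hb =>
      obtain ⟨c, s, hs, hc⟩ := ha
      obtain ⟨d, t, ht, hd⟩ := hb
      refine ⟨c + d, s + t, add_mem hs ht, ?_⟩
      rw [map_add, hc, hd, map_add, map_add]
      abel
  have hmul : ∀ (x : LocAmbient K S) (t : Loc K S), t ∈ T →
      (∃ s ∈ T, Loc.val K S s = x * Loc.val K S t) ∧
        ∃ s ∈ T, Loc.val K S s = Loc.val K S t * x := by
    intro x t ht
    obtain ⟨c, s, hs, rfl⟩ := key x
    constructor
    · refine ⟨c • t + s * t, add_mem (T.smul_mem' c ht) (mul_mem hs ht), ?_⟩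
      rw [map_add, map_smul, map_mul, add_mul, Algebra.smul_def]
    · refine ⟨c • t + t * s, add_mem (T.smul_mem' c ht) (mul_mem ht hs), ?_⟩
      rw [map_add, map_smul, map_mul, mul_add, Algebra.smul_def, Algebra.commutes]
  -- hence `T` is a two-sided ideal, which contains the image of `R`
  have hle : TwoSidedIdeal.span (Set.range (locHom K S)) ≤
      TwoSidedIdeal.mk' (Loc.val K S '' T) ⟨0, zero_mem T, map_zero _⟩
        (by rintro _ _ ⟨s, hs, rfl⟩ ⟨t, ht, rfl⟩; exact ⟨s + t, add_mem hs ht, map_add _ _ _⟩)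
        (by rintro _ ⟨s, hs, rfl⟩; exact ⟨-s, neg_mem hs, map_neg _ _⟩)
        (by rintro x _ ⟨s, hs, rfl⟩; exact (hmul x s hs).1)
        (by rintro _ x ⟨s, hs, rfl⟩; exact (hmul x s hs).2) := by
    rw [TwoSidedIdeal.span_le]
    rintro _ ⟨a, rfl⟩
    exact (TwoSidedIdeal.mem_mk' ..).2 ⟨_, hof a, rfl⟩
  obtain ⟨t, ht, h⟩ := (TwoSidedIdeal.mem_mk' ..).1 (hle (Loc.val_mem K y))
  exact Loc.val_injective K h ▸ ht

end LocGen

/-! ### Substitutions in rational functions -/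

namespace SepGraph.Adaptable

section Substitution

variable {K : Type*} [Field K]

/-- The endomorphism `t_i ↦ t_{ρ i}` of `L = K(t_1, t_2, …)`, for an injective `ρ`. -/
def renameL (ρ : ℕ → ℕ) (hρ : Function.Injective ρ) : L K →+* L K :=
  IsFractionRing.map (A := MvPolynomial ℕ K) (B := MvPolynomial ℕ K) (K := L K) (L := L K)
    (j := (MvPolynomial.rename ρ : MvPolynomial ℕ K →ₐ[K] MvPolynomial ℕ K).toRingHom)
    (MvPolynomial.rename_injective ρ hρ)

theorem renameL_algebraMap (ρ : ℕ → ℕ) (hρ : Function.Injective ρ) (f : MvPolynomial ℕ K) :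
    renameL ρ hρ (algebraMap (MvPolynomial ℕ K) (L K) f) = algebraMap (MvPolynomial ℕ K) (L K) (MvPolynomial.rename ρ f) :=
  IsLocalization.map_eq (M := nonZeroDivisors (MvPolynomial ℕ K))
    (T := nonZeroDivisors (MvPolynomial ℕ K)) (nonZeroDivisors_le_comap_nonZeroDivisors_of_injective
      _ (MvPolynomial.rename_injective ρ hρ)) f

variable {k : ℕ}

/-- The substitution `x_i ↦ 0` in polynomials. -/
def evalZeroAt {A : Type*} [CommRing A] (i : Fin k) :
    MvPolynomial (Fin k) A →+* MvPolynomial (Fin k) A :=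
  MvPolynomial.eval₂Hom MvPolynomial.C fun j => if j = i then 0 else MvPolynomial.X j

theorem X_dvd_sub_evalZeroAt {A : Type*} [CommRing A] (i : Fin k) (f : MvPolynomial (Fin k) A) :
    MvPolynomial.X i ∣ f - evalZeroAt i f := by
  induction f using MvPolynomial.induction_on with
  | C a => simp [evalZeroAt]
  | add p q hp hq =>
    rw [map_add, add_sub_add_comm]
    exact dvd_add hp hq
  | mul_X p j hp =>
    rw [map_mul]
    by_cases h : j = i
    · have h0 : evalZeroAt i (MvPolynomial.X j : MvPolynomial (Fin k) A) = 0 := by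
        simp [evalZeroAt, h]
      rw [h0, mul_zero, sub_zero, h]
      exact dvd_mul_left _ _
    · have h0 : evalZeroAt i (MvPolynomial.X j : MvPolynomial (Fin k) A) = MvPolynomial.X j := by
        simp [evalZeroAt, h]
      rw [h0, ← sub_mul]
      exact dvd_mul_of_dvd_left hp _

/-- The position in `{0, …, k - 2}` of `j ≠ i`, when `i` is left out of `{0, …, k - 1}`. -/
def skip (i j : Fin k) : ℕ := if j < i then j else j - 1

/-- The ring homomorphism `L[x_0, …, x_{k-1}] → L` that sends `x_i` to `0`, the other variables to
`t_0, …, t_{k-2}`, and the variables `t_n` of the coefficients to `t_{n+k-1}`. -/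
def substHom (i : Fin k) : MvPolynomial (Fin k) (L K) →+* L K :=
  MvPolynomial.eval₂Hom (renameL (· + (k - 1)) (add_left_injective _))
    fun j => if j = i then 0 else algebraMap (MvPolynomial ℕ K) (L K) (MvPolynomial.X (skip i j))

theorem substHom_C (i : Fin k) (l : L K) : substHom i (MvPolynomial.C l) =
    renameL (· + (k - 1)) (add_left_injective _) l :=
  MvPolynomial.eval₂Hom_C _ _ _

theorem substHom_X (i j : Fin k) : substHom (K := K) i (MvPolynomial.X j) =
    if j = i then 0 else algebraMap (MvPolynomial ℕ K) (L K) (MvPolynomial.X (skip i j)) :=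
  MvPolynomial.eval₂Hom_X' _ _ _

/-- A one-sided inverse of `substHom i` on polynomials in the `t_n`. -/
def substInv (i : Fin k) : MvPolynomial ℕ K →+* MvPolynomial (Fin k) (L K) :=
  MvPolynomial.eval₂Hom (MvPolynomial.C.comp (algebraMap K (L K))) fun n =>
    if h : n < k - 1 then MvPolynomial.X ⟨if n < i then n else n + 1, by split <;> omega⟩
    else MvPolynomial.C (algebraMap (MvPolynomial ℕ K) (L K) (MvPolynomial.X (n - (k - 1))))

theorem substHom_substInv (i : Fin k) (f : MvPolynomial ℕ K) :
    substHom i (substInv i f) = algebraMap (MvPolynomial ℕ K) (L K) f := by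
  suffices h : (substHom i).comp (substInv i) = algebraMap (MvPolynomial ℕ K) (L K) from
    congrArg (fun g : MvPolynomial ℕ K →+* L K => g f) h
  refine MvPolynomial.ringHom_ext (fun a => ?_) fun n => ?_
  · rw [RingHom.comp_apply, substInv, MvPolynomial.eval₂Hom_C, RingHom.comp_apply, substHom_C,
      IsScalarTower.algebraMap_apply K (MvPolynomial ℕ K) (L K), renameL_algebraMap,
      MvPolynomial.algebraMap_eq, MvPolynomial.rename_C]
  · rw [RingHom.comp_apply, substInv, MvPolynomial.eval₂Hom_X']
    have hi := i.2
    split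
    · rename_i h
      rw [substHom_X, if_neg, skip]
      · congr 2
        by_cases hn : n < i
        · simp [hn, Fin.lt_def]
        · have : ¬ (n + 1 < (i : ℕ)) := by omega
          simp [hn, Fin.lt_def, this]
      · intro h'
        have := congrArg Fin.val h'
        simp only at this
        split at this <;> omega
    · rename_i h
      rw [substHom_C, renameL_algebraMap, MvPolynomial.rename_X, Nat.sub_add_cancel (not_lt.1 h)]

theorem substInv_injective (i : Fin k) : Function.Injective (substInv (K := K) i) := by
  intro f g h
  apply IsFractionRing.injective (MvPolynomial ℕ K) (L K)
  rw [← substHom_substInv i, h, substHom_substInv]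

theorem substInv_X_skip {i m : Fin k} (hm : m ≠ i) :
    substInv (K := K) i (MvPolynomial.X (skip i m)) = MvPolynomial.X m := by
  have h1 := i.2
  have h2 := m.2
  have h3 : (m : ℕ) ≠ i := fun h => hm (Fin.ext h)
  have h4 : skip i m = if (m : ℕ) < i then (m : ℕ) else m - 1 := rfl
  have h5 : skip i m < k - 1 := by rw [h4]; split <;> omega
  have h6 : (if skip i m < i then skip i m else skip i m + 1) = (m : ℕ) := by
    rw [h4]; split_ifs <;> omega
  rw [substInv, MvPolynomial.eval₂Hom_X', dif_pos h5]
  exact congrArg MvPolynomial.X (Fin.ext h6)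

/-- Up to an embedding of `L` into a field `F` that contains `L[x_0, …, x_{k-1}]`, the map
`substHom i` is the substitution `x_i ↦ 0`. -/
theorem exists_comp_substHom (i : Fin k) {F : Type*} [Field F]
    (j : MvPolynomial (Fin k) (L K) →+* F) (hj : Function.Injective j) :
    ∃ ψ : L K →+* F, ∀ f, ψ (substHom i f) = j (evalZeroAt i f) := by
  have hψ : Function.Injective (j.comp (substInv (K := K) i)) := hj.comp (substInv_injective i)
  let ψ : L K →+* F := IsFractionRing.lift hψ
  have hψ' : ∀ g, ψ (algebraMap (MvPolynomial ℕ K) (L K) g) = j (substInv i g) :=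
    fun g => IsFractionRing.lift_algebraMap hψ g
  have hC : ∀ l : L K, ψ (renameL (· + (k - 1)) (add_left_injective _) l) =
      j (MvPolynomial.C l) := by
    suffices h : ψ.comp (renameL (· + (k - 1)) (add_left_injective _)) =
        j.comp MvPolynomial.C from
      fun l => congrArg (fun g : L K →+* F => g l) h
    refine IsLocalization.ringHom_ext (nonZeroDivisors (MvPolynomial ℕ K))
      (MvPolynomial.ringHom_ext (fun a => ?_) fun n => ?_)
    · simp only [RingHom.comp_apply]
      rw [renameL_algebraMap, hψ', MvPolynomial.rename_C, substInv, MvPolynomial.eval₂Hom_C,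
        RingHom.comp_apply, IsScalarTower.algebraMap_apply K (MvPolynomial ℕ K) (L K),
        MvPolynomial.algebraMap_eq]
    · simp only [RingHom.comp_apply]
      rw [renameL_algebraMap, hψ', MvPolynomial.rename_X, substInv, MvPolynomial.eval₂Hom_X',
        dif_neg (by omega), Nat.add_sub_cancel]
  refine ⟨ψ, fun f => ?_⟩
  suffices key : ψ.comp (substHom i) = j.comp (evalZeroAt i) from
    congrArg (fun g : MvPolynomial (Fin k) (L K) →+* F => g f) key
  refine MvPolynomial.ringHom_ext (fun l => ?_) fun m => ?_
  · rw [RingHom.comp_apply, RingHom.comp_apply, substHom_C, hC, evalZeroAt,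
      MvPolynomial.eval₂Hom_C]
  · rw [RingHom.comp_apply, RingHom.comp_apply, substHom_X, evalZeroAt,
      MvPolynomial.eval₂Hom_X']
    split
    · rw [map_zero, map_zero]
    · rename_i hmi
      rw [hψ', substInv_X_skip hmi]

/-- The kernel of `substHom i` is generated by `x_i`. -/
theorem substHom_ne_zero {i : Fin k} {f : MvPolynomial (Fin k) (L K)}
    (hf : ¬ MvPolynomial.X i ∣ f) : substHom i f ≠ 0 := by
  intro h0
  have hinj := IsFractionRing.injective (MvPolynomial (Fin k) (L K))
    (FractionRing (MvPolynomial (Fin k) (L K)))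
  obtain ⟨ψ, hψ⟩ := exists_comp_substHom i _ hinj
  have h1 := hψ f
  rw [h0, map_zero] at h1
  have h2 : evalZeroAt i f = 0 := hinj (h1.symm.trans (map_zero _).symm)
  have h3 := X_dvd_sub_evalZeroAt i f
  rw [h2, sub_zero] at h3
  exact hf h3

end Substitution

end SepGraph.Adaptable

namespace SepGraph

theorem cls_r_le {V Ed : Type*} (G : SepGraph V Ed) (e : Ed) : G.cls (G.r e) ≤ G.cls (G.s e) :=
  letI := G.preorder
  toAntisymmetrization_le_toAntisymmetrization_iff.2 ⟨[e], .cons e (.nil _)⟩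

namespace Adaptable

variable {V Ed : Type*} {G : SepGraph V Ed} (D : G.Adaptable) (K : Type*) [Field K]

/-! ### Relations between the generators -/

section Relations

variable {R : Type*} [NonUnitalRing R] [Module K R] (φ : D.SAlg K →ₙₐ[K] R)

theorem sg_mem (T : NonUnitalSubalgebra K (D.SAlg K)) (h : ∀ x, D.sg K x ∈ T) (y : D.SAlg K) :
    y ∈ T := by
  have hle : D.sSub K ≤ T.map (NonUnitalSubalgebraClass.subtype (D.sSub K)) := by
    refine NonUnitalAlgebra.adjoin_le ?_
    rintro _ ⟨x, rfl⟩
    exact ⟨D.sg K x, h x, rfl⟩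
  obtain ⟨t, ht, he⟩ := hle y.2
  rwa [show y = t from Subtype.ext he.symm]

theorem map_sg_of_rel {x y z : Gen V Ed}
    (h : D.Rel K (FreeAlgebra.ι K x * FreeAlgebra.ι K y) (FreeAlgebra.ι K z)) :
    φ (D.sg K x) * φ (D.sg K y) = φ (D.sg K z) := by
  rw [← map_mul]
  refine congrArg φ (Subtype.ext ?_)
  change D.gen K x * D.gen K y = D.gen K z
  rw [gen, gen, gen, ← map_mul]
  exact RingQuot.mkAlgHom_rel K h

theorem map_sg_of_rel_zero {x y : Gen V Ed}
    (h : D.Rel K (FreeAlgebra.ι K x * FreeAlgebra.ι K y) 0) :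
    φ (D.sg K x) * φ (D.sg K y) = 0 := by
  rw [← map_mul, ← map_zero φ]
  refine congrArg φ (Subtype.ext ?_)
  change D.gen K x * D.gen K y = 0
  rw [gen, gen, ← map_mul, ← map_zero (RingQuot.mkAlgHom K (D.Rel K))]
  exact RingQuot.mkAlgHom_rel K h

theorem map_sg_of_rel_mul {x y z w : Gen V Ed}
    (h : D.Rel K (FreeAlgebra.ι K x * FreeAlgebra.ι K y) (FreeAlgebra.ι K z * FreeAlgebra.ι K w)) :
    φ (D.sg K x) * φ (D.sg K y) = φ (D.sg K z) * φ (D.sg K w) := by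
  rw [← map_mul, ← map_mul]
  refine congrArg φ (Subtype.ext ?_)
  change D.gen K x * D.gen K y = D.gen K z * D.gen K w
  rw [gen, gen, gen, gen, ← map_mul, ← map_mul]
  exact RingQuot.mkAlgHom_rel K h

theorem map_sg_sum (v : V) (Y : Set Ed) (hY : Y ∈ G.C v) :
    ∑ e ∈ (D.finite_part v Y hY).toFinset, φ (D.sg K (.edge e)) * φ (D.sg K (.star e)) =
      φ (D.sg K (.vert v)) := by
  simp only [← map_mul, ← map_sum]
  refine congrArg φ (Subtype.ext ?_)
  have h := RingQuot.mkAlgHom_rel K (Rel.sum (D := D) (K := K) v Y hY)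
  rw [map_sum] at h
  refine Eq.trans ?_ h
  refine (map_sum (NonUnitalSubalgebraClass.subtype (D.sSub K)) _ _).trans ?_
  exact Finset.sum_congr rfl fun e _ => (map_mul (RingQuot.mkAlgHom K (D.Rel K)) _ _).symm

variable [IsScalarTower K R R] [SMulCommClass K R R]

theorem isEvalData_t (v : V) : IsEvalData (φ (D.sg K (.vert v)))
    (fun a : K => a • φ (D.sg K (.vert v))) (fun i : ℕ => φ (D.sg K (.t v i true))) where
  map_one := one_smul _ _
  map_add _ _ := add_smul _ _ _
  map_mul a b := by
    rw [smul_mul_assoc, mul_smul_comm, D.map_sg_of_rel K φ (.vert_self v), mul_smul]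
  mul_e i := D.map_sg_of_rel K φ (.t_vert v i true)
  comm i j := D.map_sg_of_rel_mul K φ (.t_comm v i j true true)
  comm_coeff a i := by
    rw [smul_mul_assoc, mul_smul_comm, D.map_sg_of_rel K φ (.t_vert v i true),
      D.map_sg_of_rel K φ (.vert_t v i true)]

theorem map_tEval (v : V) (f : MvPolynomial ℕ K) :
    φ (D.tEval K v f) = polyEval (φ (D.sg K (.vert v))) (fun a : K => a • φ (D.sg K (.vert v)))
      (fun i : ℕ => φ (D.sg K (.t v i true))) f := by
  rw [tEval, polyEval, map_sum]
  refine Finset.sum_congr rfl fun m _ => ?_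
  rw [map_smul, map_monomialEval, smul_mul_assoc, mul_monomialEval_of_mul_eq
    (D.isEvalData_t K φ v).comm (D.map_sg_of_rel K φ (.vert_self v))
    fun i => D.map_sg_of_rel K φ (.vert_t v i true)]

end Relations

/-! ### The corners of `S_K^1(E, C)` and the field `L` -/

theorem sg1_vert_vert (v : V) : D.sg1 K (.vert v) * D.sg1 K (.vert v) = D.sg1 K (.vert v) :=
  D.map_sg_of_rel K (D.toS1 K) (.vert_self v)

theorem sg1_vert_vert_of_ne {v w : V} (h : v ≠ w) : D.sg1 K (.vert v) * D.sg1 K (.vert w) = 0 :=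
  D.map_sg_of_rel_zero K (D.toS1 K) (.vert_ne v w h)

theorem sg1_source (e : Ed) :
    D.sg1 K (.vert (G.s e)) * D.sg1 K (.edge e) = D.sg1 K (.edge e) :=
  D.map_sg_of_rel K (D.toS1 K) (.source e)

theorem sg1_range (e : Ed) :
    D.sg1 K (.edge e) * D.sg1 K (.vert (G.r e)) = D.sg1 K (.edge e) :=
  D.map_sg_of_rel K (D.toS1 K) (.range e)

theorem sg1_star_source (e : Ed) :
    D.sg1 K (.star e) * D.sg1 K (.vert (G.s e)) = D.sg1 K (.star e) :=
  D.map_sg_of_rel K (D.toS1 K) (.star_source e)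

theorem sg1_star_range (e : Ed) :
    D.sg1 K (.vert (G.r e)) * D.sg1 K (.star e) = D.sg1 K (.star e) :=
  D.map_sg_of_rel K (D.toS1 K) (.star_range e)

/-- The element of `S_K^1(E, C)` given by a polynomial in the `t_i^v`. -/
def tS (v : V) (f : MvPolynomial ℕ K) : D.S1 K := D.toS1 K (D.tEval K v f)

theorem isEvalData_tS (v : V) : IsEvalData (D.sg1 K (.vert v))
    (fun a : K => a • D.sg1 K (.vert v)) (fun i : ℕ => D.sg1 K (.t v i true)) :=
  D.isEvalData_t K (D.toS1 K) v

theorem tS_eq (v : V) (f : MvPolynomial ℕ K) : D.tS K v f = polyEval (D.sg1 K (.vert v))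
    (fun a : K => a • D.sg1 K (.vert v)) (fun i : ℕ => D.sg1 K (.t v i true)) f :=
  D.map_tEval K (D.toS1 K) v f

theorem tS_add (v : V) (f g : MvPolynomial ℕ K) :
    D.tS K v (f + g) = D.tS K v f + D.tS K v g := by
  simp only [tS_eq, (D.isEvalData_tS K v).polyEval_add]

theorem tS_mul (v : V) (f g : MvPolynomial ℕ K) :
    D.tS K v (f * g) = D.tS K v f * D.tS K v g := by
  simp only [tS_eq, (D.isEvalData_tS K v).polyEval_mul]

theorem tS_one (v : V) : D.tS K v 1 = D.sg1 K (.vert v) := by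
  rw [tS_eq, (D.isEvalData_tS K v).polyEval_one]

theorem tS_X (v : V) (i : ℕ) : D.tS K v (MvPolynomial.X i) = D.sg1 K (.t v i true) := by
  rw [tS_eq, (D.isEvalData_tS K v).polyEval_X]

theorem tS_mul_vert (v : V) (f : MvPolynomial ℕ K) :
    D.tS K v f * D.sg1 K (.vert v) = D.tS K v f := by
  rw [tS_eq, (D.isEvalData_tS K v).polyEval_mul_e]

theorem vert_mul_tS (v : V) (f : MvPolynomial ℕ K) :
    D.sg1 K (.vert v) * D.tS K v f = D.tS K v f := by
  rw [tS_eq, (D.isEvalData_tS K v).e_mul_polyEval]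

theorem isProper_sigmaOne : ∀ M ∈ D.sigmaOne K, M.IsProper := by
  rintro _ ⟨v, f, -, rfl⟩
  have h := D.isEvalData_t K (NonUnitalAlgHom.id K (D.SAlg K)) v
  have hf : D.tEval K v f = _ := D.map_tEval K (NonUnitalAlgHom.id K (D.SAlg K)) v f
  rw [hf]
  exact CornerMat.isProper_single (D.map_sg_of_rel K (NonUnitalAlgHom.id K (D.SAlg K))
    (.vert_self v)) (h.e_mul_polyEval f) (h.polyEval_mul_e f)

theorem isCornerInv_tS (v : V) {f : MvPolynomial ℕ K} (hf : f ≠ 0) :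
    IsCornerInv (D.sg1 K (.vert v)) (D.tS K v f) (cornerInv (D.sg1 K (.vert v)) (D.tS K v f)) := by
  have hM : CornerMat.single (D.sg K (.vert v)) (D.tEval K v f) ∈ D.sigmaOne K := ⟨v, f, hf, rfl⟩
  exact Loc.isCornerInv K hM (D.isProper_sigmaOne K _ hM)

theorem tS_comm (v : V) (f g : MvPolynomial ℕ K) :
    D.tS K v f * D.tS K v g = D.tS K v g * D.tS K v f := by
  rw [← tS_mul, mul_comm, tS_mul]

section Coef

variable {K}

/-- `coef v l` is determined by any presentation of `l` as a fraction. -/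
theorem coef_mul_tS (v : V) {l : L K} {a b : MvPolynomial ℕ K}
    (h : l * algebraMap _ (L K) b = algebraMap _ (L K) a) :
    D.coef K v l * D.tS K v b = D.tS K v a := by
  set ab := IsLocalization.sec (nonZeroDivisors (MvPolynomial ℕ K)) l with hab
  have hspec : l * algebraMap _ (L K) (ab.2 : MvPolynomial ℕ K) = algebraMap _ (L K) ab.1 :=
    IsLocalization.sec_spec _ l
  have hne : (ab.2 : MvPolynomial ℕ K) ≠ 0 := nonZeroDivisors.coe_ne_zero ab.2
  have hinv := D.isCornerInv_tS K v hne
  have hcross : ab.1 * b = a * ab.2 := by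
    apply IsFractionRing.injective (MvPolynomial ℕ K) (L K)
    rw [map_mul, map_mul, ← hspec, ← h]
    ring
  have hc : D.coef K v l = D.tS K v ab.1 * cornerInv (D.sg1 K (.vert v)) (D.tS K v ab.2) := rfl
  rw [hc, mul_assoc, hinv.intertwine hinv (D.vert_mul_tS K v b) (D.tS_mul_vert K v b)
    (D.tS_comm K v _ _), ← mul_assoc, ← tS_mul, hcross, tS_mul, mul_assoc, hinv.2.2.1,
    tS_mul_vert]

theorem vert_mul_coef (v : V) (l : L K) : D.sg1 K (.vert v) * D.coef K v l = D.coef K v l := by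
  change _ * (D.tS K v _ * _) = D.tS K v _ * _
  rw [← mul_assoc, vert_mul_tS]

theorem coef_mul_vert (v : V) (l : L K) : D.coef K v l * D.sg1 K (.vert v) = D.coef K v l := by
  have h := D.isCornerInv_tS K v (nonZeroDivisors.coe_ne_zero
    (IsLocalization.sec (nonZeroDivisors (MvPolynomial ℕ K)) l).2)
  change D.tS K v _ * cornerInv _ (D.tS K v _) * _ = D.tS K v _ * cornerInv _ (D.tS K v _)
  rw [mul_assoc, h.2.1]

theorem eq_coef (v : V) {l : L K} {a b : MvPolynomial ℕ K} (hb : b ≠ 0) {y : D.S1 K}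
    (h : l * algebraMap _ (L K) b = algebraMap _ (L K) a) (hy : y * D.sg1 K (.vert v) = y)
    (hyb : y * D.tS K v b = D.tS K v a) : y = D.coef K v l := by
  have hinv := D.isCornerInv_tS K v hb
  rw [← hy, ← hinv.2.2.1, ← mul_assoc, hyb, ← D.coef_mul_tS v h, mul_assoc, hinv.2.2.1,
    coef_mul_vert]

theorem exists_fraction (l : L K) : ∃ a b : MvPolynomial ℕ K, b ≠ 0 ∧
    l * algebraMap _ (L K) b = algebraMap _ (L K) a :=
  let ab := IsLocalization.sec (nonZeroDivisors (MvPolynomial ℕ K)) l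
  ⟨ab.1, ab.2, nonZeroDivisors.coe_ne_zero ab.2, IsLocalization.sec_spec _ l⟩

theorem coef_add (v : V) (l m : L K) : D.coef K v (l + m) = D.coef K v l + D.coef K v m := by
  obtain ⟨a, b, hb, h⟩ := exists_fraction l
  obtain ⟨c, d, hd, h'⟩ := exists_fraction m
  refine (D.eq_coef v (a := a * d + c * b) (mul_ne_zero hb hd) ?_ ?_ ?_).symm
  · rw [map_add, map_mul, map_mul, map_mul, ← h, ← h']; ring
  · rw [add_mul, coef_mul_vert, coef_mul_vert]
  · rw [add_mul, tS_add, tS_mul, tS_mul, tS_mul, ← mul_assoc, D.coef_mul_tS v h,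
      D.tS_comm K v b d, ← mul_assoc, D.coef_mul_tS v h']

theorem coef_mul (v : V) (l m : L K) : D.coef K v (l * m) = D.coef K v l * D.coef K v m := by
  obtain ⟨a, b, hb, h⟩ := exists_fraction l
  obtain ⟨c, d, hd, h'⟩ := exists_fraction m
  refine (D.eq_coef v (a := a * c) (mul_ne_zero hd hb) ?_ ?_ ?_).symm
  · rw [map_mul, map_mul, ← h, ← h']; ring
  · rw [mul_assoc, coef_mul_vert]
  · rw [tS_mul, mul_assoc, ← mul_assoc (D.coef K v m), D.coef_mul_tS v h', tS_comm, ← mul_assoc,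
      D.coef_mul_tS v h, tS_mul]

theorem coef_algebraMap (v : V) (a : MvPolynomial ℕ K) :
    D.coef K v (algebraMap (MvPolynomial ℕ K) (L K) a) = D.tS K v a :=
  (D.eq_coef v (a := a) (b := 1) one_ne_zero (by rw [map_one, mul_one]) (D.tS_mul_vert K v a)
    (by rw [tS_one, tS_mul_vert])).symm

theorem coef_one (v : V) : D.coef K v 1 = D.sg1 K (.vert v) := by
  have := D.coef_algebraMap v (1 : MvPolynomial ℕ K)
  rwa [map_one, tS_one] at this

theorem coef_zero (v : V) : D.coef K v 0 = 0 := by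
  have := D.coef_add v (0 : L K) 0
  rwa [add_zero, left_eq_add] at this

theorem coef_t_true (v : V) (i : ℕ) :
    D.coef K v (algebraMap (MvPolynomial ℕ K) (L K) (MvPolynomial.X i)) = D.sg1 K (.t v i true) := by
  rw [coef_algebraMap, tS_X]

theorem coef_t_false (v : V) (i : ℕ) :
    D.coef K v (algebraMap (MvPolynomial ℕ K) (L K) (MvPolynomial.X i))⁻¹ = D.sg1 K (.t v i false) := by
  refine (D.eq_coef v (b := MvPolynomial.X i) (a := 1) (MvPolynomial.X_ne_zero i) ?_
    (D.map_sg_of_rel K (D.toS1 K) (.t_vert v i false)) ?_).symm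
  · rw [map_one, inv_mul_cancel₀]
    exact (map_ne_zero_iff _ (IsFractionRing.injective _ _)).2 (MvPolynomial.X_ne_zero i)
  · rw [tS_X, tS_one]
    exact D.map_sg_of_rel K (D.toS1 K) (.t_inv v i false)

theorem isCornerInv_coef (v : V) {l : L K} (hl : l ≠ 0) :
    IsCornerInv (D.sg1 K (.vert v)) (D.coef K v l) (D.coef K v l⁻¹) :=
  ⟨D.vert_mul_coef v _, D.coef_mul_vert v _, by rw [← coef_mul, mul_inv_cancel₀ hl, coef_one],
    by rw [← coef_mul, inv_mul_cancel₀ hl, coef_one]⟩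

theorem coef_eq_tS_mul (v : V) {l : L K} {a b : MvPolynomial ℕ K} (hb : b ≠ 0)
    (h : l * algebraMap _ (L K) b = algebraMap _ (L K) a) : D.coef K v l =
      D.tS K v a * cornerInv (D.sg1 K (.vert v)) (D.tS K v b) := by
  rw [← D.coef_mul_tS v h, mul_assoc, (D.isCornerInv_tS K v hb).2.2.1, coef_mul_vert]

/-- An element that carries each `t_i^v` to `t_{ρ i}^w` carries `coef v l` to the image of `l` under
the substitution `t_i ↦ t_{ρ i}`. -/
theorem coef_mul_eq {v w : V} {u : D.S1 K} (ρ : ℕ → ℕ) (τ : L K →+* L K)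
    (hτ : ∀ f : MvPolynomial ℕ K,
      τ (algebraMap _ (L K) f) = algebraMap _ (L K) (MvPolynomial.rename ρ f))
    (hv : D.sg1 K (.vert v) * u = u) (hw : u * D.sg1 K (.vert w) = u)
    (ht : ∀ i, D.sg1 K (.t v i true) * u = u * D.sg1 K (.t w (ρ i) true)) (l : L K) :
    D.coef K v l * u = u * D.coef K w (τ l) := by
  have hT : ∀ f : MvPolynomial ℕ K, D.tS K v f * u = u * D.tS K w (MvPolynomial.rename ρ f) := by
    intro f
    rw [tS_eq]
    refine (D.isEvalData_tS K v).polyEval_intertwine' (MvPolynomial.rename ρ).toRingHom (D.tS K w)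
      (D.tS_add K w) (D.tS_mul K w) (fun a => ?_) (fun i => ?_) f
    · simp only [AlgHom.toRingHom_eq_coe, RingHom.coe_coe, MvPolynomial.rename_C]
      rw [tS_eq, (D.isEvalData_tS K w).polyEval_C, smul_mul_assoc, hv, mul_smul_comm, hw]
    · simp only [AlgHom.toRingHom_eq_coe, RingHom.coe_coe, MvPolynomial.rename_X]
      rw [tS_X, ht]
  obtain ⟨a, b, hb, h⟩ := exists_fraction l
  have h' : τ l * algebraMap _ (L K) (MvPolynomial.rename ρ b) =
      algebraMap _ (L K) (MvPolynomial.rename ρ a) := by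
    rw [← hτ, ← hτ, ← h, map_mul]
  have hb' : MvPolynomial.rename ρ b ≠ 0 := fun h0 => hb <| by
    have h1 : τ (algebraMap _ (L K) b) = 0 := by rw [hτ, h0, map_zero]
    exact IsFractionRing.injective _ (L K) (((map_eq_zero τ).1 h1).trans (map_zero _).symm)
  rw [D.coef_eq_tS_mul v hb h, D.coef_eq_tS_mul w hb' h', mul_assoc,
    (D.isCornerInv_tS K v hb).intertwine (D.isCornerInv_tS K w hb') hv hw (hT b), ← mul_assoc,
    hT, mul_assoc]

theorem mul_coef_eq {v w : V} {u : D.S1 K} (ρ : ℕ → ℕ) (τ : L K →+* L K)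
    (hτ : ∀ f : MvPolynomial ℕ K,
      τ (algebraMap _ (L K) f) = algebraMap _ (L K) (MvPolynomial.rename ρ f))
    (hv : u * D.sg1 K (.vert v) = u) (hw : D.sg1 K (.vert w) * u = u)
    (ht : ∀ i, u * D.sg1 K (.t v i true) = D.sg1 K (.t w (ρ i) true) * u) (l : L K) :
    u * D.coef K v l = D.coef K w (τ l) * u := by
  have hT : ∀ f : MvPolynomial ℕ K, u * D.tS K v f = D.tS K w (MvPolynomial.rename ρ f) * u := by
    intro f
    rw [tS_eq]
    refine (D.isEvalData_tS K v).polyEval_intertwine (MvPolynomial.rename ρ).toRingHom (D.tS K w)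
      (D.tS_add K w) (D.tS_mul K w) (fun a => ?_) (fun i => ?_) f
    · simp only [AlgHom.toRingHom_eq_coe, RingHom.coe_coe, MvPolynomial.rename_C]
      rw [tS_eq, (D.isEvalData_tS K w).polyEval_C, smul_mul_assoc, hw, mul_smul_comm, hv]
    · simp only [AlgHom.toRingHom_eq_coe, RingHom.coe_coe, MvPolynomial.rename_X]
      rw [tS_X, ht]
  obtain ⟨a, b, hb, h⟩ := exists_fraction l
  have h' : τ l * algebraMap _ (L K) (MvPolynomial.rename ρ b) =
      algebraMap _ (L K) (MvPolynomial.rename ρ a) := by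
    rw [← hτ, ← hτ, ← h, map_mul]
  have hb' : MvPolynomial.rename ρ b ≠ 0 := fun h0 => hb <| by
    have h1 : τ (algebraMap _ (L K) b) = 0 := by rw [hτ, h0, map_zero]
    exact IsFractionRing.injective _ (L K) (((map_eq_zero τ).1 h1).trans (map_zero _).symm)
  rw [D.coef_eq_tS_mul v hb h, D.coef_eq_tS_mul w hb' h', ← mul_assoc, hT, mul_assoc, mul_assoc,
    ((D.isCornerInv_tS K w hb').intertwine (D.isCornerInv_tS K v hb) hw hv (hT b).symm)]

theorem coef_mul_comm {v w : V} {u : D.S1 K} (hv : D.sg1 K (.vert v) * u = u)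
    (hw : u * D.sg1 K (.vert w) = u)
    (ht : ∀ i, D.sg1 K (.t v i true) * u = u * D.sg1 K (.t w i true)) (l : L K) :
    D.coef K v l * u = u * D.coef K w l :=
  D.coef_mul_eq id (RingHom.id _) (fun f => by simp) hv hw ht l

theorem star_mul_coef_of_reg {e : Ed} (he : G.cls (G.s e) ∉ D.free) (l : L K) :
    D.sg1 K (.star e) * D.coef K (G.s e) l = D.coef K (G.r e) l * D.sg1 K (.star e) :=
  (D.coef_mul_comm (D.sg1_star_range K e) (D.sg1_star_source K e)
    (fun i => (D.map_sg_of_rel_mul K (D.toS1 K) (.star_reg_t e i true he)).symm) l).symm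

end Coef

/-! ### Polynomials in the loops at a free vertex -/

section Free

variable {D} in
theorem X_mem (v : D.FreeV) (i : Fin (D.k v)) : D.X v i ∈ G.C v.1 :=
  D.free_range v ▸ Set.mem_range_self i

variable {D} in
theorem s_α (v : D.FreeV) (i : Fin (D.k v)) : G.s (D.α v i) = v.1 :=
  G.source_of_mem _ _ (X_mem v i) _ (D.α_mem v i)

variable {D} in
theorem IsBeta.s_eq {v : D.FreeV} {i : Fin (D.k v)} {e : Ed} (h : D.IsBeta v i e) :
    G.s e = v.1 :=
  G.source_of_mem _ _ (X_mem v i) _ h.1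

variable (v : D.FreeV)

theorem vert_mul_α (i : Fin (D.k v)) :
    D.sg1 K (.vert v.1) * D.sg1 K (.edge (D.α v i)) = D.sg1 K (.edge (D.α v i)) := by
  have := D.sg1_source K (D.α v i)
  rwa [s_α] at this

theorem α_mul_vert (i : Fin (D.k v)) :
    D.sg1 K (.edge (D.α v i)) * D.sg1 K (.vert v.1) = D.sg1 K (.edge (D.α v i)) := by
  have := D.sg1_range K (D.α v i)
  rwa [D.α_loop] at this

theorem α_star_mul_vert (i : Fin (D.k v)) :
    D.sg1 K (.star (D.α v i)) * D.sg1 K (.vert v.1) = D.sg1 K (.star (D.α v i)) := by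
  have := D.sg1_star_source K (D.α v i)
  rwa [s_α] at this

theorem vert_mul_α_star (i : Fin (D.k v)) :
    D.sg1 K (.vert v.1) * D.sg1 K (.star (D.α v i)) = D.sg1 K (.star (D.α v i)) := by
  have := D.sg1_star_range K (D.α v i)
  rwa [D.α_loop] at this

theorem α_comm' (i j : Fin (D.k v)) :
    D.sg1 K (.edge (D.α v i)) * D.sg1 K (.edge (D.α v j)) =
      D.sg1 K (.edge (D.α v j)) * D.sg1 K (.edge (D.α v i)) := by
  by_cases h : i = j
  · rw [h]
  · exact D.map_sg_of_rel_mul K (D.toS1 K) (.α_comm v i j h)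

theorem α_star_comm' {i j : Fin (D.k v)} (h : i ≠ j) :
    D.sg1 K (.edge (D.α v i)) * D.sg1 K (.star (D.α v j)) =
      D.sg1 K (.star (D.α v j)) * D.sg1 K (.edge (D.α v i)) :=
  D.map_sg_of_rel_mul K (D.toS1 K) (.α_star_comm v i j h)

theorem α_star_mul_α (i : Fin (D.k v)) :
    D.sg1 K (.star (D.α v i)) * D.sg1 K (.edge (D.α v i)) = D.sg1 K (.vert v.1) := by
  have := D.map_sg_of_rel K (D.toS1 K) (.star_edge (D.α v i))
  rwa [D.α_loop] at this

variable {K} in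
theorem coef_mul_α (i : Fin (D.k v)) (l : L K) :
    D.coef K v.1 l * D.sg1 K (.edge (D.α v i)) = D.sg1 K (.edge (D.α v i)) * D.coef K v.1 l :=
  D.coef_mul_comm (D.vert_mul_α K v i) (D.α_mul_vert K v i)
    (fun j => D.map_sg_of_rel_mul K (D.toS1 K) (.t_α v i j true)) l

variable {K} in
theorem coef_mul_α_star (i : Fin (D.k v)) (l : L K) :
    D.coef K v.1 l * D.sg1 K (.star (D.α v i)) = D.sg1 K (.star (D.α v i)) * D.coef K v.1 l :=
  D.coef_mul_comm (D.vert_mul_α_star K v i) (D.α_star_mul_vert K v i)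
    (fun j => D.map_sg_of_rel_mul K (D.toS1 K) (.t_α_star v i j true)) l

theorem isEvalData_α : IsEvalData (D.sg1 K (.vert v.1)) (D.coef K v.1)
    (fun i : Fin (D.k v) => D.sg1 K (.edge (D.α v i))) where
  map_one := D.coef_one v.1
  map_add := D.coef_add v.1
  map_mul := D.coef_mul v.1
  mul_e := D.α_mul_vert K v
  comm := D.α_comm' K v
  comm_coeff l i := D.coef_mul_α v i l

variable {K}

theorem αEval_add (f g : MvPolynomial (Fin (D.k v)) (L K)) :
    D.αEval K v (f + g) = D.αEval K v f + D.αEval K v g :=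
  (D.isEvalData_α K v).polyEval_add f g

theorem αEval_mul (f g : MvPolynomial (Fin (D.k v)) (L K)) :
    D.αEval K v (f * g) = D.αEval K v f * D.αEval K v g :=
  (D.isEvalData_α K v).polyEval_mul f g

theorem αEval_C (l : L K) : D.αEval K v (MvPolynomial.C l) = D.coef K v.1 l :=
  (D.isEvalData_α K v).polyEval_C l

theorem αEval_X (i : Fin (D.k v)) :
    D.αEval K v (MvPolynomial.X i) = D.sg1 K (.edge (D.α v i)) :=
  (D.isEvalData_α K v).polyEval_X i

theorem αEval_mul_vert (f : MvPolynomial (Fin (D.k v)) (L K)) :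
    D.αEval K v f * D.sg1 K (.vert v.1) = D.αEval K v f :=
  (D.isEvalData_α K v).polyEval_mul_e f

theorem vert_mul_αEval (f : MvPolynomial (Fin (D.k v)) (L K)) :
    D.sg1 K (.vert v.1) * D.αEval K v f = D.αEval K v f :=
  (D.isEvalData_α K v).e_mul_polyEval f

variable {v}

theorem β_star_mul_coef {i : Fin (D.k v)} {e : Ed} (h : D.IsBeta v i e) (l : L K) :
    D.sg1 K (.star e) * D.coef K v.1 l =
      D.coef K (G.r e) (renameL (· + (D.k v - 1)) (add_left_injective _) l) *
        D.sg1 K (.star e) :=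
  D.mul_coef_eq _ _ (renameL_algebraMap _ _) (by rw [← h.s_eq, sg1_star_source])
    (D.sg1_star_range K e)
    (fun j => D.map_sg_of_rel_mul K (D.toS1 K) (.star_t_β v i e j true h)) l

/-- Multiplying a polynomial in the loops by `β*` from the left amounts to a substitution. -/
theorem β_star_mul_αEval {i : Fin (D.k v)} {e : Ed} (h : D.IsBeta v i e)
    (f : MvPolynomial (Fin (D.k v)) (L K)) :
    D.sg1 K (.star e) * D.αEval K v f = D.coef K (G.r e) (substHom i f) * D.sg1 K (.star e) := by
  refine (D.isEvalData_α K v).polyEval_intertwine (substHom i) (D.coef K (G.r e))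
    (D.coef_add _) (D.coef_mul _) (fun l => ?_) (fun j => ?_) f
  · rw [substHom_C, D.β_star_mul_coef h]
  · rw [substHom_X]
    split
    · rename_i hji
      rw [hji, coef_zero, zero_mul]
      exact D.map_sg_of_rel_zero K (D.toS1 K)
        (.star_edge_ne v.1 _ (X_mem v i) e _ h.1 (D.α_mem v i) h.2)
    · rename_i hji
      rw [coef_t_true]
      exact D.map_sg_of_rel_mul K (D.toS1 K) (.star_α_star_β v j i e hji h)

/-- The commutator of `α_i*` with a polynomial in the loops factors through the projection
`v - α_i α_i*`. -/
theorem α_star_mul_αEval (i : Fin (D.k v)) (f : MvPolynomial (Fin (D.k v)) (L K)) :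
    ∃ g : MvPolynomial (Fin (D.k v)) (L K), D.sg1 K (.star (D.α v i)) * D.αEval K v f =
      D.αEval K v f * D.sg1 K (.star (D.α v i)) + D.αEval K v g *
        (D.sg1 K (.vert v.1) - D.sg1 K (.edge (D.α v i)) * D.sg1 K (.star (D.α v i))) := by
  have h0 : D.αEval K v 0 = 0 := by rw [← map_zero MvPolynomial.C, αEval_C, coef_zero]
  induction f using MvPolynomial.induction_on with
  | C l => exact ⟨0, by rw [h0, zero_mul, add_zero, αEval_C, coef_mul_α_star]⟩
  | add p q hp hq =>
    obtain ⟨g, hg⟩ := hp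
    obtain ⟨g', hg'⟩ := hq
    refine ⟨g + g', ?_⟩
    rw [αEval_add, αEval_add, mul_add, hg, hg', add_mul, add_mul]
    abel
  | mul_X p j hp =>
    obtain ⟨g, hg⟩ := hp
    by_cases hji : j = i
    · refine ⟨p, ?_⟩
      subst hji
      rw [αEval_mul, ← mul_assoc, hg, add_mul, αEval_X, mul_assoc, mul_assoc, sub_mul, mul_assoc,
        α_star_mul_α, α_mul_vert, vert_mul_α, sub_self, mul_zero, add_zero, mul_sub,
        mul_assoc (D.αEval K v p), add_sub_cancel]
    · refine ⟨g * MvPolynomial.X j, ?_⟩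
      have hc := D.α_star_comm' K v hji
      have hp' : (D.sg1 K (.vert v.1) - D.sg1 K (.edge (D.α v i)) * D.sg1 K (.star (D.α v i))) *
          D.sg1 K (.edge (D.α v j)) = D.sg1 K (.edge (D.α v j)) *
          (D.sg1 K (.vert v.1) - D.sg1 K (.edge (D.α v i)) * D.sg1 K (.star (D.α v i))) := by
        rw [sub_mul, mul_sub, vert_mul_α, α_mul_vert, mul_assoc, ← hc, ← mul_assoc,
          D.α_comm' K v i j, mul_assoc]
      rw [αEval_mul, αEval_mul, ← mul_assoc, hg, add_mul, αEval_X, mul_assoc, mul_assoc, hp',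
        ← hc, mul_assoc, mul_assoc]

variable (K) in
theorem sum_β_mul_β_star (i : Fin (D.k v)) :
    ∃ s : Finset Ed, (∀ e ∈ s, D.IsBeta v i e) ∧
      D.sg1 K (.vert v.1) - D.sg1 K (.edge (D.α v i)) * D.sg1 K (.star (D.α v i)) =
        ∑ e ∈ s, D.sg1 K (.edge e) * D.sg1 K (.star e) := by
  classical
  have h := D.map_sg_sum K (D.toS1 K) v.1 _ (X_mem v i)
  set Y := (D.finite_part v.1 _ (X_mem v i)).toFinset with hY
  have hα : D.α v i ∈ Y := by rw [hY, Set.Finite.mem_toFinset]; exact D.α_mem v i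
  refine ⟨Y.erase (D.α v i), fun e he => ⟨?_, Finset.ne_of_mem_erase he⟩, ?_⟩
  · have := Finset.mem_of_mem_erase he
    rwa [hY, Set.Finite.mem_toFinset] at this
  · rw [sub_eq_iff_eq_add, Finset.sum_erase_add _ _ hα]
    exact h.symm

theorem IsSigmaPoly.mul {f g : MvPolynomial (Fin (D.k v)) (L K)} (hf : D.IsSigmaPoly K v f)
    (hg : D.IsSigmaPoly K v g) : D.IsSigmaPoly K v (f * g) :=
  ⟨mul_ne_zero hf.1 hg.1, fun i hi => (MvPolynomial.X_dvd_mul_iff.1 hi).elim (hf.2 i) (hg.2 i)⟩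

theorem isSigmaPoly_C {l : L K} (hl : l ≠ 0) :
    D.IsSigmaPoly K v (MvPolynomial.C l : MvPolynomial (Fin (D.k v)) (L K)) := by
  refine ⟨(map_ne_zero_iff _ (MvPolynomial.C_injective _ _)).2 hl, fun i hi => ?_⟩
  have h := map_dvd (MvPolynomial.eval fun _ : Fin (D.k v) => (0 : L K)) hi
  rw [MvPolynomial.eval_X, MvPolynomial.eval_C, zero_dvd_iff] at h
  exact hl h

end Free

/-! ### Path algebras of regular components -/

section PathAlg

theorem vert_mul_sum {s : Finset V} {v : V} (hv : v ∈ s) :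
    D.sg1 K (.vert v) * ∑ w ∈ s, D.sg1 K (.vert w) = D.sg1 K (.vert v) := by
  rw [Finset.mul_sum, Finset.sum_eq_single_of_mem v hv fun w _ h =>
    D.sg1_vert_vert_of_ne K h.symm, sg1_vert_vert]

theorem vert_mul_sum_of_notMem {s : Finset V} {v : V} (hv : v ∉ s) :
    D.sg1 K (.vert v) * ∑ w ∈ s, D.sg1 K (.vert w) = 0 := by
  rw [Finset.mul_sum]
  exact Finset.sum_eq_zero fun w hw => D.sg1_vert_vert_of_ne K fun h => hv (h ▸ hw)

theorem sum_mul_vert {s : Finset V} {v : V} (hv : v ∈ s) :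
    (∑ w ∈ s, D.sg1 K (.vert w)) * D.sg1 K (.vert v) = D.sg1 K (.vert v) := by
  rw [Finset.sum_mul, Finset.sum_eq_single_of_mem v hv fun w _ h =>
    D.sg1_vert_vert_of_ne K h, sg1_vert_vert]

theorem sum_mul_sum (s : Finset V) :
    (∑ w ∈ s, D.sg1 K (.vert w)) * ∑ w ∈ s, D.sg1 K (.vert w) = ∑ w ∈ s, D.sg1 K (.vert w) := by
  rw [Finset.sum_mul]
  exact Finset.sum_congr rfl fun v hv => D.vert_mul_sum K hv

/-- The product in `S_K^1(E, C)` of a list of edges, and of the vertex `w`. -/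
def edgeProd (l : List Ed) (w : V) : D.S1 K :=
  l.foldr (fun e y => D.sg1 K (.edge e) * y) (D.sg1 K (.vert w))

theorem edgeProd_cons (e : Ed) (l : List Ed) (w : V) :
    D.edgeProd K (e :: l) w = D.sg1 K (.edge e) * D.edgeProd K l w := rfl

theorem vert_mul_edgeProd {v w : V} {l : List Ed} (h : G.IsPath v l w) :
    D.sg1 K (.vert v) * D.edgeProd K l w = D.edgeProd K l w := by
  cases h with
  | nil => exact D.sg1_vert_vert K v
  | cons e h => rw [edgeProd_cons, ← mul_assoc, sg1_source]

theorem edgeProd_mul_vert (l : List Ed) (w : V) :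
    D.edgeProd K l w * D.sg1 K (.vert w) = D.edgeProd K l w := by
  induction l with
  | nil => exact D.sg1_vert_vert K w
  | cons e l ih => rw [edgeProd_cons, mul_assoc, ih]

theorem CompleteSub.tgt_mem {p : G.I} (F : G.CompleteSub p) {v w : V} {l : List Ed}
    (h : G.IsPath v l w) (hv : v ∈ F.verts) (hl : ∀ e ∈ l, e ∈ F.edges) : w ∈ F.verts := by
  induction h with
  | nil => exact hv
  | cons e _ ih =>
    exact ih (F.range_mem e (hl e List.mem_cons_self)) fun f hf => hl f (List.mem_cons_of_mem e hf)

theorem isProper_sigmaAll : ∀ M ∈ D.sigmaAll K, M.IsProper := by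
  rintro _ (⟨v, f, -, rfl⟩ | ⟨p, -, F, n, A, hA, -, rfl⟩)
  · exact CornerMat.isProper_single (D.sg1_vert_vert K v.1) (D.vert_mul_αEval v f)
      (D.αEval_mul_vert v f)
  · refine ⟨D.sum_mul_sum K F.verts, fun i j => ⟨?_, ?_⟩⟩
    · change _ * D.pathEval K (A i j) = D.pathEval K (A i j)
      rw [pathEval, Finsupp.sum, Finset.mul_sum]
      refine Finset.sum_congr rfl fun γ hγ => ?_
      rw [← D.vert_mul_coef, mul_assoc, ← mul_assoc, D.sum_mul_vert K (hA i j γ hγ).1]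
    · change D.pathEval K (A i j) * _ = D.pathEval K (A i j)
      rw [pathEval, Finsupp.sum, Finset.sum_mul]
      refine Finset.sum_congr rfl fun γ hγ => ?_
      have h : D.pathElem K γ = D.pathElem K γ * D.sg1 K (.vert γ.tgt) :=
        (D.edgeProd_mul_vert K γ.edges γ.tgt).symm
      rw [h, mul_assoc, mul_assoc, D.vert_mul_sum K
        (CompleteSub.tgt_mem F γ.isPath (hA i j γ hγ).1 (hA i j γ hγ).2)]

theorem coef_mem_pathAlg {p : G.I} {v : V} (hv : G.cls v = p) (l : L K) :
    D.coef K v l ∈ D.pathAlg K p :=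
  NonUnitalAlgebra.subset_adjoin K (Or.inl (Or.inl ⟨v, l, hv, rfl⟩))

theorem vert_mem_pathAlg {p : G.I} {v : V} (hv : G.cls v = p) :
    D.sg1 K (.vert v) ∈ D.pathAlg K p :=
  NonUnitalAlgebra.subset_adjoin K (Or.inl (Or.inr ⟨v, hv, rfl⟩))

theorem edge_mem_pathAlg {p : G.I} {e : Ed} (hs : G.cls (G.s e) = p) (hr : G.cls (G.r e) = p) :
    D.sg1 K (.edge e) ∈ D.pathAlg K p :=
  NonUnitalAlgebra.subset_adjoin K (Or.inr ⟨e, hs, hr, rfl⟩)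

theorem edgeProd_mem_pathAlg {p : G.I} (F : G.CompleteSub p) {l : List Ed} {w : V}
    (hl : ∀ e ∈ l, e ∈ F.edges) (hw : w ∈ F.verts) : D.edgeProd K l w ∈ D.pathAlg K p := by
  induction l with
  | nil => exact D.vert_mem_pathAlg K (F.verts_mem w hw)
  | cons e l ih =>
    have he := hl e List.mem_cons_self
    exact mul_mem (D.edge_mem_pathAlg K (F.verts_mem _ (F.source_mem e he))
      (F.verts_mem _ (F.range_mem e he))) (ih fun f hf => hl f (List.mem_cons_of_mem e hf))

theorem pathEval_mem_pathAlg {p : G.I} (F : G.CompleteSub p) {f : G.DPath →₀ L K}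
    (hf : ∀ γ ∈ f.support, F.IsPathIn γ) : D.pathEval K f ∈ D.pathAlg K p := by
  rw [pathEval, Finsupp.sum]
  refine sum_mem fun γ hγ => mul_mem (D.coef_mem_pathAlg K (F.verts_mem _ (hf γ hγ).1) _) ?_
  exact D.edgeProd_mem_pathAlg K F (hf γ hγ).2
    (CompleteSub.tgt_mem F γ.isPath (hf γ hγ).1 (hf γ hγ).2)

theorem star_mul_edge_of_reg {e f : Ed} (he : G.cls (G.s e) ∉ D.free) (hef : e ≠ f) :
    D.sg1 K (.star e) * D.sg1 K (.edge f) = 0 := by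
  by_cases hs : G.s e = G.s f
  · -- a regular vertex has a single set in its partition
    obtain ⟨Y, hY⟩ := D.reg_one _ he
    obtain ⟨X, ⟨hX, heX⟩, -⟩ := G.existsUnique_part e
    obtain ⟨X', ⟨hX', hfX⟩, -⟩ := G.existsUnique_part f
    rw [← hs] at hX'
    rw [hY, Set.mem_singleton_iff] at hX hX'
    exact D.map_sg_of_rel_zero K (D.toS1 K) (.star_edge_ne (G.s e) Y (hY ▸ rfl) e f
      (hX ▸ heX) (hX' ▸ hfX) hef)
  · rw [← sg1_star_source, ← sg1_source, mul_assoc, ← mul_assoc (D.sg1 K (.vert _)),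
      D.sg1_vert_vert_of_ne K hs, zero_mul, mul_zero]

theorem star_mul_edge_self (e : Ed) :
    D.sg1 K (.star e) * D.sg1 K (.edge e) = D.sg1 K (.vert (G.r e)) :=
  D.map_sg_of_rel K (D.toS1 K) (.star_edge e)

variable {K}

theorem star_mul_coef_of_ne {e : Ed} {v : V} (h : G.s e ≠ v) (l : L K) :
    D.sg1 K (.star e) * D.coef K v l = 0 := by
  rw [← sg1_star_source, ← D.vert_mul_coef, mul_assoc, ← mul_assoc (D.sg1 K (.vert _)),
    D.sg1_vert_vert_of_ne K h, zero_mul, mul_zero]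

variable (K) in
/-- The elements that may occur in `e* y` besides multiples of `e*`: the path algebra, if `e` is an
edge of `E_p`, and `0` if `e` leaves the component `p`. -/
def tailSub (p : G.I) (e : Ed) : Submodule K (D.S1 K) where
  carrier := {z | z ∈ D.pathAlg K p ∧ (G.cls (G.r e) ≠ p → z = 0)}
  add_mem' ha hb := ⟨add_mem ha.1 hb.1, fun h => by rw [ha.2 h, hb.2 h, add_zero]⟩
  zero_mem' := ⟨zero_mem _, fun _ => rfl⟩
  smul_mem' c _ ha := ⟨(D.pathAlg K p).smul_mem' c ha.1, fun h => by rw [ha.2 h, smul_zero]⟩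

theorem star_mul_coef_mul_pathElem {p : G.I} (hp : p ∉ D.free) (F : G.CompleteSub p) {e : Ed}
    (he : G.cls (G.s e) = p) {γ : G.DPath} (hγ : F.IsPathIn γ) (l : L K)
    [Decidable (γ = .triv G (G.s e))] :
    D.sg1 K (.star e) * (D.coef K γ.src l * D.pathElem K γ) -
      D.coef K (G.r e) (if γ = .triv G (G.s e) then l else 0) * D.sg1 K (.star e) ∈
        D.tailSub K p e := by
  have he' : G.cls (G.s e) ∉ D.free := he ▸ hp
  obtain ⟨v, es, w, hpath⟩ := γ
  cases hpath with
  | nil =>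
    change D.sg1 K (.star e) * (D.coef K v l * D.sg1 K (.vert v)) - _ ∈ _
    rw [coef_mul_vert]
    by_cases hv : G.s e = v
    · subst hv
      rw [if_pos (by rfl), D.star_mul_coef_of_reg he', sub_self]
      exact zero_mem _
    · rw [D.star_mul_coef_of_ne hv, if_neg, coef_zero, zero_mul, sub_zero]
      · exact zero_mem _
      · intro h
        exact hv (congrArg DPath.src h).symm
  | @cons f es _ hpath =>
    rw [if_neg (fun h => List.cons_ne_nil _ _ (congrArg DPath.edges h)), coef_zero, zero_mul,
      sub_zero]
    change D.sg1 K (.star e) * (D.coef K (G.s f) l *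
      (D.sg1 K (.edge f) * D.edgeProd K es w)) ∈ _
    have hf : f ∈ F.edges := hγ.2 f List.mem_cons_self
    have hes : ∀ g ∈ es, g ∈ F.edges := fun g hg => hγ.2 g (List.mem_cons_of_mem f hg)
    by_cases hs : G.s e = G.s f
    · rw [← hs, ← mul_assoc, D.star_mul_coef_of_reg he', mul_assoc, ← mul_assoc (D.sg1 K (.star e))]
      by_cases hef : e = f
      · subst hef
        rw [star_mul_edge_self, D.vert_mul_edgeProd K hpath]
        have hr := F.verts_mem _ (F.range_mem e hf)
        exact ⟨mul_mem (D.coef_mem_pathAlg K hr l) (D.edgeProd_mem_pathAlg K F hes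
          (CompleteSub.tgt_mem F hpath (F.range_mem e hf) hes)), fun h => (h hr).elim⟩
      · rw [D.star_mul_edge_of_reg K he' hef, zero_mul, mul_zero]
        exact zero_mem _
    · rw [← mul_assoc, D.star_mul_coef_of_ne hs, zero_mul]
      exact zero_mem _

/-- For a regular component `p` and an edge `e` leaving a vertex of `E_p`, the product of `e*` with
an element of the path algebra is the augmentation at `s(e)` times `e*`, up to an element of the
path algebra. -/
theorem star_mul_pathEval {p : G.I} (hp : p ∉ D.free) (F : G.CompleteSub p) {e : Ed}
    (he : G.cls (G.s e) = p) {f : G.DPath →₀ L K} (hf : ∀ γ ∈ f.support, F.IsPathIn γ) :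
    D.sg1 K (.star e) * D.pathEval K f -
      D.coef K (G.r e) (f (.triv G (G.s e))) * D.sg1 K (.star e) ∈ D.tailSub K p e := by
  classical
  have h1 : f (.triv G (G.s e)) =
      ∑ γ ∈ f.support, if γ = .triv G (G.s e) then f γ else 0 := by
    rw [Finset.sum_ite_eq']
    split
    · rfl
    · rename_i h
      exact Finsupp.notMem_support_iff.1 h
  let c : L K →+ D.S1 K := AddMonoidHom.mk' (D.coef K (G.r e)) (D.coef_add _)
  have h2 : D.coef K (G.r e) (f (.triv G (G.s e))) = ∑ γ ∈ f.support,
      D.coef K (G.r e) (if γ = .triv G (G.s e) then f γ else 0) := by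
    rw [h1]
    exact map_sum c _ _
  rw [h2, pathEval, Finsupp.sum, Finset.mul_sum, Finset.sum_mul, ← Finset.sum_sub_distrib]
  exact sum_mem fun γ hγ => D.star_mul_coef_mul_pathElem hp F he (hf γ hγ) _

end PathAlg

/-! ### Rational series -/

section Rational

/-- The image of `coef v l` in `Q_K(E, C)`. -/
def coefQ (v : V) (l : L K) : D.Q K := D.toQ K (D.coef K v l)

variable {K}

theorem coefQ_add (v : V) (l m : L K) : D.coefQ K v (l + m) = D.coefQ K v l + D.coefQ K v m := by
  rw [coefQ, coef_add, map_add]; rfl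

theorem coefQ_mul (v : V) (l m : L K) : D.coefQ K v (l * m) = D.coefQ K v l * D.coefQ K v m := by
  rw [coefQ, coef_mul, map_mul]; rfl

theorem coefQ_one (v : V) : D.coefQ K v 1 = D.q K (.vert v) := by
  rw [coefQ, coef_one]; rfl

theorem coefQ_zero (v : V) : D.coefQ K v 0 = 0 := by
  rw [coefQ, coef_zero, map_zero]

theorem vert_mul_coefQ (v : V) (l : L K) : D.q K (.vert v) * D.coefQ K v l = D.coefQ K v l := by
  rw [← coefQ_one, ← coefQ_mul, one_mul]

theorem coefQ_mul_vert (v : V) (l : L K) : D.coefQ K v l * D.q K (.vert v) = D.coefQ K v l := by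
  rw [← coefQ_one, ← coefQ_mul, mul_one]

theorem tS_C (v : V) (c : K) : D.tS K v (MvPolynomial.C c) = c • D.sg1 K (.vert v) := by
  rw [tS_eq, (D.isEvalData_tS K v).polyEval_C]

theorem coefQ_smul (v : V) (c : K) (l : L K) : D.coefQ K v
    (algebraMap (MvPolynomial ℕ K) (L K) (MvPolynomial.C c) * l) = c • D.coefQ K v l := by
  rw [coefQ_mul, coefQ, coef_algebraMap, tS_C, map_smul, smul_mul_assoc]
  exact congrArg (c • ·) (D.vert_mul_coefQ v l)

variable (K) in
/-- The map from the path algebra of a component to its algebra of rational series. -/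
def pathToRat (p : G.I) : D.pathAlg K p →ₙₐ[K] D.RatAlg K p := Loc.of K (D.sigmaPath K p)

theorem ratToQ_pathToRat {p : G.I} (hp : p ∉ D.free) (a : D.pathAlg K p) :
    D.ratToQ K hp (D.pathToRat K p a) = D.toQ K a.1 :=
  Loc.map_of K _ _ a

theorem isProper_sigmaPath {p : G.I} (hp : p ∉ D.free) :
    ∀ M ∈ D.sigmaPath K p, M.IsProper := by
  intro M hM
  obtain ⟨h1, h2⟩ := D.isProper_sigmaAll K _ (Or.inr ⟨p, hp, hM⟩)
  exact ⟨Subtype.ext h1, fun i j => ⟨Subtype.ext (h2 i j).1, Subtype.ext (h2 i j).2⟩⟩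

theorem pathAlg_mem {p : G.I} (T : NonUnitalSubalgebra K (D.pathAlg K p))
    (hcoef : ∀ v (hv : G.cls v = p) l, (⟨_, D.coef_mem_pathAlg K hv l⟩ : D.pathAlg K p) ∈ T)
    (hedge : ∀ e (hs : G.cls (G.s e) = p) (hr : G.cls (G.r e) = p),
      (⟨_, D.edge_mem_pathAlg K hs hr⟩ : D.pathAlg K p) ∈ T) (a : D.pathAlg K p) : a ∈ T := by
  have hle : D.pathAlg K p ≤ T.map (NonUnitalSubalgebraClass.subtype (D.pathAlg K p)) := by
    refine NonUnitalAlgebra.adjoin_le ?_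
    rintro _ ((⟨v, l, hv, rfl⟩ | ⟨v, hv, rfl⟩) | ⟨e, hs, hr, rfl⟩)
    · exact ⟨_, hcoef v hv l, rfl⟩
    · exact ⟨_, hcoef v hv 1, D.coef_one v⟩
    · exact ⟨_, hedge e hs hr, rfl⟩
  obtain ⟨t, ht, he⟩ := hle a.2
  rwa [show a = t from Subtype.ext he.symm]

/-- The algebra of rational series is generated by the path algebra and by the entries of the
inverses of the matrices in `Σ(p)`. -/
theorem ratAlg_mem {p : G.I} (hp : p ∉ D.free) (T : NonUnitalSubalgebra K (D.RatAlg K p))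
    (hcoef : ∀ v (hv : G.cls v = p) l, D.pathToRat K p ⟨_, D.coef_mem_pathAlg K hv l⟩ ∈ T)
    (hedge : ∀ e (hs : G.cls (G.s e) = p) (hr : G.cls (G.r e) = p),
      D.pathToRat K p ⟨_, D.edge_mem_pathAlg K hs hr⟩ ∈ T)
    (hinv : ∀ (F : G.CompleteSub p) (n : ℕ) (A : Matrix (Fin n) (Fin n) (G.DPath →₀ L K))
      (u : D.pathAlg K p) (B : Matrix (Fin n) (Fin n) (D.pathAlg K p))
      (N : Matrix (Fin n) (Fin n) (D.RatAlg K p)),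
      (∀ i j, ∀ γ ∈ (A i j).support, F.IsPathIn γ) →
      (∀ v ∈ F.verts, IsUnit (Matrix.of fun i j => A i j (DPath.triv G v))) →
      u.1 = ∑ v ∈ F.verts, D.sg1 K (.vert v) → (∀ i j, (B i j).1 = D.pathEval K (A i j)) →
      IsCornerInvMat (D.pathToRat K p u) (B.map (D.pathToRat K p)) N → ∀ i j, N i j ∈ T)
    (y : D.RatAlg K p) : y ∈ T := by
  refine Loc.mem_of_generators K (D.isProper_sigmaPath hp) T (fun a => ?_) ?_ y
  · exact D.pathAlg_mem (T.comap (D.pathToRat K p)) hcoef hedge a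
  · rintro ⟨m, u, B⟩ hM N hN i j
    obtain ⟨F, n, A, hA, hU, h⟩ := hM
    simp only [CornerMat.map, CornerMat.mk.injEq] at h
    obtain ⟨rfl, hu, hB⟩ := h
    exact hinv F m A u B N hA hU hu
      (fun i j => congrFun (congrFun (eq_of_heq hB) i) j) hN i j

variable (K) in
/-- The rational series over `E_p` as elements of `Q_K(E, C)`, if the edge `e` lies in `E_p`, and
`0` if `e` leaves the component `p`. -/
def ratTailSub {p : G.I} (hp : p ∉ D.free) (e : Ed) : Submodule K (D.Q K) where
  carrier := {z | (∃ y, D.ratToQ K hp y = z) ∧ (G.cls (G.r e) ≠ p → z = 0)}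
  add_mem' := by
    rintro _ _ ⟨⟨y, rfl⟩, h1⟩ ⟨⟨z, rfl⟩, h2⟩
    exact ⟨⟨y + z, map_add _ _ _⟩, fun h => by rw [h1 h, h2 h, add_zero]⟩
  zero_mem' := ⟨⟨0, map_zero _⟩, fun _ => rfl⟩
  smul_mem' := by
    rintro c _ ⟨⟨y, rfl⟩, h1⟩
    exact ⟨⟨c • y, map_smul _ _ _⟩, fun h => by rw [h1 h, smul_zero]⟩

section Tail

variable {p : G.I} (hp : p ∉ D.free) (e : Ed)

include hp in
theorem toQ_mem_ratTailSub {z : D.S1 K} (hz : z ∈ D.tailSub K p e) :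
    D.toQ K z ∈ D.ratTailSub K hp e :=
  ⟨⟨_, D.ratToQ_pathToRat hp ⟨z, hz.1⟩⟩, fun h => by rw [hz.2 h, map_zero]⟩

theorem coefQ_mul_mem_ratTailSub (l : L K) {z : D.Q K} (hz : z ∈ D.ratTailSub K hp e) :
    D.coefQ K (G.r e) l * z ∈ D.ratTailSub K hp e := by
  obtain ⟨⟨y, rfl⟩, h⟩ := hz
  by_cases hr : G.cls (G.r e) = p
  · refine ⟨⟨D.pathToRat K p ⟨_, D.coef_mem_pathAlg K hr l⟩ * y, ?_⟩, fun h => (h hr).elim⟩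
    rw [map_mul, ratToQ_pathToRat]
    rfl
  · rw [h hr, mul_zero]
    exact zero_mem _

theorem mul_ratToQ_mem_ratTailSub {z : D.Q K} (hz : z ∈ D.ratTailSub K hp e) (y : D.RatAlg K p) :
    z * D.ratToQ K hp y ∈ D.ratTailSub K hp e := by
  obtain ⟨⟨x, rfl⟩, h⟩ := hz
  exact ⟨⟨x * y, map_mul _ _ _⟩, fun hr => by rw [h hr, zero_mul]⟩

theorem mul_mul_add_sub_eq {R : Type*} [NonUnitalRing R] (s x y c c' : R) :
    s * (x * y) - c * c' * s = (s * x - c * s) * y + c * (s * y - c' * s) := by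
  simp only [sub_mul, mul_sub, mul_assoc]
  abel

/-- For a regular component `p` and an edge `e` leaving a vertex of `E_p`, the product of `e*` with
a rational series is a multiple of `e*`, up to a rational series. For the entries of an inverse
matrix `N` of `A` this is seen by multiplying `A N = 1` by `e*` and by the inverse of the
augmentation of `A`. -/
theorem star_mul_ratToQ (he : G.cls (G.s e) = p) (y : D.RatAlg K p) : ∃ l : L K,
    D.q K (.star e) * D.ratToQ K hp y - D.coefQ K (G.r e) l * D.q K (.star e) ∈
      D.ratTailSub K hp e := by
  have he' : G.cls (G.s e) ∉ D.free := he ▸ hp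
  let T : NonUnitalSubalgebra K (D.RatAlg K p) :=
    { carrier := {y | ∃ l : L K, D.q K (.star e) * D.ratToQ K hp y -
        D.coefQ K (G.r e) l * D.q K (.star e) ∈ D.ratTailSub K hp e}
      add_mem' := by
        rintro y z ⟨l, hl⟩ ⟨m, hm⟩
        refine ⟨l + m, ?_⟩
        rw [map_add, mul_add, coefQ_add, add_mul, add_sub_add_comm]
        exact add_mem hl hm
      zero_mem' := ⟨0, by rw [map_zero, mul_zero, coefQ_zero, zero_mul, sub_zero]; exact zero_mem _⟩
      mul_mem' := by
        rintro y z ⟨l, hl⟩ ⟨m, hm⟩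
        refine ⟨l * m, ?_⟩
        rw [map_mul, coefQ_mul, mul_mul_add_sub_eq]
        exact add_mem (D.mul_ratToQ_mem_ratTailSub hp e hl z)
          (D.coefQ_mul_mem_ratTailSub hp e l hm)
      smul_mem' := by
        rintro c y ⟨l, hl⟩
        refine ⟨algebraMap (MvPolynomial ℕ K) (L K) (MvPolynomial.C c) * l, ?_⟩
        rw [map_smul, mul_smul_comm, coefQ_smul, smul_mul_assoc, ← smul_sub]
        exact Submodule.smul_mem _ c hl }
  refine D.ratAlg_mem hp T ?_ ?_ ?_ y
  · intro v hv l
    by_cases hs : G.s e = v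
    · subst hs
      refine ⟨l, ?_⟩
      rw [ratToQ_pathToRat]
      change D.toQ K _ * D.toQ K _ - D.toQ K _ * D.toQ K _ ∈ _
      rw [← map_mul, ← map_mul, D.star_mul_coef_of_reg he', sub_self]
      exact zero_mem _
    · refine ⟨0, ?_⟩
      rw [ratToQ_pathToRat, coefQ_zero, zero_mul, sub_zero]
      change D.toQ K _ * D.toQ K _ ∈ _
      rw [← map_mul, D.star_mul_coef_of_ne hs, map_zero]
      exact zero_mem _
  · intro f hs hr
    refine ⟨0, ?_⟩
    rw [ratToQ_pathToRat, coefQ_zero, zero_mul, sub_zero]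
    change D.toQ K _ * D.toQ K _ ∈ _
    rw [← map_mul]
    by_cases hef : e = f
    · subst hef
      rw [star_mul_edge_self]
      exact D.toQ_mem_ratTailSub hp e ⟨D.vert_mem_pathAlg K hr, fun h => (h hr).elim⟩
    · rw [D.star_mul_edge_of_reg K he' hef, map_zero]
      exact zero_mem _
  · intro F n A u B N hA hU hu hB hN i j
    by_cases hF : G.s e ∈ F.verts
    -- `C` is the inverse of the component at `s(e)` of the augmentation of `A`
    · obtain ⟨C, -, hC⟩ := isUnit_iff_exists.1 (hU _ hF)
      have hC' : ∀ i m, ∑ k, C i k * A k m (.triv G (G.s e)) = if i = m then 1 else 0 := by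
        intro i m
        have := congrFun (congrFun hC i) m
        rwa [Matrix.mul_apply, Matrix.one_apply] at this
      refine ⟨C i j, ?_⟩
      let c : L K →+ D.Q K := AddMonoidHom.mk' (D.coefQ K (G.r e)) (D.coefQ_add _)
      -- the tails of the entries of `A`
      let Z : Fin n → Fin n → D.Q K := fun k m => D.q K (.star e) * D.toQ K (D.pathEval K (A k m)) -
        D.coefQ K (G.r e) (A k m (.triv G (G.s e))) * D.q K (.star e)
      have hZ : ∀ k m, Z k m ∈ D.ratTailSub K hp e := fun k m => by
        have h := D.toQ_mem_ratTailSub hp e (D.star_mul_pathEval hp F he (hA k m))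
        rwa [map_sub, map_mul, map_mul] at h
      have hu' : D.q K (.star e) * D.toQ K u.1 = D.q K (.star e) := by
        change D.toQ K _ * D.toQ K _ = D.toQ K _
        rw [← map_mul, hu, ← sg1_star_source, mul_assoc, D.vert_mul_sum K hF]
      -- the row `k` of `e* A N = e*`
      have hrow : ∀ k, ∑ m, (D.q K (.star e) * D.toQ K (D.pathEval K (A k m))) *
          D.ratToQ K hp (N m j) = if k = j then D.q K (.star e) else 0 := by
        intro k
        have h := congrArg (fun x => D.q K (.star e) * D.ratToQ K hp x) (hN.2.1 k j)
        simp only [map_sum, Matrix.map_apply, map_mul, ratToQ_pathToRat, hB, Finset.mul_sum,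
          ← mul_assoc] at h
        rw [h]
        split
        · rw [ratToQ_pathToRat, hu']
        · rw [map_zero, mul_zero]
      have hsum : D.q K (.star e) * D.ratToQ K hp (N i j) -
          D.coefQ K (G.r e) (C i j) * D.q K (.star e) =
          - ∑ k, ∑ m, D.coefQ K (G.r e) (C i k) * (Z k m * D.ratToQ K hp (N m j)) := by
        have h1 : ∑ k, D.coefQ K (G.r e) (C i k) *
            ∑ m, (D.q K (.star e) * D.toQ K (D.pathEval K (A k m))) * D.ratToQ K hp (N m j) =
            D.coefQ K (G.r e) (C i j) * D.q K (.star e) := by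
          simp only [hrow, mul_ite, mul_zero, Finset.sum_ite_eq', Finset.mem_univ, if_true]
        have h2 : ∑ k, ∑ m, D.coefQ K (G.r e) (C i k) *
            ((D.coefQ K (G.r e) (A k m (.triv G (G.s e))) * D.q K (.star e)) *
              D.ratToQ K hp (N m j)) = D.q K (.star e) * D.ratToQ K hp (N i j) := by
          rw [Finset.sum_comm]
          have h3 : ∀ m, ∑ k, D.coefQ K (G.r e) (C i k) *
              ((D.coefQ K (G.r e) (A k m (.triv G (G.s e))) * D.q K (.star e)) *
              D.ratToQ K hp (N m j)) =
              c (if i = m then 1 else 0) * (D.q K (.star e) * D.ratToQ K hp (N m j)) := by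
            intro m
            rw [← hC', map_sum, Finset.sum_mul]
            refine Finset.sum_congr rfl fun k _ => ?_
            change _ = D.coefQ K _ _ * _
            rw [coefQ_mul]
            simp only [mul_assoc]
          have hr : D.q K (.vert (G.r e)) * D.q K (.star e) = D.q K (.star e) := by
            change D.toQ K _ * D.toQ K _ = D.toQ K _
            rw [← map_mul, sg1_star_range]
          have h4 : c 1 = D.q K (.vert (G.r e)) := D.coefQ_one _
          simp only [h3, apply_ite c, map_zero, ite_mul, zero_mul, Finset.sum_ite_eq,
            Finset.mem_univ, if_true, h4]
          rw [← mul_assoc, hr]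
        rw [← h1, ← h2, ← neg_sub, ← Finset.sum_sub_distrib, neg_inj]
        refine Finset.sum_congr rfl fun k _ => ?_
        rw [Finset.mul_sum, ← Finset.sum_sub_distrib]
        refine Finset.sum_congr rfl fun m _ => ?_
        rw [← mul_sub, ← sub_mul]
      have hmem : ∀ k m, D.coefQ K (G.r e) (C i k) * (Z k m * D.ratToQ K hp (N m j)) ∈
          D.ratTailSub K hp e := fun k m =>
        D.coefQ_mul_mem_ratTailSub hp e _ (D.mul_ratToQ_mem_ratTailSub hp e (hZ k m) _)
      rw [hsum]
      exact neg_mem (sum_mem fun k _ => sum_mem fun m _ => hmem k m)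
    -- the unit of the corner that contains `A` is annihilated by `e*`
    · refine ⟨0, ?_⟩
      have hu' : D.q K (.star e) * D.toQ K u.1 = 0 := by
        change D.toQ K _ * D.toQ K _ = 0
        rw [← map_mul, hu, ← sg1_star_source, mul_assoc, D.vert_mul_sum_of_notMem K hF, mul_zero,
          map_zero]
      rw [← (hN.1 i j).1, map_mul, ratToQ_pathToRat, ← mul_assoc, hu', zero_mul, coefQ_zero,
        zero_mul, sub_zero]
      exact zero_mem _

end Tail

/-- Every rational series is a sum of series that start at a vertex. -/
theorem mem_span_vert_mul {p : G.I} (hp : p ∉ D.free) (y : D.RatAlg K p) :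
    y ∈ Submodule.span K {x : D.RatAlg K p | ∃ v, ∃ hv : G.cls v = p, D.ratVert K v hv * x = x} := by
  set S := {x : D.RatAlg K p | ∃ v, ∃ hv : G.cls v = p, D.ratVert K v hv * x = x} with hS
  have hmul : ∀ x ∈ Submodule.span K S, ∀ z, x * z ∈ Submodule.span K S := by
    intro x hx z
    induction hx using Submodule.span_induction with
    | mem x hx =>
      obtain ⟨v, hv, h⟩ := hx
      exact Submodule.subset_span ⟨v, hv, by rw [← mul_assoc, h]⟩
    | zero => rw [zero_mul]; exact zero_mem _
    | add x y _ _ hx hy => rw [add_mul]; exact add_mem hx hy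
    | smul c x _ hx => rw [smul_mul_assoc]; exact Submodule.smul_mem _ c hx
  let T : NonUnitalSubalgebra K (D.RatAlg K p) :=
    { Submodule.span K S with mul_mem' := fun {x z} hx _ => hmul x hx z }
  refine D.ratAlg_mem hp T ?_ ?_ ?_ y
  · intro v hv l
    refine Submodule.subset_span ⟨v, hv, ?_⟩
    change D.pathToRat K p _ * D.pathToRat K p _ = _
    rw [← map_mul]
    exact congrArg _ (Subtype.ext (D.vert_mul_coef v l))
  · intro e hs hr
    refine Submodule.subset_span ⟨_, hs, ?_⟩
    change D.pathToRat K p _ * D.pathToRat K p _ = _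
    rw [← map_mul]
    exact congrArg _ (Subtype.ext (D.sg1_source K e))
  · intro F n A u B N hA hU hu hB hN i j
    have hu' : u = ∑ v : F.verts, ⟨_, D.vert_mem_pathAlg K (F.verts_mem v.1 v.2)⟩ := by
      apply Subtype.ext
      rw [hu, ← Finset.sum_coe_sort]
      exact (map_sum (NonUnitalSubalgebraClass.subtype (D.pathAlg K p)) (fun v : F.verts =>
        ⟨_, D.vert_mem_pathAlg K (F.verts_mem v.1 v.2)⟩) Finset.univ).symm
    rw [← (hN.1 i j).1, hu', map_sum, Finset.sum_mul]
    refine sum_mem fun v _ => Submodule.subset_span ⟨v, F.verts_mem v.1 v.2, ?_⟩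
    change D.pathToRat K p _ * (D.pathToRat K p _ * _) = _
    rw [← mul_assoc, ← map_mul]
    exact congrArg (D.pathToRat K p · * N i j) (Subtype.ext (D.sg1_vert_vert K v))

end Rational

/-! ### Relations and generators of `Q_K(E, C)` -/

section QRel

/-- The canonical map from `S_K(E, C)` to `Q_K(E, C)`. -/
def sToQ : D.SAlg K →ₙₐ[K] D.Q K := (D.toQ K).comp (D.toS1 K)

theorem q_vert_vert (v : V) : D.q K (.vert v) * D.q K (.vert v) = D.q K (.vert v) :=
  D.map_sg_of_rel K (D.sToQ K) (.vert_self v)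

theorem q_vert_vert_of_ne {v w : V} (h : v ≠ w) : D.q K (.vert v) * D.q K (.vert w) = 0 :=
  D.map_sg_of_rel_zero K (D.sToQ K) (.vert_ne v w h)

theorem q_source (e : Ed) : D.q K (.vert (G.s e)) * D.q K (.edge e) = D.q K (.edge e) :=
  D.map_sg_of_rel K (D.sToQ K) (.source e)

theorem q_range (e : Ed) : D.q K (.edge e) * D.q K (.vert (G.r e)) = D.q K (.edge e) :=
  D.map_sg_of_rel K (D.sToQ K) (.range e)

theorem q_star_source (e : Ed) : D.q K (.star e) * D.q K (.vert (G.s e)) = D.q K (.star e) :=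
  D.map_sg_of_rel K (D.sToQ K) (.star_source e)

theorem q_star_range (e : Ed) : D.q K (.vert (G.r e)) * D.q K (.star e) = D.q K (.star e) :=
  D.map_sg_of_rel K (D.sToQ K) (.star_range e)

theorem q_star_edge (e : Ed) : D.q K (.star e) * D.q K (.edge e) = D.q K (.vert (G.r e)) :=
  D.map_sg_of_rel K (D.sToQ K) (.star_edge e)

/-- Products that meet at different vertices vanish. -/
theorem mul_eq_zero_of_vert_ne {x y : D.Q K} {v w : V} (h : v ≠ w) (hx : x * D.q K (.vert v) = x)
    (hy : D.q K (.vert w) * y = y) : x * y = 0 := by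
  rw [← hx, ← hy, mul_assoc, ← mul_assoc (D.q K (.vert v)), D.q_vert_vert_of_ne K h, zero_mul,
    mul_zero]

theorem isCornerInv_fracInv (v : D.FreeV) {f : MvPolynomial (Fin (D.k v)) (L K)}
    (hf : D.IsSigmaPoly K v f) :
    IsCornerInv (D.q K (.vert v.1)) (D.toQ K (D.αEval K v f)) (D.fracInv K v f) := by
  have hM : CornerMat.single (D.sg1 K (.vert v.1)) (D.αEval K v f) ∈ D.sigmaAll K :=
    Or.inl ⟨v, f, hf, rfl⟩
  exact Loc.isCornerInv K hM (D.isProper_sigmaAll K _ hM)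

variable {K}

theorem fracInv_mul (v : D.FreeV) {f g : MvPolynomial (Fin (D.k v)) (L K)}
    (hf : D.IsSigmaPoly K v f) (hg : D.IsSigmaPoly K v g) :
    D.fracInv K v f * D.fracInv K v g = D.fracInv K v (g * f) := by
  have h := (D.isCornerInv_fracInv K v hg).mul (D.isCornerInv_fracInv K v hf)
  rw [← map_mul, ← αEval_mul] at h
  exact h.unique (D.isCornerInv_fracInv K v (IsSigmaPoly.mul D hg hf))

theorem fracInv_C (v : D.FreeV) {l : L K} (hl : l ≠ 0) :
    D.fracInv K v (MvPolynomial.C l) = D.coefQ K v.1 l⁻¹ := by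
  have h := (D.isCornerInv_coef v.1 hl).map (D.toQ K)
  rw [← αEval_C] at h
  exact h.cornerInv_eq

theorem fracInv_one (v : D.FreeV) : D.fracInv K v 1 = D.q K (.vert v.1) := by
  rw [← map_one MvPolynomial.C, D.fracInv_C v one_ne_zero, inv_one, coefQ_one]

theorem isSigmaPoly_one (v : D.FreeV) :
    D.IsSigmaPoly K v (1 : MvPolynomial (Fin (D.k v)) (L K)) := by
  rw [← map_one MvPolynomial.C]
  exact D.isSigmaPoly_C one_ne_zero

theorem ratToQ_ratVert {p : G.I} (hp : p ∉ D.free) {v : V} (hv : G.cls v = p) :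
    D.ratToQ K hp (D.ratVert K v hv) = D.q K (.vert v) :=
  D.ratToQ_pathToRat hp ⟨_, D.vert_mem_pathAlg K hv⟩

/-- The algebra `Q_K(E, C)` is generated by the generators of `S_K(E, C)`, the copies of `L`, the
inverses of the polynomials in the loops at free vertices, and the rational series. -/
theorem q_mem (T : NonUnitalSubalgebra K (D.Q K)) (hq : ∀ x, D.q K x ∈ T)
    (hcoef : ∀ v l, D.coefQ K v l ∈ T)
    (hfrac : ∀ v f, D.IsSigmaPoly K v f → D.fracInv K v f ∈ T)
    (hrat : ∀ (p : G.I) (hp : p ∉ D.free) (y : D.RatAlg K p) (s : Finset V),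
      D.ratToQ K hp y * ∑ v ∈ s, D.q K (.vert v) = D.ratToQ K hp y → D.ratToQ K hp y ∈ T)
    (x : D.Q K) : x ∈ T := by
  refine Loc.mem_of_generators K (D.isProper_sigmaAll K) T (fun a => ?_) ?_ x
  · refine Loc.mem_of_generators K (D.isProper_sigmaOne K) (T.comap (D.toQ K)) (fun b => ?_) ?_ a
    · exact D.sg_mem K (T.comap (D.sToQ K)) hq b
    · rintro _ ⟨v, f, hf, rfl⟩ N hN i j
      have hf' : algebraMap (MvPolynomial ℕ K) (L K) f ≠ 0 :=
        (map_ne_zero_iff _ (IsFractionRing.injective _ _)).2 hf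
      have h1 := D.isCornerInv_coef v hf'
      rw [coef_algebraMap] at h1
      have h2 := (IsCornerInvMat.isCornerInv hN).unique h1
      obtain rfl : i = (0 : Fin 1) := Subsingleton.elim (α := Fin 1) i 0
      obtain rfl : j = (0 : Fin 1) := Subsingleton.elim (α := Fin 1) j 0
      have h3 := hcoef v (algebraMap (MvPolynomial ℕ K) (L K) f)⁻¹
      rw [coefQ, ← h2] at h3
      exact h3
  · rintro _ (⟨v, f, hf, rfl⟩ | ⟨p, hp, hM⟩) N hN i j
    · have h2 := (IsCornerInvMat.isCornerInv hN).unique (D.isCornerInv_fracInv K v hf)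
      obtain rfl : i = (0 : Fin 1) := Subsingleton.elim (α := Fin 1) i 0
      obtain rfl : j = (0 : Fin 1) := Subsingleton.elim (α := Fin 1) j 0
      have h3 := hfrac v f hf
      rw [← h2] at h3
      exact h3
    · obtain ⟨F, n, A, hA, hU, rfl⟩ := hM
      let M : CornerMat (D.pathAlg K p) := ⟨n, ⟨∑ v ∈ F.verts, D.sg1 K (.vert v),
        sum_mem fun v hv => D.vert_mem_pathAlg K (F.verts_mem v hv)⟩,
        fun i j => ⟨_, D.pathEval_mem_pathAlg K F (hA i j)⟩⟩
      have hM : M ∈ D.sigmaPath K p := ⟨F, n, A, hA, hU, rfl⟩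
      obtain ⟨N', -, hN', -⟩ := Loc.exists_inverse K hM (D.isProper_sigmaPath hp M hM)
      have h1 := hN'.map (D.ratToQ K hp)
      have h2 : N'.map (D.ratToQ K hp) = N := by
        have he : D.ratToQ K hp (D.pathToRat K p M.e) =
            Loc.of K (D.sigmaAll K) (∑ v ∈ F.verts, D.sg1 K (.vert v)) :=
          D.ratToQ_pathToRat hp M.e
        have hB : (M.A.map (D.pathToRat K p)).map (D.ratToQ K hp) =
            (Matrix.of fun i j => D.pathEval K (A i j)).map (Loc.of K (D.sigmaAll K)) := by
          ext i j
          exact D.ratToQ_pathToRat hp (M.A i j)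
        have h1' : IsCornerInvMat (D.ratToQ K hp (D.pathToRat K p M.e))
          ((M.A.map (D.pathToRat K p)).map (D.ratToQ K hp)) (N'.map (D.ratToQ K hp)) := h1
        rw [he, hB] at h1'
        exact h1'.unique hN
      have h3 := (hN.1 i j).2
      rw [← h2] at h3 ⊢
      refine hrat p hp (N' i j) F.verts ?_
      refine Eq.trans ?_ h3
      exact congrArg (D.ratToQ K hp (N' i j) * ·) (map_sum (D.toQ K) _ _).symm

theorem ratToQ_mul_vert_of_ne {p : G.I} (hp : p ∉ D.free) {w : V} (hw : G.cls w ≠ p)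
    (y : D.RatAlg K p) : D.ratToQ K hp y * D.q K (.vert w) = 0 := by
  let T : NonUnitalSubalgebra K (D.RatAlg K p) :=
    { carrier := {y | D.ratToQ K hp y * D.q K (.vert w) = 0}
      add_mem' := fun {a b} (ha : _ = _) (hb : _ = _) => by
        change _ = _
        rw [map_add, add_mul, ha, hb, add_zero]
      zero_mem' := by
        change _ = _
        rw [map_zero, zero_mul]
      mul_mem' := fun {a b} _ (hb : _ = _) => by
        change _ = _
        rw [map_mul, mul_assoc, hb, mul_zero]
      smul_mem' := fun c a (ha : _ = _) => by
        change _ = _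
        rw [map_smul, smul_mul_assoc, ha, smul_zero] }
  refine D.ratAlg_mem hp T (fun v hv l => ?_) (fun e hs hr => ?_) ?_ y
  · change _ = _
    rw [ratToQ_pathToRat]
    exact D.mul_eq_zero_of_vert_ne K (fun h : v = w => hw (h ▸ hv)) (D.coefQ_mul_vert v l)
      (D.q_vert_vert K w)
  · change _ = _
    rw [ratToQ_pathToRat]
    exact D.mul_eq_zero_of_vert_ne K (fun h : G.r e = w => hw (h ▸ hr)) (D.q_range K e) (D.q_vert_vert K w)
  · intro F n A u B N hA hU hu hB hN i j
    have h0 : D.toQ K u.1 * D.q K (.vert w) = 0 := by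
      rw [hu, map_sum, Finset.sum_mul]
      exact Finset.sum_eq_zero fun v hv =>
        D.q_vert_vert_of_ne K fun h => hw (h ▸ F.verts_mem v hv)
    change _ = _
    rw [← (hN.1 i j).2, map_mul, mul_assoc, ratToQ_pathToRat, h0, mul_zero]

end QRel

/-! ### The span of the products `γ m ν*` and its left multipliers -/

section Span

/-- The linear span of the products `γ m ν*`, where `γ` is a fractional c-path, `m` a fractional
monomial and `ν` a c-path. -/
def spanW : Submodule K (D.Q K) :=
  Submodule.span K
      {x : D.Q K | ∃ (v w v' w' : V) (γ m : D.Q K) (p : G.I) (ν : List Ed),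
        D.IsFracCPath K v w γ ∧ D.IsFracMonomial K p m ∧ D.IsCPath v' ν w' ∧
        x = γ * m * D.adjElem K v' ν}

/-- The elements that map `spanW` into itself by multiplication from the left. -/
def multW : NonUnitalSubalgebra K (D.Q K) where
  carrier := {x | ∀ y ∈ D.spanW K, x * y ∈ D.spanW K}
  add_mem' ha hb y hy := by rw [add_mul]; exact add_mem (ha y hy) (hb y hy)
  zero_mem' y _ := by rw [zero_mul]; exact zero_mem _
  mul_mem' ha hb y hy := by rw [mul_assoc]; exact ha _ (hb y hy)
  smul_mem' c _ ha y hy := by rw [smul_mul_assoc]; exact Submodule.smul_mem _ c (ha y hy)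

variable {K}

theorem powMul_mem_spanW {x y : D.Q K} (hx : x ∈ D.multW K) (hy : y ∈ D.spanW K) (m : ℕ) :
    powMul x m y ∈ D.spanW K := by
  induction m with
  | zero => exact hy
  | succ m ih => rw [powMul_succ]; exact hx _ ih

theorem FracStep.vert_mul {v w : V} {x : D.Q K} (h : D.FracStep K v w x) :
    D.q K (.vert v) * x = x := by
  cases h with
  | free v f hf i m β hβ => rw [← mul_assoc, (D.isCornerInv_fracInv K v hf).1]
  | reg p hp v hv β hs hr f hf =>
    rw [← mul_assoc, ← D.ratToQ_ratVert hp hv, ← map_mul, hf.2.1]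

theorem FracStep.mul_vert {v w : V} {x : D.Q K} (h : D.FracStep K v w x) :
    x * D.q K (.vert w) = x := by
  cases h with
  | free v f hf i m β hβ => rw [mul_assoc, ← powMul_mul, q_range]
  | reg p hp v hv β hs hr f hf => rw [mul_assoc, q_range]

theorem IsFracCPath.vert_mul {v w : V} {x : D.Q K} (h : D.IsFracCPath K v w x) :
    D.q K (.vert v) * x = x := by
  cases h with
  | triv => exact D.q_vert_vert K v
  | cons h _ => rw [← mul_assoc, h.vert_mul]

theorem isPath_replicate_α (v : D.FreeV) (i : Fin (D.k v)) (m : ℕ) :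
    G.IsPath v.1 (List.replicate m (D.α v i)) v.1 := by
  induction m with
  | zero => exact .nil _
  | succ m ih =>
    have h := IsPath.cons (G := G) (D.α v i) (l := List.replicate m (D.α v i)) (w := v.1)
      (by rw [D.α_loop]; exact ih)
    rwa [s_α] at h

variable {D} in
theorem IsCStep.isPath {v w : V} {l : List Ed} (h : D.IsCStep v l w) : G.IsPath v l w := by
  cases h with
  | free v i m β hβ =>
    refine (D.isPath_replicate_α v i m).append ?_
    rw [← hβ.s_eq]
    exact .cons β (.nil _)
  | reg v hp l β hs hr hl => exact hl.append (.cons β (.nil _))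

variable {D} in
theorem IsCPath.isPath {v w : V} {l : List Ed} (h : D.IsCPath v l w) : G.IsPath v l w := by
  induction h with
  | triv v => exact .nil v
  | cons h _ ih => exact h.isPath.append ih

variable {D} in
theorem IsCPath.append {u v w : V} {l m : List Ed} (h : D.IsCPath u l v) (h' : D.IsCPath v m w) :
    D.IsCPath u (l ++ m) w := by
  induction h with
  | triv v => exact h'
  | cons h _ ih => rw [List.append_assoc]; exact .cons h (ih h')

variable {D} in
theorem IsCStep.isCPath {v w : V} {l : List Ed} (h : D.IsCStep v l w) : D.IsCPath v l w := by
  rw [← List.append_nil l]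
  exact .cons h (.triv w)

theorem foldl_star_mul (l : List Ed) (x y : D.Q K) :
    l.foldl (fun y e => D.q K (.star e) * y) (x * y) =
      l.foldl (fun y e => D.q K (.star e) * y) x * y := by
  induction l generalizing x with
  | nil => rfl
  | cons e l ih => rw [List.foldl_cons, List.foldl_cons, ← mul_assoc, ih]

theorem adjElem_concat (v : V) (l : List Ed) (e : Ed) :
    D.adjElem K v (l ++ [e]) = D.q K (.star e) * D.adjElem K v l := by
  rw [adjElem, List.foldl_append]
  rfl

theorem adjElem_mul_vert (v : V) (l : List Ed) :
    D.adjElem K v l * D.q K (.vert v) = D.adjElem K v l := by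
  rw [adjElem, ← foldl_star_mul, q_vert_vert]

theorem vert_mul_adjElem {v w : V} {l : List Ed} (h : G.IsPath v l w) :
    D.q K (.vert w) * D.adjElem K v l = D.adjElem K v l := by
  have key : ∀ x : D.Q K, D.q K (.vert v) * x = x →
      D.q K (.vert w) * l.foldl (fun y e => D.q K (.star e) * y) x =
        l.foldl (fun y e => D.q K (.star e) * y) x := by
    induction h with
    | nil v => exact fun x hx => hx
    | cons e _ ih => exact fun x _ => ih _ (by rw [← mul_assoc, q_star_range])
  exact key _ (D.q_vert_vert K v)

theorem adjElem_mul_adjElem {v w : V} {l : List Ed} (h : G.IsPath v l w) (m : List Ed) :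
    D.adjElem K w m * D.adjElem K v l = D.adjElem K v (l ++ m) := by
  rw [adjElem, ← foldl_star_mul, D.vert_mul_adjElem h, adjElem, adjElem, List.foldl_append]

theorem IsFracMonomial.exists_vert {p : G.I} {m : D.Q K} (h : D.IsFracMonomial K p m) :
    ∃ v w, D.q K (.vert v) * m = m ∧ m * D.q K (.vert w) = m := by
  cases h with
  | free v f hf a b =>
    refine ⟨v.1, v.1, by rw [← mul_assoc, (D.isCornerInv_fracInv K v hf).1], ?_⟩
    rw [mul_assoc]
    congr 1
    induction List.finRange (D.k v) with
    | nil => exact D.q_vert_vert K v.1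
    | cons i l ih => rw [List.foldr_cons, ← powMul_mul, ← powMul_mul, ih]
  | reg p hp v v' u hv hv' hu f hf ν hν =>
    refine ⟨v, u, ?_, by rw [mul_assoc, adjElem_mul_vert]⟩
    rw [← mul_assoc, ← D.ratToQ_ratVert hp hv, ← map_mul, hf.2.1]

theorem monomial_mem_spanW {p : G.I} {m : D.Q K} (h : D.IsFracMonomial K p m) :
    m ∈ D.spanW K := by
  obtain ⟨v, w, hv, hw⟩ := IsFracMonomial.exists_vert D h
  refine Submodule.subset_span ⟨v, v, w, w, _, m, p, [], .triv v, h, .triv w, ?_⟩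
  change m = D.q K (.vert v) * m * D.q K (.vert w)
  rw [hv, hw]

/-- Multiplication by a step from the left leaves `spanW` invariant. -/
theorem step_mem_multW {v u : V} {x : D.Q K} (h : D.FracStep K v u x) : x ∈ D.multW K := by
  intro y hy
  induction hy using Submodule.span_induction with
  | mem y hy =>
    obtain ⟨v₁, w, v', w', γ, m, p, ν, hγ, hm, hν, rfl⟩ := hy
    by_cases hu : u = v₁
    · subst hu
      exact Submodule.subset_span ⟨v, w, v', w', x * γ, m, p, ν, .cons h hγ, hm, hν,
        by simp only [mul_assoc]⟩
    · rw [← mul_assoc, ← mul_assoc,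
        D.mul_eq_zero_of_vert_ne K hu (h.mul_vert D) (hγ.vert_mul D), zero_mul, zero_mul]
      exact zero_mem _
  | zero => rw [mul_zero]; exact zero_mem _
  | add y z _ _ hy hz => rw [mul_add]; exact add_mem hy hz
  | smul c y _ hy => rw [mul_smul_comm]; exact Submodule.smul_mem _ c hy

/-- Multiplication by the adjoint of a c-path from the right leaves `spanW` invariant. -/
theorem mul_adjElem_mem_spanW {v w : V} {ν : List Ed} (h : D.IsCPath v ν w) {y : D.Q K}
    (hy : y ∈ D.spanW K) : y * D.adjElem K v ν ∈ D.spanW K := by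
  induction hy using Submodule.span_induction with
  | mem y hy =>
    obtain ⟨v₁, w₁, v', w', γ, m, p, ν', hγ, hm, hν, rfl⟩ := hy
    by_cases hw : w = v'
    · subst hw
      refine Submodule.subset_span ⟨v₁, w₁, v, w', γ, m, p, ν ++ ν', hγ, hm, h.append hν, ?_⟩
      rw [mul_assoc, D.adjElem_mul_adjElem h.isPath]
    · rw [mul_assoc, D.mul_eq_zero_of_vert_ne K (Ne.symm hw) (D.adjElem_mul_vert v' ν')
        (D.vert_mul_adjElem h.isPath), mul_zero]
      exact zero_mem _
  | zero => rw [zero_mul]; exact zero_mem _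
  | add y z _ _ hy hz => rw [add_mul]; exact add_mem hy hz
  | smul c y _ hy => rw [smul_mul_assoc]; exact Submodule.smul_mem _ c hy

/-- To be a left multiplier of `spanW` is tested on fractional monomials and on steps. -/
theorem mem_multW_of {x : D.Q K} (hm : ∀ p m, D.IsFracMonomial K p m → x * m ∈ D.spanW K)
    (hs : ∀ v u y, D.FracStep K v u y → ∀ z ∈ D.spanW K, x * (y * z) ∈ D.spanW K) :
    x ∈ D.multW K := by
  intro y hy
  induction hy using Submodule.span_induction with
  | mem y hy =>
    obtain ⟨v, w, v', w', γ, m, p, ν, hγ, hmon, hν, rfl⟩ := hy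
    cases hγ with
    | triv =>
      rw [← mul_assoc]
      refine D.mul_adjElem_mem_spanW hν ?_
      obtain ⟨v₀, _, hv₀, -⟩ := IsFracMonomial.exists_vert D hmon
      by_cases hv : v = v₀
      · subst hv
        rw [hv₀]
        exact hm p m hmon
      · rw [D.mul_eq_zero_of_vert_ne K hv (D.q_vert_vert K v) hv₀, mul_zero]
        exact zero_mem _
    | cons h hγ =>
      rw [mul_assoc, mul_assoc]
      refine hs _ _ _ h _ (Submodule.subset_span ⟨_, w, v', w', _, m, p, ν, hγ, hmon, hν, ?_⟩)
      rw [mul_assoc]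
  | zero => rw [mul_zero]; exact zero_mem _
  | add y z _ _ hy hz => rw [mul_add]; exact add_mem hy hz
  | smul c y _ hy => rw [mul_smul_comm]; exact Submodule.smul_mem _ c hy

end Span

/-! ### Left multipliers at regular components -/

section RegMult

variable {K} {p : G.I} (hp : p ∉ D.free)

theorem ratVert_ratVert {v : V} (hv : G.cls v = p) :
    D.ratVert K v hv * D.ratVert K v hv = D.ratVert K v hv := by
  change D.pathToRat K p _ * D.pathToRat K p _ = D.pathToRat K p _
  rw [← map_mul]
  exact congrArg _ (Subtype.ext (D.sg1_vert_vert K v))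

theorem ratToQ_mul_adjElem_mem_spanW (y : D.RatAlg K p) {u v : V} (hu : G.cls u = p)
    (hv : G.cls v = p) {ν : List Ed} (hν : G.IsPath u ν v) :
    D.ratToQ K hp y * D.adjElem K u ν ∈ D.spanW K := by
  have h := D.mem_span_vert_mul hp y
  induction h using Submodule.span_induction with
  | mem y hy =>
    obtain ⟨w, hw, hy⟩ := hy
    rw [← D.vert_mul_adjElem hν, ← D.ratToQ_ratVert hp hv, ← mul_assoc, ← map_mul]
    by_cases h0 : y * D.ratVert K v hv = 0
    · rw [h0, map_zero, zero_mul]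
      exact zero_mem _
    · exact D.monomial_mem_spanW (.reg p hp w v u hw hv hu _
        ⟨h0, by rw [← mul_assoc, hy], by rw [mul_assoc, ratVert_ratVert]⟩ ν hν)
  | zero => rw [map_zero, zero_mul]; exact zero_mem _
  | add y z _ _ hy hz => rw [map_add, add_mul]; exact add_mem hy hz
  | smul c y _ hy => rw [map_smul, smul_mul_assoc]; exact Submodule.smul_mem _ c hy

theorem ratToQ_mul_edge_mul_mem_spanW (y : D.RatAlg K p) {β : Ed} (hs : G.cls (G.s β) = p)
    (hr : G.cls (G.r β) < p) {z : D.Q K} (hz : z ∈ D.spanW K) :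
    D.ratToQ K hp y * (D.q K (.edge β) * z) ∈ D.spanW K := by
  have h := D.mem_span_vert_mul hp y
  induction h using Submodule.span_induction with
  | mem y hy =>
    obtain ⟨w, hw, hy⟩ := hy
    rw [← q_source, ← D.ratToQ_ratVert hp hs, mul_assoc, ← mul_assoc, ← map_mul]
    by_cases h0 : y * D.ratVert K (G.s β) hs = 0
    · rw [h0, map_zero, zero_mul]
      exact zero_mem _
    · rw [← mul_assoc]
      exact D.step_mem_multW (.reg p hp w hw β hs hr _
        ⟨h0, by rw [← mul_assoc, hy], by rw [mul_assoc, ratVert_ratVert]⟩) z hz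
  | zero => rw [map_zero, zero_mul]; exact zero_mem _
  | add y z _ _ hy hz => rw [map_add, add_mul]; exact add_mem hy hz
  | smul c y _ hy => rw [map_smul, smul_mul_assoc]; exact Submodule.smul_mem _ c hy

/-- The criterion `mem_multW_of` for elements that live at a regular component. -/
theorem mem_multW_of_reg {x : D.Q K} (hx : ∀ v, G.cls v ≠ p → x * D.q K (.vert v) = 0)
    (hm : ∀ (y : D.RatAlg K p) (u v : V) (ν : List Ed), G.cls u = p → G.cls v = p →
      G.IsPath u ν v → x * (D.ratToQ K hp y * D.adjElem K u ν) ∈ D.spanW K)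
    (hs : ∀ (y : D.RatAlg K p) (β : Ed), G.cls (G.s β) = p → G.cls (G.r β) < p →
      ∀ z ∈ D.spanW K, x * (D.ratToQ K hp y * (D.q K (.edge β) * z)) ∈ D.spanW K) :
    x ∈ D.multW K := by
  have hx' : ∀ v y, G.cls v ≠ p → D.q K (.vert v) * y = y → x * y = 0 := fun v y hv hy => by
    rw [← hy, ← mul_assoc, hx v hv, zero_mul]
  refine D.mem_multW_of (fun q m hmon => ?_) fun v u y hy z hz => ?_
  · cases hmon with
    | free v f hf a b =>
      rw [hx' v.1 _ (fun h => hp (h ▸ v.2)) (by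
        rw [← mul_assoc, (D.isCornerInv_fracInv K v hf).1])]
      exact zero_mem _
    | reg q hq v v' u hv hv' hu f hf ν hν =>
      by_cases hqp : q = p
      · subst hqp
        exact hm f u v' ν hu hv' hν
      · rw [hx' v _ (hv ▸ hqp) (by
          rw [← mul_assoc, ← D.ratToQ_ratVert hq hv, ← map_mul, hf.2.1])]
        exact zero_mem _
  · by_cases hv : G.cls v = p
    · cases hy with
      | free v f hf i m β hβ => exact (hp (hv ▸ v.2)).elim
      | reg q hq v hv' β hs' hr f hf =>
        obtain rfl : q = p := hv'.symm.trans hv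
        rw [mul_assoc]
        exact hs f β hs' hr z hz
    · rw [hx' v _ hv (by rw [← mul_assoc, hy.vert_mul D])]
      exact zero_mem _

theorem ratToQ_mem_multW (y : D.RatAlg K p) : D.ratToQ K hp y ∈ D.multW K := by
  refine D.mem_multW_of_reg hp (fun v hv => D.ratToQ_mul_vert_of_ne hp hv y) ?_ ?_
  · intro y' u v ν hu hv hν
    rw [← mul_assoc, ← map_mul]
    exact D.ratToQ_mul_adjElem_mem_spanW hp _ hu hv hν
  · intro y' β hs hr z hz
    rw [← mul_assoc, ← map_mul]
    exact D.ratToQ_mul_edge_mul_mem_spanW hp _ hs hr hz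

include hp in
theorem edge_mem_multW_of_reg {e : Ed} (he : G.cls (G.s e) = p) :
    D.q K (.edge e) ∈ D.multW K := by
  have hle : G.cls (G.r e) ≤ p := he ▸ G.cls_r_le e
  rcases hle.eq_or_lt with hr | hr
  · have h := D.ratToQ_mem_multW hp (D.pathToRat K p ⟨_, D.edge_mem_pathAlg K he hr⟩)
    rwa [ratToQ_pathToRat] at h
  · intro z hz
    have h := D.ratToQ_mul_edge_mul_mem_spanW hp (D.ratVert K _ he) he hr hz
    rwa [ratToQ_ratVert, ← mul_assoc, q_source] at h

include hp in
theorem coefQ_mem_multW_of_reg {v : V} (hv : G.cls v = p) (l : L K) :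
    D.coefQ K v l ∈ D.multW K := by
  have h := D.ratToQ_mem_multW hp (D.pathToRat K p ⟨_, D.coef_mem_pathAlg K hv l⟩)
  rwa [ratToQ_pathToRat] at h

end RegMult

/-! ### Left multipliers at free vertices -/

section FreeMult

/-- The product of the elements `α_j ^ a_j (α_j*) ^ b_j`, for `j` in a list, and of `y`. -/
def loopProd (v : D.FreeV) (a b : Fin (D.k v) → ℕ) (l : List (Fin (D.k v))) (y : D.Q K) : D.Q K :=
  l.foldr (fun j y => powMul (D.q K (.edge (D.α v j))) (a j)
    (powMul (D.q K (.star (D.α v j))) (b j) y)) y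

variable (v : D.FreeV)

theorem q_vert_mul_α (i : Fin (D.k v)) :
    D.q K (.vert v.1) * D.q K (.edge (D.α v i)) = D.q K (.edge (D.α v i)) := by
  have := D.q_source K (D.α v i)
  rwa [s_α] at this

theorem q_vert_mul_α_star (i : Fin (D.k v)) :
    D.q K (.vert v.1) * D.q K (.star (D.α v i)) = D.q K (.star (D.α v i)) := by
  have := D.q_star_range K (D.α v i)
  rwa [D.α_loop] at this

theorem q_α_star_mul_vert (i : Fin (D.k v)) :
    D.q K (.star (D.α v i)) * D.q K (.vert v.1) = D.q K (.star (D.α v i)) := by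
  have := D.q_star_source K (D.α v i)
  rwa [s_α] at this

theorem q_α_star_mul_α (i : Fin (D.k v)) :
    D.q K (.star (D.α v i)) * D.q K (.edge (D.α v i)) = D.q K (.vert v.1) := by
  have := D.q_star_edge K (D.α v i)
  rwa [D.α_loop] at this

theorem q_α_comm {i j : Fin (D.k v)} (h : i ≠ j) :
    D.q K (.edge (D.α v i)) * D.q K (.edge (D.α v j)) =
      D.q K (.edge (D.α v j)) * D.q K (.edge (D.α v i)) :=
  D.map_sg_of_rel_mul K (D.sToQ K) (.α_comm v i j h)

theorem q_α_star_comm {i j : Fin (D.k v)} (h : i ≠ j) :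
    D.q K (.edge (D.α v i)) * D.q K (.star (D.α v j)) =
      D.q K (.star (D.α v j)) * D.q K (.edge (D.α v i)) :=
  D.map_sg_of_rel_mul K (D.sToQ K) (.α_star_comm v i j h)

theorem q_star_α_comm {i j : Fin (D.k v)} (h : i ≠ j) :
    D.q K (.star (D.α v i)) * D.q K (.star (D.α v j)) =
      D.q K (.star (D.α v j)) * D.q K (.star (D.α v i)) :=
  D.map_sg_of_rel_mul K (D.sToQ K) (.star_α_comm v i j h)

theorem loopProd_perm (a b : Fin (D.k v) → ℕ) {l l' : List (Fin (D.k v))} (h : l.Perm l')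
    (y : D.Q K) : D.loopProd K v a b l y = D.loopProd K v a b l' y :=
  have : LeftCommutative (fun (j : Fin (D.k v)) (y : D.Q K) =>
      powMul (D.q K (.edge (D.α v j))) (a j) (powMul (D.q K (.star (D.α v j))) (b j) y)) := by
    refine ⟨fun i j y => ?_⟩
    by_cases hij : i = j
    · rw [hij]
    · rw [powMul_comm (D.q_α_star_comm K v (Ne.symm hij)).symm, powMul_comm (D.q_α_comm K v hij),
        powMul_comm (D.q_star_α_comm K v hij), powMul_comm (D.q_α_star_comm K v hij)]
  h.foldr_eq y

theorem vert_mul_loopProd (a b : Fin (D.k v) → ℕ) (l : List (Fin (D.k v))) {y : D.Q K}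
    (hy : D.q K (.vert v.1) * y = y) :
    D.q K (.vert v.1) * D.loopProd K v a b l y = D.loopProd K v a b l y := by
  induction l with
  | nil => exact hy
  | cons i l ih =>
    exact mul_powMul_of_mul_eq (D.q_vert_mul_α K v i)
      (mul_powMul_of_mul_eq (D.q_vert_mul_α_star K v i) ih _) _

theorem loopProd_congr {a b a' b' : Fin (D.k v) → ℕ} {l : List (Fin (D.k v))}
    (ha : ∀ j ∈ l, a j = a' j) (hb : ∀ j ∈ l, b j = b' j) (y : D.Q K) :
    D.loopProd K v a b l y = D.loopProd K v a' b' l y := by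
  induction l with
  | nil => rfl
  | cons i l ih =>
    change powMul _ _ (powMul _ _ (D.loopProd K v a b l y)) =
      powMul _ _ (powMul _ _ (D.loopProd K v a' b' l y))
    rw [ih (fun j hj => ha j (List.mem_cons_of_mem i hj))
      (fun j hj => hb j (List.mem_cons_of_mem i hj)), ha i List.mem_cons_self,
      hb i List.mem_cons_self]

/-- The factors at a given index can be moved to the front. -/
theorem loopProd_finRange (a b : Fin (D.k v) → ℕ) (i : Fin (D.k v)) (y : D.Q K) :
    D.loopProd K v a b (List.finRange (D.k v)) y =
      powMul (D.q K (.edge (D.α v i))) (a i) (powMul (D.q K (.star (D.α v i))) (b i)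
        (D.loopProd K v a b ((List.finRange (D.k v)).erase i) y)) :=
  D.loopProd_perm K v a b (List.perm_cons_erase (List.mem_finRange i)) y

/-- The factors at a given index can be moved to the end. -/
theorem loopProd_finRange' (a b : Fin (D.k v) → ℕ) (i : Fin (D.k v)) (y : D.Q K) :
    D.loopProd K v a b (List.finRange (D.k v)) y =
      D.loopProd K v a b ((List.finRange (D.k v)).erase i)
        (powMul (D.q K (.edge (D.α v i))) (a i) (powMul (D.q K (.star (D.α v i))) (b i) y)) := by
  rw [D.loopProd_perm K v a b ((List.perm_cons_erase (List.mem_finRange i)).trans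
    (List.perm_append_singleton i _).symm), loopProd, List.foldr_append]
  rfl

theorem ne_of_mem_erase_finRange {n : ℕ} {i j : Fin n} (h : j ∈ (List.finRange n).erase i) :
    j ≠ i :=
  ((List.nodup_finRange n).mem_erase_iff.1 h).1

variable {K}

theorem fracInv_mul_loopProd_mem_spanW {f : MvPolynomial (Fin (D.k v)) (L K)}
    (hf : D.IsSigmaPoly K v f) (a b : Fin (D.k v) → ℕ) :
    D.fracInv K v f * D.loopProd K v a b (List.finRange (D.k v)) (D.q K (.vert v.1)) ∈
      D.spanW K :=
  D.monomial_mem_spanW (.free v f hf a b)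

theorem loopProd_mem_spanW (a b : Fin (D.k v) → ℕ) :
    D.loopProd K v a b (List.finRange (D.k v)) (D.q K (.vert v.1)) ∈ D.spanW K := by
  have h := D.fracInv_mul_loopProd_mem_spanW (K := K) v (D.isSigmaPoly_one v) a b
  rwa [fracInv_one, D.vert_mul_loopProd K v a b _ (D.q_vert_vert K v.1)] at h

/-- The criterion `mem_multW_of` for elements that live at a free vertex. -/
theorem mem_multW_of_free {x : D.Q K} (hx : x * D.q K (.vert v.1) = x)
    (hm : ∀ (f : MvPolynomial (Fin (D.k v)) (L K)) (a b : Fin (D.k v) → ℕ), D.IsSigmaPoly K v f →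
      x * (D.fracInv K v f * D.loopProd K v a b (List.finRange (D.k v)) (D.q K (.vert v.1))) ∈
        D.spanW K)
    (hs : ∀ (f : MvPolynomial (Fin (D.k v)) (L K)) (i : Fin (D.k v)) (m : ℕ) (β : Ed),
      D.IsSigmaPoly K v f → D.IsBeta v i β → ∀ z ∈ D.spanW K,
      x * (D.fracInv K v f * powMul (D.q K (.edge (D.α v i))) m (D.q K (.edge β) * z)) ∈
        D.spanW K) : x ∈ D.multW K := by
  refine D.mem_multW_of (fun p m hmon => ?_) fun w u y hy z hz => ?_
  · cases hmon with
    | free w f hf a b =>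
      by_cases hvw : v = w
      · subst hvw
        exact hm f a b hf
      · rw [D.mul_eq_zero_of_vert_ne K (fun h => hvw (Subtype.ext h)) hx (by
          rw [← mul_assoc, (D.isCornerInv_fracInv K w hf).1])]
        exact zero_mem _
    | reg p hp w w' u hw hw' hu f hf ν hν =>
      rw [D.mul_eq_zero_of_vert_ne K (w := w) (fun h => hp (hw ▸ h ▸ v.2)) hx (by
        rw [← mul_assoc, ← D.ratToQ_ratVert hp hw, ← map_mul, hf.2.1])]
      exact zero_mem _
  · by_cases hvw : v.1 = w
    · cases hy with
      | free w f hf i m β hβ =>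
        obtain rfl : v = w := Subtype.ext hvw
        rw [mul_assoc, ← powMul_mul]
        exact hs f i m β hf hβ z hz
      | reg p hp w hw β hs' hr f hf => exact (hp (hw ▸ hvw ▸ v.2)).elim
    · rw [← mul_assoc, D.mul_eq_zero_of_vert_ne K hvw hx (hy.vert_mul D), zero_mul]
      exact zero_mem _

theorem fracInv_mem_multW {f : MvPolynomial (Fin (D.k v)) (L K)} (hf : D.IsSigmaPoly K v f) :
    D.fracInv K v f ∈ D.multW K := by
  refine D.mem_multW_of_free v (D.isCornerInv_fracInv K v hf).2.1 (fun g a b hg => ?_)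
    fun g i m β hg hβ z hz => ?_
  · rw [← mul_assoc, D.fracInv_mul v hf hg]
    exact D.fracInv_mul_loopProd_mem_spanW v (IsSigmaPoly.mul D hg hf) a b
  · rw [← mul_assoc, D.fracInv_mul v hf hg, powMul_mul, ← mul_assoc]
    exact D.step_mem_multW (.free v _ (IsSigmaPoly.mul D hg hf) i m β hβ) z hz

/-- The copies of `L` multiply `spanW` into itself, as the inverse of a non-zero element of `L` can
be absorbed in a denominator. -/
theorem coefQ_mem_multW (w : V) (l : L K) : D.coefQ K w l ∈ D.multW K := by
  by_cases hw : G.cls w ∈ D.free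
  · by_cases hl : l = 0
    · rw [hl, coefQ_zero]
      exact zero_mem _
    · have h := D.fracInv_mem_multW ⟨w, hw⟩ (D.isSigmaPoly_C (inv_ne_zero hl))
      rwa [D.fracInv_C ⟨w, hw⟩ (inv_ne_zero hl), inv_inv] at h
  · exact D.coefQ_mem_multW_of_reg hw rfl l

theorem vert_mem_multW (w : V) : D.q K (.vert w) ∈ D.multW K :=
  D.coefQ_one (K := K) w ▸ D.coefQ_mem_multW w 1

theorem coefQ_t_true (w : V) (n : ℕ) :
    D.coefQ K w (algebraMap (MvPolynomial ℕ K) (L K) (MvPolynomial.X n)) = D.q K (.t w n true) :=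
  congrArg (D.toQ K) (D.coef_t_true w n)

theorem coefQ_t_false (w : V) (n : ℕ) :
    D.coefQ K w (algebraMap (MvPolynomial ℕ K) (L K) (MvPolynomial.X n))⁻¹ =
      D.q K (.t w n false) :=
  congrArg (D.toQ K) (D.coef_t_false w n)

theorem t_mem_multW (w : V) (n : ℕ) (b : Bool) : D.q K (.t w n b) ∈ D.multW K := by
  cases b with
  | true => exact D.coefQ_t_true (K := K) w n ▸ D.coefQ_mem_multW w _
  | false => exact D.coefQ_t_false (K := K) w n ▸ D.coefQ_mem_multW w _

variable {v}

theorem β_mem_multW {i : Fin (D.k v)} {β : Ed} (hβ : D.IsBeta v i β) :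
    D.q K (.edge β) ∈ D.multW K := by
  have h := D.step_mem_multW (.free (K := K) v 1 (D.isSigmaPoly_one v) i 0 β hβ)
  rwa [fracInv_one, powMul_zero, ← hβ.s_eq, q_source] at h

/-- A loop moves to the right past the denominator of a step; in front of a connector `β(p, j, s)`
it is absorbed in the power of the loop, or becomes one of the `t_n` at `r(β)`. -/
theorem α_mem_multW (i : Fin (D.k v)) : D.q K (.edge (D.α v i)) ∈ D.multW K := by
  have hcomm : ∀ f : MvPolynomial (Fin (D.k v)) (L K), D.IsSigmaPoly K v f →
      D.q K (.edge (D.α v i)) * D.fracInv K v f = D.fracInv K v f * D.q K (.edge (D.α v i)) := by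
    intro f hf
    have h := D.isCornerInv_fracInv K v hf
    refine (h.intertwine h (D.q_vert_mul_α K v i) ?_ ?_).symm
    · exact (map_mul (D.toQ K) _ _).symm.trans (congrArg (D.toQ K) (D.α_mul_vert K v i))
    · refine (map_mul (D.toQ K) _ _).symm.trans (Eq.trans (congrArg (D.toQ K) ?_)
        (map_mul (D.toQ K) _ _))
      rw [← αEval_X, ← αEval_mul, mul_comm, αEval_mul]
  refine D.mem_multW_of_free v ?_ (fun f a b hf => ?_) fun f j m β hf hβ z hz => ?_
  · exact (map_mul (D.toQ K) _ _).symm.trans (congrArg (D.toQ K) (D.α_mul_vert K v i))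
  · rw [← mul_assoc, hcomm f hf, mul_assoc]
    have h := D.fracInv_mul_loopProd_mem_spanW v hf (Function.update a i (a i + 1)) b
    rw [D.loopProd_finRange K v _ _ i, Function.update_self, powMul_succ,
      D.loopProd_congr K v (a' := a) (b' := b) (fun j hj => Function.update_of_ne
        (ne_of_mem_erase_finRange hj) _ _) fun _ _ => rfl, ← D.loopProd_finRange K v] at h
    exact h
  · rw [← mul_assoc, hcomm f hf, mul_assoc]
    by_cases hij : i = j
    · subst hij
      rw [← powMul_succ, powMul_mul, ← mul_assoc]
      exact D.step_mem_multW (.free v _ hf i (m + 1) β hβ) z hz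
    · have hrel : D.q K (.edge (D.α v i)) * D.q K (.edge β) =
          D.q K (.edge β) * D.q K (.t (G.r β) (D.sigmaJ v j i) true) :=
        D.map_sg_of_rel_mul K (D.sToQ K) (.α_β v i j β hij hβ)
      rw [mul_powMul_of_comm (D.q_α_comm K v hij), ← mul_assoc (D.q K (.edge (D.α v i))), hrel,
        mul_assoc, powMul_mul, ← mul_assoc]
      exact D.step_mem_multW (.free v _ hf j m β hβ) _ (D.t_mem_multW _ _ _ z hz)

theorem αEval_mem_multW (f : MvPolynomial (Fin (D.k v)) (L K)) :
    D.toQ K (D.αEval K v f) ∈ D.multW K := by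
  induction f using MvPolynomial.induction_on with
  | C l => rw [αEval_C]; exact D.coefQ_mem_multW v.1 l
  | add f g hf hg => rw [αEval_add, map_add]; exact add_mem hf hg
  | mul_X f i hf => rw [αEval_mul, αEval_X, map_mul]; exact mul_mem hf (D.α_mem_multW i)

/-- The element `β*` moves to the right past a denominator, which becomes an element of `L`. -/
theorem β_star_mul_fracInv {i : Fin (D.k v)} {β : Ed} (hβ : D.IsBeta v i β)
    {f : MvPolynomial (Fin (D.k v)) (L K)} (hf : D.IsSigmaPoly K v f) :
    D.q K (.star β) * D.fracInv K v f =
      D.coefQ K (G.r β) (substHom i f)⁻¹ * D.q K (.star β) := by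
  have h := (D.isCornerInv_coef (G.r β) (substHom_ne_zero (hf.2 i))).map (D.toQ K)
  refine (h.intertwine (D.isCornerInv_fracInv K v hf) (D.q_star_range K β) ?_ ?_).symm
  · rw [← hβ.s_eq]; exact D.q_star_source K β
  · refine (map_mul (D.toQ K) _ _).symm.trans (Eq.trans (congrArg (D.toQ K) ?_)
      (map_mul (D.toQ K) _ _))
    exact (D.β_star_mul_αEval hβ f).symm

theorem β_star_mul_α {i : Fin (D.k v)} {β : Ed} (hβ : D.IsBeta v i β) :
    D.q K (.star β) * D.q K (.edge (D.α v i)) = 0 :=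
  D.map_sg_of_rel_zero K (D.sToQ K)
    (.star_edge_ne v.1 _ (X_mem v i) β _ hβ.1 (D.α_mem v i) hβ.2)

theorem β_star_mul_α_of_ne {i j : Fin (D.k v)} {β : Ed} (hβ : D.IsBeta v i β) (hij : j ≠ i) :
    D.q K (.star β) * D.q K (.edge (D.α v j)) =
      D.q K (.t (G.r β) (D.sigmaJ v i j) true) * D.q K (.star β) :=
  D.map_sg_of_rel_mul K (D.sToQ K) (.star_α_star_β v j i β hij hβ)

theorem β_star_mul_α_star_of_ne {i j : Fin (D.k v)} {β : Ed} (hβ : D.IsBeta v i β) (hij : j ≠ i) :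
    D.q K (.star β) * D.q K (.star (D.α v j)) =
      D.q K (.t (G.r β) (D.sigmaJ v i j) false) * D.q K (.star β) :=
  D.map_sg_of_rel_mul K (D.sToQ K) (.star_α_β v j i β hij hβ)

theorem β_star_mul_β {i j : Fin (D.k v)} {β β' : Ed} (hβ : D.IsBeta v i β)
    (hβ' : D.IsBeta v j β') (h : β ≠ β') : D.q K (.star β) * D.q K (.edge β') = 0 := by
  by_cases hij : i = j
  · subst hij
    exact D.map_sg_of_rel_zero K (D.sToQ K)
      (.star_edge_ne v.1 _ (X_mem v i) β _ hβ.1 hβ'.1 h)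
  · exact D.map_sg_of_rel_zero K (D.sToQ K) (.β_orth v i j β β' hij hβ hβ')

theorem vert_mem_spanW (w : V) : D.q K (.vert w) ∈ D.spanW K := by
  by_cases hw : G.cls w ∈ D.free
  · have h := D.loopProd_mem_spanW (K := K) ⟨w, hw⟩ (fun _ => 0) fun _ => 0
    have h0 : ∀ l, D.loopProd K ⟨w, hw⟩ (fun _ => 0) (fun _ => 0) l (D.q K (.vert w)) =
        D.q K (.vert w) := by
      intro l
      induction l with
      | nil => rfl
      | cons i l ih => exact ih
    rwa [h0] at h
  · have h := D.ratToQ_mul_adjElem_mem_spanW hw (D.ratVert K w rfl) rfl rfl (.nil w)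
    rw [ratToQ_ratVert] at h
    exact D.q_vert_vert K w ▸ h

theorem adjElem_mem_spanW {u w : V} {ν : List Ed} (h : D.IsCPath u ν w) :
    D.adjElem K u ν ∈ D.spanW K := by
  rw [← D.vert_mul_adjElem h.isPath]
  exact D.mul_adjElem_mem_spanW h (D.vert_mem_spanW w)

theorem adjElem_replicate_α (i : Fin (D.k v)) (m : ℕ) :
    D.adjElem K v.1 (List.replicate m (D.α v i)) =
      powMul (D.q K (.star (D.α v i))) m (D.q K (.vert v.1)) := by
  induction m with
  | zero => rfl
  | succ m ih => rw [List.replicate_succ', adjElem_concat, ih, powMul_succ]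

theorem β_star_mul_loopProd_mem_spanW {i : Fin (D.k v)} {β : Ed} (hβ : D.IsBeta v i β)
    (a b : Fin (D.k v) → ℕ) :
    D.q K (.star β) * D.loopProd K v a b (List.finRange (D.k v)) (D.q K (.vert v.1)) ∈
      D.spanW K := by
  rw [D.loopProd_finRange' K v a b i]
  have key : ∀ (l : List (Fin (D.k v))) (y : D.Q K), (∀ j ∈ l, j ≠ i) →
      D.q K (.star β) * y ∈ D.spanW K → D.q K (.star β) * D.loopProd K v a b l y ∈ D.spanW K := by
    intro l y hl hy
    induction l with
    | nil => exact hy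
    | cons j l ih =>
      have hj := hl j List.mem_cons_self
      change D.q K (.star β) * powMul _ _ (powMul _ _ (D.loopProd K v a b l y)) ∈ _
      rw [mul_powMul_intertwine (D.β_star_mul_α_of_ne hβ hj),
        mul_powMul_intertwine (D.β_star_mul_α_star_of_ne hβ hj)]
      exact D.powMul_mem_spanW (D.t_mem_multW _ _ _) (D.powMul_mem_spanW (D.t_mem_multW _ _ _)
        (ih fun k hk => hl k (List.mem_cons_of_mem j hk)) _) _
  refine key _ _ (fun j hj => ne_of_mem_erase_finRange hj) ?_
  cases a i with
  | zero =>
    -- `β* (α_i*) ^ b_i` is the adjoint of the c-path `α_i ^ b_i β`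
    have h := D.adjElem_mem_spanW (K := K) (IsCStep.free v i (b i) β hβ).isCPath
    rwa [adjElem_concat, adjElem_replicate_α] at h
  | succ n =>
    rw [powMul_succ, ← mul_assoc, D.β_star_mul_α hβ, zero_mul]
    exact zero_mem _

theorem β_star_mul_powMul_mem_spanW {i j : Fin (D.k v)} {β β' : Ed} (hβ : D.IsBeta v i β)
    (hβ' : D.IsBeta v j β') (m : ℕ) {z : D.Q K} (hz : z ∈ D.spanW K) :
    D.q K (.star β) * powMul (D.q K (.edge (D.α v j))) m (D.q K (.edge β') * z) ∈ D.spanW K := by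
  have h0 : D.q K (.star β) * (D.q K (.edge β') * z) ∈ D.spanW K := by
    rw [← mul_assoc]
    by_cases h : β = β'
    · subst h
      rw [q_star_edge]
      exact D.vert_mem_multW _ z hz
    · rw [D.β_star_mul_β hβ hβ' h, zero_mul]
      exact zero_mem _
  by_cases hij : j = i
  · subst hij
    cases m with
    | zero => exact h0
    | succ m =>
      rw [powMul_succ, ← mul_assoc, D.β_star_mul_α hβ, zero_mul]
      exact zero_mem _
  · rw [mul_powMul_intertwine (D.β_star_mul_α_of_ne hβ hij)]
    exact D.powMul_mem_spanW (D.t_mem_multW _ _ _) h0 m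

theorem β_star_mem_multW {i : Fin (D.k v)} {β : Ed} (hβ : D.IsBeta v i β) :
    D.q K (.star β) ∈ D.multW K := by
  refine D.mem_multW_of_free v ?_ (fun f a b hf => ?_) fun f j m β' hf hβ' z hz => ?_
  · rw [← hβ.s_eq]; exact D.q_star_source K β
  · rw [← mul_assoc, D.β_star_mul_fracInv hβ hf, mul_assoc]
    exact D.coefQ_mem_multW _ _ _ (D.β_star_mul_loopProd_mem_spanW hβ a b)
  · rw [← mul_assoc, D.β_star_mul_fracInv hβ hf, mul_assoc]
    exact D.coefQ_mem_multW _ _ _ (D.β_star_mul_powMul_mem_spanW hβ hβ' m hz)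

theorem α_star_mul_loopProd_mem_spanW (i : Fin (D.k v)) (a b : Fin (D.k v) → ℕ) :
    D.q K (.star (D.α v i)) *
      D.loopProd K v a b (List.finRange (D.k v)) (D.q K (.vert v.1)) ∈ D.spanW K := by
  have hvert := D.q_vert_vert K v.1
  have hR : ∀ n c, D.q K (.vert v.1) * powMul (D.q K (.edge (D.α v i))) n
      (powMul (D.q K (.star (D.α v i))) c (D.loopProd K v a b ((List.finRange (D.k v)).erase i)
        (D.q K (.vert v.1)))) = powMul (D.q K (.edge (D.α v i))) n
      (powMul (D.q K (.star (D.α v i))) c (D.loopProd K v a b ((List.finRange (D.k v)).erase i)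
        (D.q K (.vert v.1)))) := fun n c =>
    mul_powMul_of_mul_eq (D.q_vert_mul_α K v i) (mul_powMul_of_mul_eq (D.q_vert_mul_α_star K v i)
      (D.vert_mul_loopProd K v a b _ hvert) c) n
  have hmem : ∀ n c, powMul (D.q K (.edge (D.α v i))) n
      (powMul (D.q K (.star (D.α v i))) c (D.loopProd K v a b ((List.finRange (D.k v)).erase i)
        (D.q K (.vert v.1)))) ∈ D.spanW K := fun n c => by
    have h := D.loopProd_mem_spanW (K := K) v (Function.update a i n) (Function.update b i c)
    rwa [D.loopProd_finRange K v _ _ i, Function.update_self, Function.update_self,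
      D.loopProd_congr K v (a' := a) (b' := b)
        (fun j hj => Function.update_of_ne (ne_of_mem_erase_finRange hj) _ _)
        (fun j hj => Function.update_of_ne (ne_of_mem_erase_finRange hj) _ _)] at h
  rw [D.loopProd_finRange K v a b i]
  cases a i with
  | zero =>
    have h := hmem 0 (b i + 1)
    rw [powMul_zero, powMul_succ] at h
    rwa [powMul_zero]
  | succ n =>
    rw [powMul_succ, ← mul_assoc, q_α_star_mul_α, hR]
    exact hmem n (b i)

theorem α_star_mul_powMul_mem_spanW (i : Fin (D.k v)) {j : Fin (D.k v)} {β : Ed}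
    (hβ : D.IsBeta v j β) (m : ℕ) {z : D.Q K} (hz : z ∈ D.spanW K) :
    D.q K (.star (D.α v i)) * powMul (D.q K (.edge (D.α v j))) m (D.q K (.edge β) * z) ∈
      D.spanW K := by
  by_cases hij : i = j
  · subst hij
    cases m with
    | zero =>
      have h : D.q K (.star (D.α v i)) * D.q K (.edge β) = 0 :=
        D.map_sg_of_rel_zero K (D.sToQ K)
          (.star_edge_ne v.1 _ (X_mem v i) _ β (D.α_mem v i) hβ.1 (Ne.symm hβ.2))
      rw [powMul_zero, ← mul_assoc, h, zero_mul]
      exact zero_mem _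
    | succ m =>
      rw [powMul_succ, ← mul_assoc, q_α_star_mul_α]
      exact D.vert_mem_multW _ _
        (D.powMul_mem_spanW (D.α_mem_multW i) (D.β_mem_multW hβ z hz) m)
  · have hrel : D.q K (.star (D.α v i)) * D.q K (.edge β) =
        D.q K (.edge β) * D.q K (.t (G.r β) (D.sigmaJ v j i) false) :=
      D.map_sg_of_rel_mul K (D.sToQ K) (.α_star_β v i j β hij hβ)
    rw [mul_powMul_of_comm (D.q_α_star_comm K v (Ne.symm hij)).symm, ← mul_assoc, hrel, mul_assoc]
    exact D.powMul_mem_spanW (D.α_mem_multW j)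
      (D.β_mem_multW hβ _ (D.t_mem_multW _ _ _ z hz)) m

/-- The commutator of `α_i*` with a polynomial in the loops, multiplied by the inverse of the
polynomial from both sides. -/
theorem α_star_mul_fracInv (i : Fin (D.k v)) {f : MvPolynomial (Fin (D.k v)) (L K)}
    (hf : D.IsSigmaPoly K v f) : ∃ (g : MvPolynomial (Fin (D.k v)) (L K)) (s : Finset Ed),
      (∀ e ∈ s, D.IsBeta v i e) ∧ D.q K (.star (D.α v i)) * D.fracInv K v f =
        D.fracInv K v f * D.q K (.star (D.α v i)) - D.fracInv K v f * D.toQ K (D.αEval K v g) *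
          (∑ e ∈ s, D.q K (.edge e) * D.q K (.star e)) * D.fracInv K v f := by
  obtain ⟨g, hg⟩ := D.α_star_mul_αEval (K := K) i f
  obtain ⟨s, hs, hsum⟩ := D.sum_β_mul_β_star K i
  refine ⟨g, s, hs, ?_⟩
  rw [hsum] at hg
  have h := congrArg (D.toQ K) hg
  simp only [map_add, map_mul, map_sum] at h
  change D.q K (.star (D.α v i)) * D.toQ K (D.αEval K v f) =
    D.toQ K (D.αEval K v f) * D.q K (.star (D.α v i)) + D.toQ K (D.αEval K v g) *
      ∑ e ∈ s, D.q K (.edge e) * D.q K (.star e) at h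
  obtain ⟨h1, h2, h3, h4⟩ := D.isCornerInv_fracInv K v hf
  have h5 : D.fracInv K v f * (D.q K (.star (D.α v i)) * D.toQ K (D.αEval K v f)) *
      D.fracInv K v f = D.fracInv K v f * D.q K (.star (D.α v i)) := by
    rw [mul_assoc, mul_assoc, h3, q_α_star_mul_vert]
  have h6 : D.fracInv K v f * (D.toQ K (D.αEval K v f) * D.q K (.star (D.α v i))) *
      D.fracInv K v f = D.q K (.star (D.α v i)) * D.fracInv K v f := by
    rw [← mul_assoc, h4, q_vert_mul_α_star]
  rw [← h5, h, mul_add, add_mul, h6]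
  simp only [mul_assoc]
  rw [add_sub_cancel_right]

theorem α_star_mem_multW (i : Fin (D.k v)) : D.q K (.star (D.α v i)) ∈ D.multW K := by
  have key : ∀ (f : MvPolynomial (Fin (D.k v)) (L K)), D.IsSigmaPoly K v f → ∀ y : D.Q K,
      D.q K (.star (D.α v i)) * y ∈ D.spanW K → D.fracInv K v f * y ∈ D.spanW K →
      D.q K (.star (D.α v i)) * (D.fracInv K v f * y) ∈ D.spanW K := by
    intro f hf y hy hy'
    obtain ⟨g, s, hs, h⟩ := D.α_star_mul_fracInv i hf
    have hfm := D.fracInv_mem_multW v hf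
    have e : D.q K (.star (D.α v i)) * (D.fracInv K v f * y) =
        D.fracInv K v f * (D.q K (.star (D.α v i)) * y) - D.fracInv K v f *
          (D.toQ K (D.αEval K v g) *
            ((∑ e ∈ s, D.q K (.edge e) * D.q K (.star e)) * (D.fracInv K v f * y))) := by
      rw [← mul_assoc, h, sub_mul, mul_assoc, mul_assoc, mul_assoc, mul_assoc]
    rw [e]
    refine sub_mem (hfm _ hy) (hfm _ (D.αEval_mem_multW g _ ?_))
    refine (D.multW K).toSubmodule.sum_mem (fun e he => ?_) _ hy'
    exact (D.multW K).mul_mem (D.β_mem_multW (hs e he)) (D.β_star_mem_multW (hs e he))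
  refine D.mem_multW_of_free v (D.q_α_star_mul_vert K v i) (fun f a b hf => ?_)
    fun f j m β hf hβ z hz => ?_
  · exact key f hf _ (D.α_star_mul_loopProd_mem_spanW i a b)
      (D.fracInv_mul_loopProd_mem_spanW v hf a b)
  · refine key f hf _ (D.α_star_mul_powMul_mem_spanW i hβ m hz) ?_
    rw [powMul_mul, ← mul_assoc]
    exact D.step_mem_multW (.free v f hf j m β hβ) z hz

theorem eq_α_or_isBeta {e : Ed} (he : G.cls (G.s e) ∈ D.free) :
    ∃ i, e = D.α ⟨G.s e, he⟩ i ∨ D.IsBeta ⟨G.s e, he⟩ i e := by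
  obtain ⟨X, ⟨hX, heX⟩, -⟩ := G.existsUnique_part e
  rw [← D.free_range ⟨G.s e, he⟩] at hX
  obtain ⟨i, rfl⟩ := hX
  exact ⟨i, or_iff_not_imp_left.2 fun h => ⟨heX, h⟩⟩

end FreeMult

/-! ### Adjoints of edges at regular components -/

section RegStar

variable {K} {p : G.I} (hp : p ∉ D.free)

include hp in
theorem star_mem_multW_of_reg {e : Ed} (he : G.cls (G.s e) = p) :
    D.q K (.star e) ∈ D.multW K := by
  have hle : G.cls (G.r e) ≤ p := he ▸ G.cls_r_le e
  have htail : ∀ z ∈ D.ratTailSub K hp e, z ∈ D.multW K := by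
    rintro _ ⟨⟨y, rfl⟩, -⟩
    exact D.ratToQ_mem_multW hp y
  have key : ∀ (y : D.RatAlg K p) (w : D.Q K), D.q K (.star e) * w ∈ D.spanW K → w ∈ D.spanW K →
      D.q K (.star e) * (D.ratToQ K hp y * w) ∈ D.spanW K := by
    intro y w hw hw'
    obtain ⟨l, hl⟩ := D.star_mul_ratToQ hp e he y
    have h := add_mem (htail _ hl w hw') (D.coefQ_mem_multW (G.r e) l _ hw)
    rwa [← mul_assoc, ← add_mul, sub_add_cancel, mul_assoc] at h
  refine D.mem_multW_of_reg hp (fun v hv => ?_) (fun y u v ν hu hv hν => ?_)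
    fun y β hs hr z hz => ?_
  · exact D.mul_eq_zero_of_vert_ne K (fun h : G.s e = v => hv (h ▸ he)) (D.q_star_source K e)
      (D.q_vert_vert K v)
  · have hν' : D.adjElem K u ν ∈ D.spanW K := by
      have h := D.ratToQ_mul_adjElem_mem_spanW (K := K) hp (D.ratVert K v hv) hu hv hν
      rwa [ratToQ_ratVert, D.vert_mul_adjElem hν] at h
    refine key y _ ?_ hν'
    by_cases hsv : G.s e = v
    · subst hsv
      rw [← adjElem_concat]
      rcases hle.eq_or_lt with hr | hr
      · have hpath : G.IsPath u (ν ++ [e]) (G.r e) := hν.append (.cons e (.nil _))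
        have h := D.ratToQ_mul_adjElem_mem_spanW (K := K) hp (D.ratVert K _ hr) hu hr hpath
        rwa [ratToQ_ratVert, D.vert_mul_adjElem hpath] at h
      · exact D.adjElem_mem_spanW (IsCStep.reg u (hu ▸ hp) ν e (he.trans hu.symm)
          (hu ▸ hr) hν).isCPath
    · rw [D.mul_eq_zero_of_vert_ne K hsv (D.q_star_source K e) (D.vert_mul_adjElem hν)]
      exact zero_mem _
  · refine key y _ ?_ (D.edge_mem_multW_of_reg hp hs z hz)
    rw [← mul_assoc]
    by_cases h : e = β
    · subst h
      rw [q_star_edge]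
      exact D.vert_mem_multW _ z hz
    · have h0 : D.q K (.star e) * D.q K (.edge β) = 0 :=
        (map_mul (D.toQ K) _ _).symm.trans ((congrArg (D.toQ K)
          (D.star_mul_edge_of_reg K (he ▸ hp) h)).trans (map_zero (D.toQ K)))
      rw [h0, zero_mul]
      exact zero_mem _

end RegStar

/-! ### The spanning set -/

section Main

variable {K}

theorem gen_mem_multW (x : Gen V Ed) : D.q K x ∈ D.multW K := by
  cases x with
  | vert v => exact D.vert_mem_multW v
  | edge e =>
    by_cases he : G.cls (G.s e) ∈ D.free
    · obtain ⟨i, h | h⟩ := D.eq_α_or_isBeta he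
      · rw [h]
        exact D.α_mem_multW i
      · exact D.β_mem_multW h
    · exact D.edge_mem_multW_of_reg he rfl
  | star e =>
    by_cases he : G.cls (G.s e) ∈ D.free
    · obtain ⟨i, h | h⟩ := D.eq_α_or_isBeta he
      · rw [h]
        exact D.α_star_mem_multW i
      · exact D.β_star_mem_multW h
    · exact D.star_mem_multW_of_reg he rfl
  | t v n b => exact D.t_mem_multW v n b

theorem mem_multW (x : D.Q K) : x ∈ D.multW K :=
  D.q_mem (D.multW K) D.gen_mem_multW D.coefQ_mem_multW (fun v _ hf => D.fracInv_mem_multW v hf)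
    (fun _ hp y _ _ => D.ratToQ_mem_multW hp y) x

/-- The left ideal `spanW` contains the vertices, hence all elements that are fixed from the right
by a sum of vertices, and so all generators. -/
theorem mem_spanW (x : D.Q K) : x ∈ D.spanW K := by
  have hvert : ∀ (x : D.Q K) (v : V), x * D.q K (.vert v) = x → x ∈ D.spanW K := fun x v h =>
    h ▸ D.mem_multW x _ (D.vert_mem_spanW v)
  let T : NonUnitalSubalgebra K (D.Q K) :=
    { D.spanW K with mul_mem' := fun {a b} _ hb => D.mem_multW a b hb }
  refine D.q_mem T (fun g => ?_) (fun v l => hvert _ v (D.coefQ_mul_vert v l))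
    (fun v f hf => hvert _ v.1 (D.isCornerInv_fracInv K v hf).2.1) (fun p hp y s h => ?_) x
  · cases g with
    | vert v => exact hvert _ v (D.q_vert_vert K v)
    | edge e => exact hvert _ _ (D.q_range K e)
    | star e => exact hvert _ _ (D.q_star_source K e)
    | t v n b => exact hvert _ v (D.map_sg_of_rel K (D.sToQ K) (.t_vert v n b))
  · rw [← h]
    exact D.mem_multW _ _ (sum_mem fun v _ => D.vert_mem_spanW v)

end Main

end Adaptable

end SepGraph

end

theorem theorem2 {V Ed K : Type*} [Field K] (G : SepGraph V Ed) (D : G.Adaptable) :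
    Submodule.span K
      {x : D.Q K | ∃ (v w v' w' : V) (γ m : D.Q K) (p : G.I) (ν : List Ed),
        D.IsFracCPath K v w γ ∧ D.IsFracMonomial K p m ∧ D.IsCPath v' ν w' ∧
        x = γ * m * D.adjElem K v' ν} = ⊤ :=
  Submodule.eq_top_iff'.2 D.mem_spanW
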